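/- **Linear representations from rational actions.** Let $k$ be a field with algebraic closure $\bar k$. Let $G$ be a connected smooth algebraic group over $k$ with unit $e$, and let $X$ be a normal, projective, geometrically integral $k$-variety; assume that $k$ is perfect or, more generally, that $X_{\bar k}$ is normal. Let $\mu: G\times X\dashrightarrow X$ be a rational action, that is, a rational map over $k$ that is defined at $(e,x)$ with $\mu(e,x)=x$ for $x$ in a dense open subset of $X$, and such that $\mu(g_1g_2,x)=\mu(g_1,\mu(g_2,x))$ (all terms being defined) for $(g_1,g_2,x)$ in a dense open subset of $G\times G\times X$. For $g\in G(\bar k)$ let $\mu_g:=\mu(g,\cdot\,): X_{\bar k}\dashrightarrow X_{\bar k}$. Let $|D|$ be a (not necessarily complete) linear system of Weil divisors on $X$ without fixed components, given by a Weil divisor $D$ and a nonzero finite-dimensional $k$-subspace $V\subset k(X)$; its members are the effective divisors $D+\operatorname{div} f$, $0\ne f\in V$. Put $V_{\bar k}:=V\otimes_k\bar k\subset \bar k(X_{\bar k})$. A nonzero finite-dimensional $\bar k$-subspace $W\subset\bar k(X_{\bar k})$ determines a unique linear system $|W|$ without fixed components on $X_{\bar k}$, whose members are the divisors $\operatorname{div}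 f-\min_{0\neq h\in W}\operatorname{div} h$, $0\neq f\in W$; thus $|D|_{\bar k}=|V_{\bar k}|$. If $\mu_g$ is defined and birational, the birational transform of $|D|_{\bar k}$ is $(\mu_g)_*|D|_{\bar k}:=|(\mu_g^*)^{-1}V_{\bar k}|$, and $(\mu_g)_*$ also denotes the bijection of $|D|_{\bar k}$ onto it that sends the member given by $f$ to the member given by $(\mu_g^*)^{-1}f$. Assume that there is a dense open subset $U\subset G$ such that for every $g\in U(\bar k)$ the rational map $\mu_g$ is defined and birational, and $(\mu_g)_*|D|_{\bar k}=|D|_{\bar k}$. Let $N:=\dim V=\dim|D|+1$, and use a $k$-basis of $V$ to identify the automorphism group $\operatorname{Aut}(|D|)$ of the projective space $|D|$ with $\mathrm{PGL}_N$, regarded as an algebraic group over $k$ (the automorphism group scheme of the matrix algebra $\mathrm{Mat}_N$). Then there is a unique homomorphism of algebraic groups over $k$ (everywhere defined) $$\tau_{|D|}: G\to \operatorname{Aut}(|D|)\cong \mathrm{PGL}_N$$ such that, for every $g\in G(\bar k)$ for which $\mu_g$ is defined and birational, $(\mu_g)_*|D|_{\bar k}=|D|_{\bar k}$ and $\tau_{|D|}(g)$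 is the automorphism $(\mu_g)_*$ of $|D|_{\bar k}$. -/

import Mathlib

open CategoryTheory Limits AlgebraicGeometry MonoidalCategory

universe u

noncomputable section

namespace LinRep

section PGL

variable {N : ℕ} {R S : Type*} [CommRing R] [CommRing S]

/-- The `R`-linear endomorphism of the matrix algebra `Mat_N(R)` whose matrix with respect to the
standard basis `E_{ij}` is `a`. -/
def act (a : Matrix (Fin N × Fin N) (Fin N × Fin N) R) (x : Matrix (Fin N) (Fin N) R) :
    Matrix (Fin N) (Fin N) R :=
  Matrix.of fun i j => ∑ q, a (i, j) q * x q.1 q.2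

/-- The image of the basis vector `E_q` under `act a`, i.e. the column `q` of `a`. -/
def img (a : Matrix (Fin N × Fin N) (Fin N × Fin N) R) (q : Fin N × Fin N) :
    Matrix (Fin N) (Fin N) R :=
  Matrix.of fun i j => a (i, j) q

/-- The linear endomorphism `act a` of `Mat_N(R)` is a homomorphism of (unital) `R`-algebras. -/
def IsAlgHom (a : Matrix (Fin N × Fin N) (Fin N × Fin N) R) : Prop :=
  act a 1 = 1 ∧ ∀ x y, act a (x * y) = act a x * act a y

lemma act_one (x : Matrix (Fin N) (Fin N) R) : act 1 x = x := by
  ext i j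
  simp [act, Matrix.one_apply]

lemma act_mul (a b : Matrix (Fin N × Fin N) (Fin N × Fin N) R) (x : Matrix (Fin N) (Fin N) R) :
    act (a * b) x = act a (act b x) := by
  ext i j
  simp only [act, Matrix.of_apply, Matrix.mul_apply, Finset.sum_mul, Finset.mul_sum, mul_assoc]
  rw [Finset.sum_comm]

/-- The group `PGL_N(R)` of `R`-algebra automorphisms of `Mat_N(R)`, as a group of invertible
`N² × N²` matrices. -/
def PGLPoints (N : ℕ) (R : Type*) [CommRing R] : Subgroup (GL (Fin N × Fin N) R) where
  carrier := {a | IsAlgHom a.1}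
  one_mem' := by simp [IsAlgHom, act_one]
  mul_mem' := by
    rintro a b ⟨ha, ha'⟩ ⟨hb, hb'⟩
    refine ⟨?_, fun x y => ?_⟩
    · rw [Units.val_mul, act_mul, hb, ha]
    · rw [Units.val_mul, act_mul, hb', ha', ← act_mul, ← act_mul]
  inv_mem' := by
    rintro a ⟨ha, ha'⟩
    have h1 : ∀ x, act a.1 (act (a⁻¹).1 x) = x := fun x => by
      rw [← act_mul, ← Units.val_mul]; simp [act_one]
    have h2 : ∀ x, act (a⁻¹).1 (act a.1 x) = x := fun x => by
      rw [← act_mul, ← Units.val_mul]; simp [act_one]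
    refine ⟨?_, fun x y => ?_⟩
    · conv_lhs => rw [← ha, h2]
    · conv_lhs => rw [← h1 x, ← h1 y, ← ha', h2]

lemma isAlgHom_iff (a : Matrix (Fin N × Fin N) (Fin N × Fin N) R) :
    IsAlgHom a ↔ ∑ l, img a (l, l) = 1 ∧
      ∀ p q, img a p * img a q = if p.2 = q.1 then img a (p.1, q.2) else 0 := by
  have hact : ∀ x, act a x = ∑ q : Fin N × Fin N, x q.1 q.2 • img a q := by
    intro x
    ext i j
    simp [act, img, Matrix.sum_apply, mul_comm]
  have himg : ∀ i j, act a (Matrix.single i j 1) = img a (i, j) := by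
    intro i j
    rw [hact, Finset.sum_eq_single (i, j)]
    · simp
    · rintro ⟨i', j'⟩ - h
      rw [Matrix.single_apply_of_ne, zero_smul]
      rintro ⟨rfl, rfl⟩
      exact h rfl
    · simp
  have hone : act a 1 = ∑ l, img a (l, l) := by
    rw [hact, Fintype.sum_prod_type]
    simp [Matrix.one_apply]
  refine and_congr (by rw [hone]) ⟨fun h p q => ?_, fun h x y => ?_⟩
  · rw [← himg, ← himg, ← h]
    split_ifs with hpq
    · rw [hpq, Matrix.single_mul_single_same, _root_.mul_one, himg]
    · rw [Matrix.single_mul_single_of_ne _ _ _ _ hpq]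
      ext; simp [act]
  · rw [hact, hact x, hact y, Finset.sum_mul_sum]
    simp only [smul_mul_smul_comm, h, Fintype.sum_prod_type, smul_ite, smul_zero,
      Matrix.mul_apply, Finset.sum_smul]
    refine Finset.sum_congr rfl fun i _ => ?_
    rw [Finset.sum_comm]
    refine Finset.sum_congr rfl fun j _ => ?_
    rw [Finset.sum_comm]
    simp

lemma img_map (f : R →+* S) (a : Matrix (Fin N × Fin N) (Fin N × Fin N) R) (q : Fin N × Fin N) :
    img (a.map f) q = (img a q).map f := rfl

lemma IsAlgHom.map (f : R →+* S) {a : Matrix (Fin N × Fin N) (Fin N × Fin N) R}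
    (h : IsAlgHom a) : IsAlgHom (a.map f) := by
  rw [isAlgHom_iff] at h ⊢
  refine ⟨?_, fun p q => ?_⟩
  · have := congrArg f.mapMatrix h.1
    simpa [map_sum, img_map] using this
  · have := congrArg f.mapMatrix (h.2 p q)
    rw [map_mul] at this
    simp only [img_map]
    refine this.trans ?_
    split_ifs <;> simp

/-- Functoriality of `PGL_N(R)` in the ring `R`. -/
def PGLPoints.map (f : R →+* S) : PGLPoints N R →* PGLPoints N S :=
  ((Matrix.GeneralLinearGroup.map f).comp (PGLPoints N R).subtype).codRestrict _
    fun a => a.2.map f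

end PGL

section PGLScheme

open Opposite

variable (k : Type u) [Field k] (N : ℕ)

/-- The polynomial ring in the entries of two `N² × N²` matrices. -/
abbrev PGLPoly : Type u :=
  MvPolynomial (Bool × (Fin N × Fin N) × (Fin N × Fin N)) k

/-- One of the two matrices of indeterminates. -/
def genMat (b : Bool) : Matrix (Fin N × Fin N) (Fin N × Fin N) (PGLPoly k N) :=
  Matrix.of fun p q => MvPolynomial.X (b, p, q)

/-- The equations saying that the two matrices are inverse to each other and that the first one
is an endomorphism of the algebra of `N × N` matrices. -/
def PGLRel : Set (PGLPoly k N) :=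
  {r | ∃ p q, r = (genMat k N true * genMat k N false - 1) p q} ∪
  {r | ∃ p q, r = (genMat k N false * genMat k N true - 1) p q} ∪
  {r | ∃ i j, r = (∑ l, img (genMat k N true) (l, l) - 1) i j} ∪
  {r | ∃ p q i j, r = (img (genMat k N true) p * img (genMat k N true) q -
    if p.2 = q.1 then img (genMat k N true) (p.1, q.2) else 0) i j}

/-- The coordinate ring of the algebraic group `PGL_N` over `k`. -/
abbrev PGLRing : Type u := PGLPoly k N ⧸ Ideal.span (PGLRel k N)

/-- The algebraic group `PGL_N` over `k`, realized as the automorphism group of the algebra of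
`N × N` matrices. -/
def PGL : Over (Spec (.of k)) :=
  Over.mk (Spec.map (CommRingCat.ofHom (algebraMap k (PGLRing k N))))

variable {k N}

/-- Evaluate a polynomial at two matrices with entries in a ring under `k`. -/
def evalAt {R : Type u} [CommRing R] (s : k →+* R)
    (a b : Matrix (Fin N × Fin N) (Fin N × Fin N) R) : PGLPoly k N →+* R :=
  MvPolynomial.eval₂Hom s fun x => (cond x.1 a b) x.2.1 x.2.2

lemma genMat_map_evalAt {R : Type u} [CommRing R] (s : k →+* R)
    (a b : Matrix (Fin N × Fin N) (Fin N × Fin N) R) (c : Bool) :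
    (genMat k N c).map (evalAt s a b) = cond c a b := by
  ext p q
  simp [genMat, evalAt]

lemma evalAt_rel {R : Type u} [CommRing R] (s : k →+* R) (a : PGLPoints N R)
    (r : PGLPoly k N) (hr : r ∈ Ideal.span (PGLRel k N)) :
    evalAt s a.1.1 (a.1⁻¹).1 r = 0 := by
  have h := (isAlgHom_iff _).1 a.2
  set e := evalAt s a.1.1 (a.1⁻¹).1 with he
  have ht : (genMat k N true).map e = a.1.1 := genMat_map_evalAt s _ _ true
  have hf : (genMat k N false).map e = (a.1⁻¹).1 := genMat_map_evalAt s _ _ false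
  have hent : ∀ {m : Type} [Fintype m] [DecidableEq m] (x : Matrix m m (PGLPoly k N)) (y : Matrix m m R) (i j : m),
      x.map e = y → e (x i j) = y i j := fun x y i j h => by rw [← h]; rfl
  suffices Ideal.span (PGLRel k N) ≤ RingHom.ker e from this hr
  rw [Ideal.span_le]
  rintro r (((⟨p, q, rfl⟩ | ⟨p, q, rfl⟩) | ⟨i, j, rfl⟩) | ⟨p, q, i, j, rfl⟩)
  · refine hent _ 0 p q ?_
    change e.mapMatrix _ = _
    rw [map_sub, map_mul, map_one, RingHom.mapMatrix_apply, RingHom.mapMatrix_apply, ht, hf,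
      ← Units.val_mul]
    simp
  · refine hent _ 0 p q ?_
    change e.mapMatrix _ = _
    rw [map_sub, map_mul, map_one, RingHom.mapMatrix_apply, RingHom.mapMatrix_apply, ht, hf,
      ← Units.val_mul]
    simp
  · refine hent _ 0 i j ?_
    change e.mapMatrix _ = _
    rw [map_sub, map_sum, map_one]
    simp only [RingHom.mapMatrix_apply, ← img_map, ht, h.1, sub_self]
  · refine hent _ 0 i j ?_
    change e.mapMatrix _ = _
    rw [map_sub, map_mul, apply_ite e.mapMatrix, map_zero]
    simp only [RingHom.mapMatrix_apply, ← img_map, ht, h.2, sub_self]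

/-- The `PGL_N(R)`-point defined by a ring homomorphism from the coordinate ring. -/
def pointOfHom {R : Type u} [CommRing R] (f : PGLRing k N →+* R) : PGLPoints N R :=
  have hent : ∀ {m : Type} [Fintype m] [DecidableEq m] (x : Matrix m m (PGLPoly k N)),
      (∀ i j, x i j ∈ PGLRel k N) →
        (f.comp (Ideal.Quotient.mk _)).mapMatrix x = 0 := fun x h => by
    ext i j
    change f (Ideal.Quotient.mk _ (x i j)) = 0
    rw [Ideal.Quotient.eq_zero_iff_mem.2 (Ideal.subset_span (h i j)), map_zero]
  ⟨⟨(f.comp (Ideal.Quotient.mk _)).mapMatrix (genMat k N true),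
    (f.comp (Ideal.Quotient.mk _)).mapMatrix (genMat k N false), by
      rw [← map_mul, ← sub_eq_zero, ← map_one (f.comp (Ideal.Quotient.mk _)).mapMatrix, ← map_sub]
      exact hent _ fun i j => .inl (.inl (.inl ⟨i, j, rfl⟩)), by
      rw [← map_mul, ← sub_eq_zero, ← map_one (f.comp (Ideal.Quotient.mk _)).mapMatrix, ← map_sub]
      exact hent _ fun i j => .inl (.inl (.inr ⟨i, j, rfl⟩))⟩, by
    refine (isAlgHom_iff _).2 ⟨?_, fun p q => ?_⟩
    · have := hent (∑ l, img (genMat k N true) (l, l) - 1) fun i j => .inl (.inr ⟨i, j, rfl⟩)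
      rw [map_sub, map_sum, map_one, sub_eq_zero] at this
      exact this
    · have := hent _ fun i j => .inr ⟨p, q, i, j, rfl⟩
      rw [map_sub, map_mul, apply_ite (f.comp (Ideal.Quotient.mk _)).mapMatrix, map_zero,
        sub_eq_zero] at this
      exact this⟩

/-- The ring homomorphism from the coordinate ring defined by a point of `PGL_N(R)`. -/
def homOfPoint {R : Type u} [CommRing R] (s : k →+* R) (a : PGLPoints N R) :
    PGLRing k N →+* R :=
  Ideal.Quotient.lift _ (evalAt s a.1.1 (a.1⁻¹).1) fun r hr => evalAt_rel s a r hr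

lemma homOfPoint_algebraMap {R : Type u} [CommRing R] (s : k →+* R) (a : PGLPoints N R) :
    (homOfPoint s a).comp (algebraMap k (PGLRing k N)) = s := by
  ext x
  change evalAt s a.1.1 (a.1⁻¹).1 (MvPolynomial.C x) = s x
  simp [evalAt]

lemma pointOfHom_homOfPoint {R : Type u} [CommRing R] (s : k →+* R) (a : PGLPoints N R) :
    pointOfHom (homOfPoint s a) = a :=
  Subtype.ext (Units.ext (genMat_map_evalAt s _ _ true))

lemma homOfPoint_pointOfHom {R : Type u} [CommRing R] (s : k →+* R) (f : PGLRing k N →+* R)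
    (hf : f.comp (algebraMap k (PGLRing k N)) = s) : homOfPoint s (pointOfHom f) = f := by
  refine Ideal.Quotient.ringHom_ext (MvPolynomial.ringHom_ext (fun x => ?_) ?_)
  · exact (DFunLike.congr_fun (homOfPoint_algebraMap s (pointOfHom f)) x).trans
      (DFunLike.congr_fun hf x).symm
  · rintro ⟨b, p, q⟩
    have h : (homOfPoint s (pointOfHom f)) (Ideal.Quotient.mk _ (MvPolynomial.X (b, p, q))) =
        (cond b (pointOfHom f).1.1 ((pointOfHom f).1⁻¹).1) p q :=
      congrFun (congrFun (genMat_map_evalAt s (pointOfHom f).1.1 ((pointOfHom f).1⁻¹).1 b) p) q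
    refine h.trans ?_
    cases b <;> rfl

lemma pointOfHom_comp {R S : Type u} [CommRing R] [CommRing S] (g : R →+* S)
    (f : PGLRing k N →+* R) : pointOfHom (g.comp f) = PGLPoints.map g (pointOfHom f) :=
  rfl

variable (k N)

/-- The functor of points `T ↦ PGL_N(Γ(T, 𝒪_T))` on schemes over `k`. -/
def PGLFunctor : (Over (Spec (.of k)))ᵒᵖ ⥤ GrpCat.{u} where
  obj T := GrpCat.of (PGLPoints N Γ(T.unop.left, ⊤))
  map f := GrpCat.ofHom (PGLPoints.map f.unop.left.appTop.hom)
  map_id T := by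
    refine GrpCat.hom_ext (MonoidHom.ext fun a => Subtype.ext (Units.ext ?_))
    ext p q
    simp [PGLPoints.map]
  map_comp f g := by
    refine GrpCat.hom_ext (MonoidHom.ext fun a => Subtype.ext (Units.ext ?_))
    ext p q
    change ((f ≫ g).unop.left.appTop).hom (a.1.1 p q) =
      g.unop.left.appTop.hom (f.unop.left.appTop.hom (a.1.1 p q))
    rw [unop_comp, Over.comp_left, Scheme.Hom.comp_appTop]
    rfl

/-- The structure homomorphism `k → Γ(T, 𝒪_T)` of a scheme over `k`. -/
def structHom {k : Type u} [Field k] (T : Over (Spec (.of k))) : k →+* Γ(T.left, ⊤) :=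
  ((Scheme.ΓSpecIso (.of k)).inv ≫ T.hom.appTop).hom

lemma toSpecΓ_structHom {k : Type u} [Field k] (T : Over (Spec (.of k))) :
    T.left.toSpecΓ ≫ Spec.map (CommRingCat.ofHom (structHom T)) = T.hom := by
  simp [structHom, ← Scheme.toSpecΓ_naturality_assoc]

variable {k N}

/-- The morphism `T → PGL_N` defined by a point of `PGL_N(Γ(T, 𝒪_T))`. -/
def PGL.ofPoint (T : Over (Spec (.of k))) (a : PGLPoints N Γ(T.left, ⊤)) : T ⟶ PGL k N :=
  Over.homMk (T.left.toSpecΓ ≫ Spec.map (CommRingCat.ofHom (homOfPoint (structHom T) a))) (by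
    change (_ ≫ _) ≫ Spec.map (CommRingCat.ofHom (algebraMap k (PGLRing k N))) = _
    rw [Category.assoc, ← Spec.map_comp, ← CommRingCat.ofHom_comp,
      homOfPoint_algebraMap, toSpecΓ_structHom])

/-- The morphism of schemes underlying a morphism to `PGL_N`. -/
def PGL.toSpec {T : Over (Spec (.of k))} (t : T ⟶ PGL k N) :
    T.left ⟶ Spec (.of (PGLRing k N)) := t.left

lemma PGL.toSpec_comp {T : Over (Spec (.of k))} (t : T ⟶ PGL k N) :
    PGL.toSpec t ≫ Spec.map (CommRingCat.ofHom (algebraMap k (PGLRing k N))) = T.hom :=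
  Over.w t

/-- The ring homomorphism from the coordinate ring of `PGL_N` given by a morphism to `PGL_N`. -/
def PGL.ringHom {T : Over (Spec (.of k))} (t : T ⟶ PGL k N) : PGLRing k N →+* Γ(T.left, ⊤) :=
  ((Scheme.ΓSpecIso (.of (PGLRing k N))).inv ≫ (PGL.toSpec t).appTop).hom

lemma PGL.ringHom_comp_algebraMap {T : Over (Spec (.of k))} (t : T ⟶ PGL k N) :
    (PGL.ringHom t).comp (algebraMap k (PGLRing k N)) = structHom T := by
  have h : CommRingCat.ofHom (algebraMap k (PGLRing k N)) ≫
      (Scheme.ΓSpecIso (.of (PGLRing k N))).inv ≫ (PGL.toSpec t).appTop =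
      (Scheme.ΓSpecIso (.of k)).inv ≫ T.hom.appTop := by
    rw [← PGL.toSpec_comp t, Scheme.Hom.comp_appTop, Scheme.ΓSpecIso_inv_naturality_assoc]
  exact congrArg CommRingCat.Hom.hom h

/-- Morphisms `T → PGL_N` over `k` are the same as points of `PGL_N(Γ(T, 𝒪_T))`, i.e. automorphisms
of the matrix algebra over `Γ(T, 𝒪_T)`. -/
def PGL.homEquiv (T : Over (Spec (.of k))) : (T ⟶ PGL k N) ≃ PGLPoints N Γ(T.left, ⊤) where
  toFun t := pointOfHom (PGL.ringHom t)
  invFun a := PGL.ofPoint T a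
  left_inv t := by
    refine Over.OverMorphism.ext ?_
    change T.left.toSpecΓ ≫ Spec.map (CommRingCat.ofHom (homOfPoint (structHom T)
      (pointOfHom (PGL.ringHom t)))) = PGL.toSpec t
    rw [homOfPoint_pointOfHom _ _ (PGL.ringHom_comp_algebraMap t), PGL.ringHom,
      CommRingCat.ofHom_hom, Spec.map_comp, ← Scheme.toSpecΓ_naturality_assoc]
    exact (congrArg (PGL.toSpec t ≫ ·) (toSpecΓ_SpecMap_ΓSpecIso_inv _)).trans (Category.comp_id _)
  right_inv a := by
    refine Eq.trans (congrArg pointOfHom ?_) (pointOfHom_homOfPoint (structHom T) a)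
    have : (Scheme.ΓSpecIso (.of (PGLRing k N))).inv ≫ (T.left.toSpecΓ ≫
        Spec.map (CommRingCat.ofHom (homOfPoint (structHom T) a))).appTop =
        CommRingCat.ofHom (homOfPoint (structHom T) a) := by
      simp
    exact congrArg CommRingCat.Hom.hom this

lemma PGL.homEquiv_comp {T T' : Over (Spec (.of k))} (f : T ⟶ T') (g : T' ⟶ PGL k N) :
    PGL.homEquiv T (f ≫ g) = PGLPoints.map f.left.appTop.hom (PGL.homEquiv T' g) := by
  refine Eq.trans (congrArg pointOfHom ?_) (pointOfHom_comp _ _)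
  have : PGL.toSpec (f ≫ g) = f.left ≫ PGL.toSpec g := rfl
  simp only [PGL.ringHom, this]
  rw [Scheme.Hom.comp_appTop]
  rfl

variable (k N)

/-- `PGL_N` represents the functor `T ↦ PGL_N(Γ(T, 𝒪_T))`. -/
def PGLRepresentable : (PGLFunctor k N ⋙ forget GrpCat).RepresentableBy (PGL k N) where
  homEquiv {T} := PGL.homEquiv T
  homEquiv_comp f g := PGL.homEquiv_comp f g

/-- The group structure of `PGL_N`: composition of automorphisms of the matrix algebra. -/
instance : GrpObj (PGL k N) := GrpObj.ofRepresentableBy _ (PGLFunctor k N) (PGLRepresentable k N)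

/-- The automorphism of the matrix algebra `Mat_N(K)` given by a `K`-point of `PGL_N`. -/
def PGL.value {k : Type u} [Field k] {N : ℕ} {K : Type u} [Field K] [Algebra k K]
    (p : Over.mk (Spec.map (CommRingCat.ofHom (algebraMap k K))) ⟶ PGL k N) : PGLPoints N K :=
  PGLPoints.map (Scheme.ΓSpecIso (.of K)).hom.hom (PGL.homEquiv _ p)

end PGLScheme

section Varieties
open Order

/-- A scheme is normal if all its local rings are integrally closed domains. -/
def IsNormalScheme (Y : Scheme.{u}) : Prop :=
  ∀ y : Y, IsDomain (Y.presheaf.stalk y) ∧ IsIntegrallyClosed (Y.presheaf.stalk y)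

attribute [local instance] MvPolynomial.gradedAlgebra in
/-- Projective `n`-space over `k`. -/
def ProjSpace (k : Type u) [Field k] (n : ℕ) : Over (Spec (.of k)) :=
  Over.mk (Proj.toSpecZero (MvPolynomial.homogeneousSubmodule (Fin (n + 1)) k) ≫
    Spec.map (CommRingCat.ofHom
      (algebraMap k (MvPolynomial.homogeneousSubmodule (Fin (n + 1)) k 0))))

/-- A scheme over `k` is projective if it is isomorphic over `k` to a closed subscheme of some
projective space. -/
def IsProjective {k : Type u} [Field k] (X : Over (Spec (.of k))) : Prop :=
  ∃ (n : ℕ) (i : X ⟶ ProjSpace k n), IsClosedImmersion i.left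

variable {k : Type u} [Field k]

/-- The spectrum of an extension field, as a scheme over `k`. -/
abbrev SpecExt (k K : Type u) [Field k] [Field K] [Algebra k K] : Over (Spec (.of k)) :=
  Over.mk (Spec.map (CommRingCat.ofHom (algebraMap k K)))

/-- The base change `X_K` of a `k`-scheme `X` to an extension field `K`. -/
abbrev baseChange (X : Over (Spec (.of k))) (K : Type u) [Field K] [Algebra k K] :
    Over (Spec (.of K)) :=
  Over.mk (pullback.snd X.hom (SpecExt k K).hom)

instance isIntegral_of_geometricallyIntegral (X : Over (Spec (.of k)))
    [GeometricallyIntegral X.hom] : IsIntegral X.left :=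
  GeometricallyIntegral.isIntegral_of_subsingleton X.hom

instance isLocallyNoetherian_of_locallyOfFiniteType (X : Over (Spec (.of k)))
    [LocallyOfFiniteType X.hom] : IsLocallyNoetherian X.left :=
  LocallyOfFiniteType.isLocallyNoetherian X.hom

instance (X : Over (Spec (.of k))) (K : Type u) [Field K] [Algebra k K]
    [GeometricallyIntegral X.hom] : GeometricallyIntegral (baseChange X K).hom :=
  inferInstanceAs (GeometricallyIntegral (pullback.snd X.hom (SpecExt k K).hom))

instance (X : Over (Spec (.of k))) (K : Type u) [Field K] [Algebra k K]
    [LocallyOfFiniteType X.hom] : LocallyOfFiniteType (baseChange X K).hom :=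
  inferInstanceAs (LocallyOfFiniteType (pullback.snd X.hom (SpecExt k K).hom))

/-- The field of rational functions on an integral scheme over `k`. -/
abbrev RatFun (Y : Over (Spec (.of k))) [IsIntegral Y.left] : Type u := Y.left.functionField

instance (Y : Scheme.{u}) [IsIntegral Y] : Nonempty (⊤ : Y.Opens) :=
  ⟨⟨genericPoint Y, trivial⟩⟩

/-- The field of rational functions on an integral `k`-scheme is an extension of `k`. -/
instance ratFunAlgebra (Y : Over (Spec (.of k))) [IsIntegral Y.left] :
    Algebra k (RatFun Y) :=
  RingHom.toAlgebra ((Scheme.ΓSpecIso (.of k)).inv ≫ Y.hom.appTop ≫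
    Y.left.germToFunctionField ⊤).hom

/-- The generic point of an integral scheme, as a morphism from the spectrum of its function
field. -/
abbrev genPt (Y : Over (Spec (.of k))) [IsIntegral Y.left] : Spec Y.left.functionField ⟶ Y.left :=
  Y.left.fromSpecStalk (genericPoint Y.left)

lemma fst_genericPoint_specializes (X : Over (Spec (.of k))) [GeometricallyIntegral X.hom]
    (K : Type u) [Field K] [Algebra k K] :
    (pullback.fst X.hom (SpecExt k K).hom) (genericPoint (baseChange X K).left) ⤳
      genericPoint X.left := by
  have hsurj : Surjective (pullback.fst X.hom (SpecExt k K).hom) := by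
    have : Surjective (SpecExt k K).hom := by
      change Surjective (Spec.map (CommRingCat.ofHom (algebraMap k K)))
      infer_instance
    infer_instance
  rw [specializes_iff_mem_closure]
  obtain ⟨y, hy⟩ := hsurj.surj (genericPoint X.left)
  have h : genericPoint (baseChange X K).left ⤳ y :=
    genericPoint_specializes (α := (baseChange X K).left) y
  rw [← hy, ← specializes_iff_mem_closure]
  exact h.map (pullback.fst X.hom (SpecExt k K).hom).continuous

/-- Pull-back of rational functions along `X_K → X`. -/
def ratFunMap (X : Over (Spec (.of k))) [GeometricallyIntegral X.hom]
    (K : Type u) [Field K] [Algebra k K] : RatFun X →+* RatFun (baseChange X K) :=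
  (X.left.presheaf.stalkSpecializes (fst_genericPoint_specializes X K) ≫
    (pullback.fst X.hom (SpecExt k K).hom).stalkMap (genericPoint (baseChange X K).left)).hom

lemma ratFunMap_spec (X : Over (Spec (.of k))) [GeometricallyIntegral X.hom]
    (K : Type u) [Field K] [Algebra k K] :
    Spec.map (CommRingCat.ofHom (ratFunMap X K)) ≫ genPt X =
      genPt (baseChange X K) ≫ pullback.fst X.hom (SpecExt k K).hom := by
  have h : CommRingCat.ofHom (ratFunMap X K) =
      X.left.presheaf.stalkSpecializes (fst_genericPoint_specializes X K) ≫
    (pullback.fst X.hom (SpecExt k K).hom).stalkMap (genericPoint (baseChange X K).left) := rfl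
  rw [h, Spec.map_comp, Category.assoc, Scheme.SpecMap_stalkSpecializes_fromSpecStalk,
    Scheme.SpecMap_stalkMap_fromSpecStalk]
  rfl

/-! ### Linear systems of Weil divisors -/

/-- A Weil divisor on `Y`: a (locally finite) integral combination of points of codimension one,
i.e. of generic points of prime divisors. The coefficient of the prime divisor with generic point
`y` is `D y`. -/
def WeilDivisor (Y : Scheme.{u}) : Type u :=
  {D : AlgebraicCycle Y ℤ // ∀ y, D y ≠ 0 → coheight y = 1}

/-- A (not necessarily complete) linear system on `Y`: a Weil divisor `D` and a nonzero
finite-dimensional vector space `V` of rational functions such that `D + div f` is effective for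
every nonzero `f ∈ V`. -/
structure LinearSystem (Y : Over (Spec (.of k))) [IsIntegral Y.left]
    [IsLocallyNoetherian Y.left] where
  /-- The reference divisor. -/
  D : WeilDivisor Y.left
  /-- The space of rational functions. -/
  V : Submodule k (RatFun Y)
  finiteDimensional : FiniteDimensional k V
  ne_bot : V ≠ ⊥
  effective : ∀ f ∈ V, f ≠ 0 → ∀ y, 0 ≤ D.1 y + Scheme.ord f y

section

variable {Y : Over (Spec (.of k))} [IsIntegral Y.left] [IsLocallyNoetherian Y.left]

/-- The coefficients of the member `D + div f` of a linear system. -/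
def LinearSystem.member (L : LinearSystem Y) (f : RatFun Y) : Y.left → ℤ :=
  fun y => L.D.1 y + Scheme.ord f y

/-- A linear system has no fixed components if no prime divisor is contained in the support of all
its members. -/
def LinearSystem.NoFixedComponents (L : LinearSystem Y) : Prop :=
  ∀ y : Y.left, coheight y = 1 → ∃ f ∈ L.V, f ≠ 0 ∧ L.member f y = 0

/-- Let `W` be a nonzero finite-dimensional vector space of rational functions. It defines a unique
linear system without fixed components, whose members are the divisors
`div f - min {div h : 0 ≠ h ∈ W}` for `0 ≠ f ∈ W`. This is the member defined by `f`. -/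
def movableMember (W : Submodule k (RatFun Y)) (f : RatFun Y) : Y.left → ℤ :=
  fun y => Scheme.ord f y - sInf {n : ℤ | ∃ h ∈ W, h ≠ 0 ∧ n = Scheme.ord h y}

/-- The set of all members of the linear system without fixed components defined by `W`. -/
def movableSystem (W : Submodule k (RatFun Y)) : Set (Y.left → ℤ) :=
  {E | ∃ f ∈ W, f ≠ 0 ∧ E = movableMember W f}

/-- For a linear system without fixed components the two descriptions of the members agree. -/
theorem LinearSystem.member_eq (L : LinearSystem Y) (hL : L.NoFixedComponents) (f : RatFun Y) :
    L.member f = movableMember L.V f := by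
  funext y
  have key : sInf {n : ℤ | ∃ h ∈ L.V, h ≠ 0 ∧ n = Scheme.ord h y} = - L.D.1 y := by
    refine IsLeast.csInf_eq ⟨?_, ?_⟩
    · by_cases hy : coheight y = 1
      · obtain ⟨h, hV, h0, hh⟩ := hL y hy
        refine ⟨h, hV, h0, ?_⟩
        simp only [LinearSystem.member] at hh
        omega
      · obtain ⟨h, hV, h0⟩ := Submodule.exists_mem_ne_zero_of_ne_bot L.ne_bot
        refine ⟨h, hV, h0, ?_⟩
        rw [Scheme.ord_eq_zero_of_coheight_neq_one hy, neg_eq_zero]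
        by_contra hD
        exact hy (L.D.2 y hD)
    · rintro n ⟨h, hV, h0, rfl⟩
      have := L.effective h hV h0 y
      omega
  simp only [LinearSystem.member, movableMember, key]
  omega

end

end Varieties

section Action

open MonoidalCategory CartesianMonoidalCategory MonObj

variable {k : Type u} [Field k]

/-- `RatMapsTo ρ t y`: the `T`-point `t` of `Y` factors through an open set on which the rational
map `ρ : Y ⇢ X` is defined, and `ρ(t) = y`. -/
def RatMapsTo {Y X : Over (Spec (.of k))} (ρ : Y.left.RationalMap X.left)
    {T : Over (Spec (.of k))} (t : T ⟶ Y) (y : T ⟶ X) : Prop :=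
  ∃ f : Y.left.PartialMap X.left, f.toRationalMap = ρ ∧
    ∃ s : T.left ⟶ f.domain, s ≫ f.domain.ι = t.left ∧ s ≫ f.hom = y.left

/-- A rational action of a `k`-group scheme `G` on a `k`-scheme `X`: a rational map
`ρ : G × X ⇢ X` over `k`, defined at `(e, x)` for `x` in a dense open subset of `X` with
`ρ(e, x) = x` there, and such that `ρ(g₁g₂, x) = ρ(g₁, ρ(g₂, x))`, with all terms defined, for all
(scheme-valued) points `(g₁, g₂, x)` of a dense open subset of `G × G × X`. -/
structure IsRationalAction (G X : Over (Spec (.of k))) [GrpObj G]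
    (ρ : (G ⊗ X).left.RationalMap X.left) : Prop where
  isOver : ρ.compHom X.hom = (G ⊗ X).hom.toRationalMap
  unit : ∃ U : X.left.Opens, Dense (U : Set X.left) ∧
    RatMapsTo ρ (T := Over.mk (U.ι ≫ X.hom)) (lift 1 (Over.homMk U.ι)) (Over.homMk U.ι)
  assoc : ∃ W : (G ⊗ G ⊗ X).left.Opens, Dense (W : Set (G ⊗ G ⊗ X).left) ∧
    ∀ (T : Over (Spec (.of k))) (g₁ g₂ : T ⟶ G) (x : T ⟶ X),
      Set.range (lift g₁ (lift g₂ x)).left ⊆ W →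
      ∃ y z : T ⟶ X, RatMapsTo ρ (lift g₂ x) y ∧ RatMapsTo ρ (lift g₁ y) z ∧
        RatMapsTo ρ (lift (g₁ * g₂) x) z

variable (X : Over (Spec (.of k))) [GeometricallyIntegral X.hom]
  (K : Type u) [Field K] [Algebra k K]

/-- The spectrum of the function field of `X_K`, as a scheme over `k`. -/
abbrev specRatFun : Over (Spec (.of k)) :=
  Over.mk ((genPt (baseChange X K) ≫ (baseChange X K).hom) ≫ (SpecExt k K).hom)

/-- The generic point of `X_K`, as a point of `X`. -/
def genericPt : specRatFun X K ⟶ X :=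
  Over.homMk (genPt (baseChange X K) ≫ pullback.fst X.hom (SpecExt k K).hom) (by
    simp [pullback.condition])

variable {X K}

/-- A `K`-point of `G`, viewed as a point over the function field of `X_K`. -/
def constPt {G : Over (Spec (.of k))} (g : SpecExt k K ⟶ G) : specRatFun X K ⟶ G :=
  Over.homMk (genPt (baseChange X K) ≫ (baseChange X K).hom) ≫ g

/-- `IsPullbackBy ρ g σ`: the rational map `ρ_g = ρ(g, -) : X_K ⇢ X_K` is defined and birational,
and `σ` is the automorphism `f ↦ f ∘ ρ_g` of the function field of `X_K`. Indeed, the condition says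
that `ρ(g, η) = η ∘ Spec σ` where `η` is the generic point. -/
def IsPullbackBy {G : Over (Spec (.of k))} (ρ : (G ⊗ X).left.RationalMap X.left)
    (g : SpecExt k K ⟶ G) (σ : RatFun (baseChange X K) ≃ₐ[K] RatFun (baseChange X K)) : Prop :=
  ∃ y : specRatFun X K ⟶ X, RatMapsTo ρ (lift (constPt g) (genericPt X K)) y ∧
    y.left = Spec.map (CommRingCat.ofHom σ.toRingEquiv.toRingHom) ≫ (genericPt X K).left

/-- The space of rational functions on `X_K` spanned by the rational functions defining a linear
system on `X`. It defines the linear system `|D|_K` on `X_K`. -/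
def LinearSystem.extend [LocallyOfFiniteType X.hom] (L : LinearSystem X) (K : Type u) [Field K]
    [Algebra k K] : Submodule K (RatFun (baseChange X K)) :=
  Submodule.span K (ratFunMap X K '' L.V)

/-- The space of rational functions defining the birational transform of a linear system without
fixed components, itself defined by `W`, under a birational self-map with pull-back `σ`. Pushing
forward the incidence divisor `∑ λᵢ fᵢ = 0` in `Y × |D|`, where the `fᵢ` are a basis of `W`, replaces
`fᵢ` by `σ⁻¹ fᵢ` and leaves `λ` unchanged; the fixed part is removed in `movableSystem`. -/
def pushforward {Y : Over (Spec (.of K))} [IsIntegral Y.left] (σ : RatFun Y ≃ₐ[K] RatFun Y)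
    (W : Submodule K (RatFun Y)) : Submodule K (RatFun Y) :=
  W.map σ.symm.toLinearMap

/-- The linear system without fixed components defined by `W` is equal to its birational transform
under the birational self-map with pull-back `σ`: the two have the same members. -/
def IsPreservedBy {Y : Over (Spec (.of K))} [IsIntegral Y.left] [IsLocallyNoetherian Y.left]
    (W : Submodule K (RatFun Y)) (σ : RatFun Y ≃ₐ[K] RatFun Y) : Prop :=
  movableSystem (pushforward σ W) = movableSystem W

/-- The rational function `∑ cᵢ bᵢ` on `X_K` with coordinates `c ∈ K^N` with respect to a basis `b`
of the space of rational functions defining a linear system on `X`. -/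
def LinearSystem.comb [LocallyOfFiniteType X.hom] (L : LinearSystem X) {N : ℕ}
    (b : Module.Basis (Fin N) k L.V) (c : Fin N → K) : RatFun (baseChange X K) :=
  ∑ i, c i • ratFunMap X K (b i : RatFun X)

/-- The linear automorphism `M` of `K^N` describes, in the homogeneous coordinates on `|D|_K` given
by the basis `b`, the map which sends a member of `|D|_K` to the corresponding member of the
birational transform of `|D|_K` under the birational self-map with pull-back `σ`. -/
def Induces [LocallyOfFiniteType X.hom] (L : LinearSystem X) {N : ℕ}
    (b : Module.Basis (Fin N) k L.V) (σ : RatFun (baseChange X K) ≃ₐ[K] RatFun (baseChange X K))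
    (M : GL (Fin N) K) : Prop :=
  ∀ c : Fin N → K, c ≠ 0 →
    movableMember (L.extend K) (L.comb b (M.1.mulVec c)) =
      movableMember (pushforward σ (L.extend K)) (σ.symm (L.comb b c))

end Action

end LinRep

end

/-! Write K for the algebraic closure of k, V_K for the space of functions defining |D|_K, and σ for
the pull-back μ_g^* on K(X_K). The geometric input is that on a normal proper integral scheme over K
a rational function is determined by its divisor up to a constant: a function of order zero
everywhere is regular by algebraic Hartogs (`mem_range_of_forall_height_one`), and global regular
functions are constant. Hence equality of the members of |D|_K and of its transform means that σ⁻¹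
V_K = φ V_K for some φ ≠ 0, and φ⁻¹σ⁻¹ gives a matrix M ∈ GL_N(K). This is the relation `ActsBy`. A
change of φ which still gives a matrix is multiplication by an element integral over K, hence in K,
so the class of M in PGL_N(K) depends on σ only.

The resulting map U(K) → PGL_N(K) comes from a morphism on U. On a product of charts Spec B ⊗ A the
action sends the basis functions β_i to fractions q_i / s^n, and eliminating the unknown factor φ
leaves a system of linear equations over B for the entries of the matrix. At each general point the
solutions form a line, so cofactors give a solution over B near a given point
(`exists_solution_of_forall_point`, `exists_generic_matrix`). The local matrices glue in PGL_N
because morphisms from a reduced scheme to a separated one are determined by their K-points.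

The associativity of μ makes the map multiplicative where g, h and gh lie in U. Weil's argument
extends it to all of G: finitely many translates of U meet, so the map on points extends to a
homomorphism φ on G(K). The morphism (u, v) ↦ t(u) t(v)⁻¹ on U × U, where t denotes the morphism on
U, is constant on the geometric fibres of the smooth surjection (u, v) ↦ u v⁻¹ and therefore
descends to G (`exists_isMonHom_of_points`). For an arbitrary g with μ_g birational, a point w with
w, gw ∈ U expresses μ_g through μ_{gw} and μ_w, so that g preserves |D|_K as well and τ(g) is the
induced map. Uniqueness holds because K-points in U determine a morphism out of the reduced scheme
G. -/

noncomputable section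

set_option linter.unusedSectionVars false

namespace LinRep

section

/-! ### Normal domains, smooth algebras and separable base change -/

section CommutativeAlgebra

open Polynomial TensorProduct

/-- Algebraic Hartogs: an element of the fraction field of a normal noetherian domain that is
regular at all primes of height one is regular. -/
theorem mem_range_of_forall_height_one {R K : Type*} [CommRing R] [IsDomain R] [IsNoetherianRing R]
    [IsIntegrallyClosed R] [Field K] [Algebra R K] [IsFractionRing R K] (x : K)
    (h : ∀ p : Ideal R, p.IsPrime → p.height = 1 →
      ∃ a b : R, b ∉ p ∧ x * algebraMap R K b = algebraMap R K a) :
    ∃ r, algebraMap R K r = x := by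
  have hinj := IsFractionRing.injective R K
  obtain ⟨a, b, hb, rfl⟩ := IsFractionRing.div_surjective (A := R) x
  have hb0 : b ≠ 0 := nonZeroDivisors.ne_zero hb
  have hbK : algebraMap R K b ≠ 0 := by simpa using hb0
  by_cases ha : Ideal.Quotient.mk (Ideal.span {b}) a = 0
  · rw [Ideal.Quotient.eq_zero_iff_dvd] at ha
    obtain ⟨c, rfl⟩ := ha
    exact ⟨c, by rw [map_mul]; field_simp⟩
  exfalso
  -- If b does not divide a, some associated prime P = (b : c) of R / bR contains the annihilator of
  -- the class of a.
  obtain ⟨P, hP, hle⟩ := exists_le_isAssociatedPrime_of_isNoetherianRing R _ ha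
  rw [isAssociatedPrime_iff] at hP
  obtain ⟨hPp, c', hc'⟩ := hP
  obtain ⟨c, rfl⟩ := Ideal.Quotient.mk_surjective c'
  have hmem : ∀ a r : R, r ∈ (⊥ : Submodule R (R ⧸ Ideal.span {b})).colon
      {Ideal.Quotient.mk (Ideal.span {b}) a} ↔ b ∣ r * a := fun a r => by
    rw [Submodule.mem_colon_singleton, Submodule.mem_bot, ← Ideal.Quotient.eq_zero_iff_dvd, map_mul]
    rfl
  have hPmem : ∀ r, r ∈ P ↔ b ∣ r * c := fun r => by rw [hc', hmem]
  set y : K := algebraMap R K c / algebraMap R K b with hy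
  have hbP : b ∈ P := (hPmem b).2 (dvd_mul_right _ _)
  have hmul : ∀ r ∈ P, ∃ w, algebraMap R K w = y * algebraMap R K r := fun r hr => by
    obtain ⟨w, hw⟩ := (hPmem r).1 hr
    refine ⟨w, ?_⟩
    rw [hy]
    field_simp
    rw [← map_mul, ← map_mul, _root_.mul_comm w b, ← hw, _root_.mul_comm]
  have hheight : P.height = 1 := by
    -- The fraction y = c / b satisfies yP ⊆ R. If yP ⊆ P, then y is integral, hence in R, and 1 ∈
    -- P. Otherwise yu ∉ P for some u ∈ P, which makes P minimal over (u), and Krull's principal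
    -- ideal theorem applies.
    by_cases hcase : ∀ r ∈ P, ∀ w, algebraMap R K w = y * algebraMap R K r → w ∈ P
    · exfalso
      have hint : IsIntegral R y := by
        refine isIntegral_of_smul_mem_submodule (A := K) (M := K)
          (Submodule.map (Algebra.linearMap R K) P) ?_ ((IsNoetherian.noetherian P).map _) y ?_
        · intro h0
          have : algebraMap R K b ∈ Submodule.map (Algebra.linearMap R K) P := ⟨b, hbP, rfl⟩
          rw [h0] at this
          exact hbK (by simpa using this)
        · rintro _ ⟨r, hr, rfl⟩
          obtain ⟨w, hw⟩ := hmul r hr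
          exact ⟨w, hcase r hr w hw, by simpa using hw⟩
      obtain ⟨z, hz⟩ := IsIntegrallyClosed.isIntegral_iff.1 hint
      apply hPp.ne_top
      rw [Ideal.eq_top_iff_one, hPmem, _root_.one_mul]
      refine ⟨z, hinj ?_⟩
      rw [map_mul, hz, hy]
      field_simp
    · push Not at hcase
      obtain ⟨u, hu, w, hw, hwP⟩ := hcase
      have hmin : P ∈ (Ideal.span {u}).minimalPrimes := by
        refine ⟨⟨hPp, by simpa [Ideal.span_le] using hu⟩, ?_⟩
        rintro Q ⟨hQp, hQ⟩ hQP p hp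
        obtain ⟨v, hv⟩ := hmul p hp
        have : p * w = v * u := hinj (by rw [map_mul, map_mul, hw, hv]; ring)
        have h1 : p * w ∈ Q := this ▸ Q.mul_mem_left v (hQ (Ideal.mem_span_singleton_self u))
        exact (hQp.mem_or_mem h1).resolve_right fun h => hwP (hQP h)
      refine le_antisymm (Ideal.height_le_one_of_isPrincipal_of_mem_minimalPrimes _ _ hmin) ?_
      rw [Order.one_le_iff_ne_zero, Ne, Ideal.height_eq_zero_iff]
      rintro ⟨-, hmin⟩
      have := hmin (y := ⊥) ⟨Ideal.isPrime_bot, bot_le⟩ bot_le hbP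
      exact hb0 (by simpa using this)
  -- Regularity of a / b at P gives b' ∉ P with b ∣ b'a; but such a b' annihilates the class of a
  -- and so lies in P.
  obtain ⟨a', b', hb', he⟩ := h P hPp hheight
  apply hb'
  apply hle
  rw [hmem]
  refine ⟨a', hinj ?_⟩
  rw [map_mul, map_mul, ← he]
  field_simp

/-- For nilpotent s the element s ⊗ X is integral over S. Integral closure commutes with smooth base
change, and polynomials integral over k are constant, so the coefficient s of X has to vanish. -/
theorem isReduced_of_smooth (k S : Type*) [Field k] [CommRing S] [Algebra k S]
    [Algebra.Smooth k S] : IsReduced S := by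
  refine ⟨fun s hs => ?_⟩
  have hint : IsIntegral S ((s ⊗ₜ[k] (X : k[X])) : S ⊗[k] k[X]) := by
    obtain ⟨n, hn⟩ := hs
    refine IsIntegral.of_pow (n := n + 1) (Nat.succ_pos _) ?_
    rw [Algebra.TensorProduct.tmul_pow, pow_succ, hn]
    simp [isIntegral_zero]
  obtain ⟨z, hz⟩ := (TensorProduct.toIntegralClosure_bijective_of_smooth (R := k) (S := S)
    (B := k[X])).2 ⟨_, hint⟩
  have hz' : Algebra.TensorProduct.map (.id S S) (integralClosure k k[X]).val z =
      s ⊗ₜ[k] (X : k[X]) := congrArg Subtype.val hz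
  have hconst : ∀ f : integralClosure k k[X], ((f : k[X]).coeff 1) = 0 := by
    rintro ⟨f, p, hp, hpf⟩
    have hcomp : p.comp f = 0 := by rw [← hpf]; rfl
    have hdeg : p.natDegree * f.natDegree = 0 := by rw [← natDegree_comp, hcomp, natDegree_zero]
    rcases Nat.mul_eq_zero.1 hdeg with h | h
    · rw [hp.natDegree_eq_zero] at h
      simp [h] at hcomp
    · exact coeff_eq_zero_of_natDegree_lt (by simp [h])
  let φ : S ⊗[k] k[X] →ₗ[k] S ⊗[k] k := (lcoeff k 1).lTensor S
  have h1 : ∀ z : S ⊗[k] integralClosure k k[X],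
      φ (Algebra.TensorProduct.map (.id S S) (integralClosure k k[X]).val z) = 0 := by
    intro z
    induction z with
    | zero => simp
    | add x y hx hy => rw [map_add, map_add, hx, hy, add_zero]
    | tmul x y => simp [φ, hconst]
  have h2 := h1 z
  rw [hz'] at h2
  have h3 := congrArg (TensorProduct.rid k S) h2
  simpa [φ] using h3

lemma exists_finset_mem_range_tensor {k A K : Type*} [Field k] [CommRing A] [Algebra k A] [Field K]
    [Algebra k K] (t : A ⊗[k] K) : ∃ S : Finset K, ∀ E : IntermediateField k K, (S : Set K) ⊆ E →
      t ∈ (Algebra.TensorProduct.map (.id A A) E.val).range := by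
  classical
  induction t with
  | zero => exact ⟨∅, fun E _ => zero_mem _⟩
  | tmul a x =>
    exact ⟨{x}, fun E hE => ⟨a ⊗ₜ ⟨x, hE (by simp)⟩, by simp⟩⟩
  | add x y hx hy =>
    obtain ⟨S, hS⟩ := hx
    obtain ⟨T, hT⟩ := hy
    refine ⟨S ∪ T, fun E hE => ?_⟩
    rw [Finset.coe_union, Set.union_subset_iff] at hE
    exact add_mem (hS E hE.1) (hT E hE.2)

lemma exists_intermediateField_mem_range_tensor {k A K : Type*} [Field k] [CommRing A] [Algebra k A]
    [Field K] [Algebra k K] [Algebra.IsAlgebraic k K] (t : A ⊗[k] K) :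
    ∃ E : IntermediateField k K, FiniteDimensional k E ∧
      t ∈ (Algebra.TensorProduct.map (.id A A) E.val).range := by
  obtain ⟨S, hS⟩ := exists_finset_mem_range_tensor t
  exact ⟨_, IntermediateField.finiteDimensional_adjoin fun x _ => Algebra.IsIntegral.isIntegral x,
    hS _ (IntermediateField.subset_adjoin k _)⟩

/-- An element of a field extension of the fractions of a normal domain `A` which is integral over
`A` and a quotient of an element of a smooth `A`-algebra by an element of `A` lies in this
algebra. -/
lemma mem_range_of_smooth_of_isIntegral {A S F : Type*} (Q : Type*) [CommRing A] [IsDomain A]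
    [IsIntegrallyClosed A] [CommRing S] [Algebra A S] [Algebra.Smooth A S] [Field Q] [Algebra A Q]
    [IsFractionRing A Q] [Field F] [Algebra A F] (ι : S →ₐ[A] F) (hι : Function.Injective ι)
    (hAF : Function.Injective (algebraMap A F)) {x : F} {a : A} {s : S} (ha : a ≠ 0)
    (hat : algebraMap A F a * x = ι s) (hxA : IsIntegral A x) : x ∈ ι.range := by
  let j : Q →ₐ[A] F := IsFractionRing.liftAlgHom (g := Algebra.ofId A F) hAF
  let f : S ⊗[A] Q →ₐ[A] F := Algebra.TensorProduct.lift ι j fun _ _ => .all _ _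
  have hpure : ∀ w : S ⊗[A] Q, ∃ (a : A) (s : S), a ≠ 0 ∧ a • w = s ⊗ₜ 1 := by
    intro w
    induction w with
    | zero => exact ⟨1, 0, one_ne_zero, by simp⟩
    | tmul s q =>
      obtain ⟨n, d, hd, rfl⟩ := IsFractionRing.div_surjective (A := A) q
      refine ⟨d, n • s, nonZeroDivisors.ne_zero hd, ?_⟩
      rw [TensorProduct.smul_tmul, ← TensorProduct.tmul_smul]
      congr 1
      have : algebraMap A Q d ≠ 0 :=
        (map_ne_zero_iff _ (IsFractionRing.injective A Q)).2 (nonZeroDivisors.ne_zero hd)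
      rw [Algebra.smul_def, Algebra.smul_def, _root_.mul_one, mul_div_cancel₀ _ this]
    | add x y hx hy =>
      obtain ⟨a, s, ha, h⟩ := hx
      obtain ⟨b, t, hb, h'⟩ := hy
      refine ⟨a * b, b • s + a • t, mul_ne_zero ha hb, ?_⟩
      rw [smul_add, mul_smul, mul_smul, h', smul_comm, h, TensorProduct.add_tmul,
        TensorProduct.smul_tmul', TensorProduct.smul_tmul']
  have hf : Function.Injective f := by
    rw [injective_iff_map_eq_zero]
    intro w hw
    obtain ⟨b, s, hb, h⟩ := hpure w
    have h1 : f (b • w) = ι s := by rw [h]; simp [f]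
    rw [map_smul, hw, smul_zero, ← map_zero ι] at h1
    rw [← hι h1, TensorProduct.zero_tmul] at h
    have hbQ : algebraMap A Q b ≠ 0 := (map_ne_zero_iff _ (IsFractionRing.injective A Q)).2 hb
    have h2 : ∀ w : S ⊗[A] Q, b • w = Algebra.TensorProduct.includeRight (algebraMap A Q b) * w :=
      fun w => by
        rw [Algebra.TensorProduct.includeRight_apply, ← Algebra.TensorProduct.algebraMap_apply',
          Algebra.smul_def]
    have h3 : IsUnit (Algebra.TensorProduct.includeRight (R := A) (A := S) (algebraMap A Q b)) :=
      (IsUnit.mk0 _ hbQ).map (Algebra.TensorProduct.includeRight (R := A) (A := S))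
    rw [h2] at h
    exact (h3.mul_right_eq_zero).1 h
  let z : S ⊗[A] Q := s ⊗ₜ (algebraMap A Q a)⁻¹
  have hz : f z = x := by
    have haF : algebraMap A F a ≠ 0 := by rwa [Ne, map_eq_zero_iff _ hAF]
    have hj : j (algebraMap A Q a) = algebraMap A F a := j.commutes a
    have : f z = ι s * (algebraMap A F a)⁻¹ := by
      rw [← hj, ← map_inv₀]
      exact Algebra.TensorProduct.lift_tmul _ _ _ _ _
    rw [this, ← hat]
    field_simp
  have hzint : IsIntegral A z := by
    rw [← isIntegral_algHom_iff f hf, hz]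
    exact hxA
  -- Integral closure commutes with the smooth base change A → S, so z comes from the tensor product
  -- of S with the integral closure of A in Q, which is A itself.
  obtain ⟨y, hy⟩ := (TensorProduct.toIntegralClosure_bijective_of_smooth (R := A) (S := S)
    (B := Q)).2 ⟨z, hzint.tower_top⟩
  have hy' : Algebra.TensorProduct.map (.id S S) (integralClosure A Q).val y = z :=
    congrArg Subtype.val hy
  have key : ∀ y : S ⊗[A] integralClosure A Q, ∃ s' : S,
      f (Algebra.TensorProduct.map (.id S S) (integralClosure A Q).val y) = ι s' := by
    intro y
    induction y with
    | zero => exact ⟨0, by simp⟩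
    | add x y hx hy =>
      obtain ⟨s, hs⟩ := hx
      obtain ⟨t, ht⟩ := hy
      exact ⟨s + t, by rw [map_add, map_add, map_add, hs, ht]⟩
    | tmul s q =>
      obtain ⟨r, hr⟩ := IsIntegrallyClosed.isIntegral_iff.1 q.2
      refine ⟨r • s, ?_⟩
      rw [Algebra.TensorProduct.map_tmul]
      simp only [AlgHom.coe_id, id_eq, Subalgebra.coe_val, ← hr, f,
        Algebra.TensorProduct.lift_tmul, AlgHom.commutes, map_smul]
      rw [Algebra.smul_def, _root_.mul_comm]
  obtain ⟨s', hs'⟩ := key y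
  exact ⟨s', by rw [← hz, ← hy', hs']; rfl⟩

/-- Since A ⊗ K is algebraic over A, the denominator of x can be taken in A. The numerator then
lives over a finite separable subextension E, and A ⊗ E is étale over A, so
`mem_range_of_smooth_of_isIntegral` applies. -/
lemma mem_range_of_isIntegral_tensor (k A K : Type*) {F : Type*} [Field k] [CommRing A] [IsDomain A]
    [IsIntegrallyClosed A] [Algebra k A] [Field K] [Algebra k K] [Algebra.IsSeparable k K]
    [IsDomain (A ⊗[k] K)] [Field F] [Algebra (A ⊗[k] K) F] [IsFractionRing (A ⊗[k] K) F]
    [Algebra A F] [IsScalarTower A (A ⊗[k] K) F] {x : F} (hx : IsIntegral (A ⊗[k] K) x) :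
    ∃ y, algebraMap (A ⊗[k] K) F y = x := by
  have : Algebra.IsIntegral A (A ⊗[k] K) := inferInstance
  have hxA : IsIntegral A x := isIntegral_trans (A := A ⊗[k] K) x hx
  have hT : Function.Injective (algebraMap (A ⊗[k] K) F) := IsFractionRing.injective _ _
  have hA : Function.Injective (algebraMap A (A ⊗[k] K)) :=
    Algebra.TensorProduct.includeLeft_injective (S := k) (algebraMap k K).injective
  have hAF : Function.Injective (algebraMap A F) := by
    rw [IsScalarTower.algebraMap_eq A (A ⊗[k] K) F]
    exact hT.comp hA
  obtain ⟨a, t, ha, hat⟩ : ∃ (a : A) (t : A ⊗[k] K), a ≠ 0 ∧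
      algebraMap A F a * x = algebraMap _ F t := by
    obtain ⟨t, t', ht', rfl⟩ := IsFractionRing.div_surjective (A := A ⊗[k] K) x
    obtain ⟨a, ha, d, hd⟩ := (Algebra.IsAlgebraic.isAlgebraic (R := A) t').exists_nonzero_dvd ht'
    refine ⟨a, d * t, ha, ?_⟩
    have h0 : algebraMap _ F t' ≠ 0 := by simpa using nonZeroDivisors.ne_zero ht'
    rw [IsScalarTower.algebraMap_apply A (A ⊗[k] K) F, hd, map_mul, map_mul]
    rw [_root_.mul_assoc, mul_left_comm, mul_div_cancel₀ _ h0]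
  obtain ⟨E, hE, s, hs⟩ := exists_intermediateField_mem_range_tensor t
  have : Algebra.FormallyEtale k E := Algebra.FormallyEtale.of_isSeparable k E
  have : Algebra.FinitePresentation k E :=
    Algebra.FinitePresentation.of_finiteType.1 inferInstance
  have : Algebra.Smooth k E := ⟨inferInstance, inferInstance⟩
  have hm : Function.Injective (Algebra.TensorProduct.map (.id A A) E.val) :=
    Module.Flat.lTensor_preserves_injective_linearMap (M := A) E.val.toLinearMap E.val.injective
  generalize Algebra.TensorProduct.map (.id A A) E.val = m at hs hm
  obtain ⟨s', hs'⟩ := mem_range_of_smooth_of_isIntegral (FractionRing A)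
    ((IsScalarTower.toAlgHom A (A ⊗[k] K) F).comp m) (hT.comp hm) hAF ha
    (hat.trans (congrArg (algebraMap _ F) hs).symm) hxA
  exact ⟨m s', hs'⟩

/-- This settles the case of a perfect field, where the algebraic closure is separable. -/
theorem isIntegrallyClosed_tensor (k A K : Type*) [Field k] [CommRing A] [IsDomain A]
    [IsIntegrallyClosed A] [Algebra k A] [Field K] [Algebra k K] [Algebra.IsSeparable k K]
    [IsDomain (A ⊗[k] K)] : IsIntegrallyClosed (A ⊗[k] K) := by
  rw [isIntegrallyClosed_iff (FractionRing (A ⊗[k] K))]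
  exact fun hx => mem_range_of_isIntegral_tensor k A K hx

end CommutativeAlgebra

end

section

/-! ### Linear systems of equations over a ring, solved from their values at points -/

section LinearAlgebra

open TensorProduct

/-- If a system of linear equations over `B` has a nontrivial solution at all points of a basic
open set, and a unique one up to scalars at the point `p₀` of this set, then it has a solution over
`B` which is nontrivial at `p₀`. -/
theorem exists_solution_of_forall_point {k B K n ι : Type*} [Field k] [CommRing B] [Algebra k B]
    [Field K] [Algebra k K] [Fintype n] [DecidableEq n]
    (hsep : ∀ b : B, (∀ p : B →ₐ[k] K, p b = 0) → b = 0) (Φ : ι → n → B) (c : B)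
    (hker : ∀ p : B →ₐ[k] K, p c ≠ 0 → ∃ x : n → K, x ≠ 0 ∧ ∀ r, ∑ j, p (Φ r j) * x j = 0)
    (p₀ : B →ₐ[k] K) (hc : p₀ c ≠ 0) (v₀ : n → K) (hv₀ : v₀ ≠ 0)
    (hsol : ∀ r, ∑ j, p₀ (Φ r j) * v₀ j = 0)
    (huniq : ∀ x : n → K, (∀ r, ∑ j, p₀ (Φ r j) * x j = 0) → ∃ a : K, x = a • v₀) :
    ∃ x : n → B, (∃ j, p₀ (x j) ≠ 0) ∧ ∀ r, ∑ j, Φ r j * x j = 0 := by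
  classical
  let row : ι → n → K := fun r j => p₀ (Φ r j)
  -- `b` is a basis of the row space at `p₀`. Since the kernel there is a line, it has one element
  -- fewer than there are unknowns, and one extra row makes the system square.
  obtain ⟨b, hbS, hspan, hli⟩ := exists_linearIndependent K (Set.range row)
  have : Fintype b := hli.setFinite.fintype
  choose idx hidx using fun r : b => hbS r.2
  let M : Matrix b n K := Matrix.of fun r => (r : n → K)
  have hkerM : ∀ x, M.mulVec x = 0 ↔ ∀ r, ∑ j, p₀ (Φ r j) * x j = 0 := by
    intro x
    constructor
    · intro h r
      have : row r ∈ Submodule.span K b := hspan ▸ Submodule.subset_span ⟨r, rfl⟩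
      change row r ⬝ᵥ x = 0
      generalize row r = y at this
      induction this using Submodule.span_induction with
      | mem y hy => exact congrFun h ⟨y, hy⟩
      | zero => simp
      | add y z _ _ hy hz => rw [add_dotProduct, hy, hz, add_zero]
      | smul a y _ hy => rw [smul_dotProduct, hy, smul_zero]
    · intro h
      ext r
      have := h (idx r)
      simp only [Matrix.mulVec, M, Matrix.of_apply, dotProduct, Pi.zero_apply]
      rw [← hidx r]
      exact this
  have hker1 : Module.finrank K (LinearMap.ker M.mulVecLin) = 1 := by
    refine finrank_eq_one_iff'.2 ⟨⟨v₀, (hkerM v₀).2 hsol⟩, fun h => hv₀ (congrArg Subtype.val h), ?_⟩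
    rintro ⟨w, hw⟩
    obtain ⟨a, ha⟩ := huniq w ((hkerM w).1 hw)
    exact ⟨a, Subtype.ext ha.symm⟩
  have hrank : M.rank = Fintype.card b := by
    rw [Matrix.rank_eq_finrank_span_row]
    exact finrank_span_eq_card hli
  have hcard : Fintype.card (Option b) = Fintype.card n := by
    have := LinearMap.finrank_range_add_finrank_ker M.mulVecLin
    rw [hker1, Module.finrank_fintype_fun_eq_card] at this
    rw [Fintype.card_option, ← this, ← hrank]
    rfl
  -- A vector outside the row space is what shows that not all cofactors vanish at `p₀`.
  obtain ⟨v, hv⟩ : ∃ v, v ∉ Submodule.span K (Set.range ((↑) : b → n → K)) := by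
    by_contra! h
    have h1 : Submodule.span K (Set.range ((↑) : b → n → K)) = ⊤ := by
      rw [eq_top_iff]; exact fun v _ => h v
    have h2 := finrank_span_eq_card hli
    rw [h1, finrank_top, Module.finrank_fintype_fun_eq_card, ← hcard] at h2
    simp at h2
  have hli' := hli.option hv
  let e : Option b ≃ n := Fintype.equivOfCardEq hcard
  let S : Matrix n n B := Matrix.of fun i => (e.symm i).elim 0 fun r => Φ (idx r)
  let i₀ : n := e none
  let D : (n → B) →ₗ[B] B := (LinearMap.proj i₀).comp S.transpose.cramer
  have hD : ∀ w, D w = (S.updateRow i₀ w).det := fun w => Matrix.cramer_transpose_apply S w i₀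
  have hDsum : ∀ w, D w = ∑ j, w j * D (fun i => if j = i then 1 else 0) := fun w =>
    LinearMap.pi_apply_eq_sum_univ D w
  have hmap : ∀ (p : B →ₐ[k] K) w, p (D w) = ((S.updateRow i₀ w).map p).det := fun p w => by
    rw [hD]
    exact RingHom.map_det p.toRingHom _
  -- The solution is the vector of cofactors of the extra row; the factor `c` makes the equations
  -- hold also at the points where `c` vanishes and nothing is known.
  refine ⟨fun j => c * D (fun i => if j = i then 1 else 0), ?_, ?_⟩
  · by_contra! h
    have hDK : ∀ j, p₀ (D (fun i => if j = i then 1 else 0)) = 0 := fun j => by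
      have := h j
      rw [map_mul] at this
      exact (mul_eq_zero.1 this).resolve_left hc
    let SK : Matrix n n K := S.map p₀
    let DK : (n → K) →ₗ[K] K := (LinearMap.proj i₀).comp SK.transpose.cramer
    have hDK' : ∀ w, DK w = (SK.updateRow i₀ w).det := fun w =>
      Matrix.cramer_transpose_apply SK w i₀
    have h0 : DK v = 0 := by
      rw [LinearMap.pi_apply_eq_sum_univ DK v]
      refine Finset.sum_eq_zero fun j _ => ?_
      have := hDK j
      rw [hmap, Matrix.map_updateRow] at this
      rw [hDK', smul_eq_mul]
      refine mul_eq_zero_of_right _ ?_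
      convert this using 3
      ext i
      simp [apply_ite p₀]
    rw [hDK'] at h0
    have hne : (SK.updateRow i₀ v).det ≠ 0 := by
      rw [← isUnit_iff_ne_zero, ← Matrix.isUnit_iff_isUnit_det,
        ← Matrix.linearIndependent_rows_iff_isUnit]
      suffices hrow : (SK.updateRow i₀ v).row = (fun o : Option b => o.casesOn' v (↑)) ∘ e.symm by
        rw [hrow]
        exact hli'.comp e.symm e.symm.injective
      ext i j
      obtain ⟨o, rfl⟩ := e.surjective i
      cases o with
      | none => simp [Matrix.row, i₀]
      | some r =>
        have hne : e (some r) ≠ i₀ := fun h => by simpa using e.injective h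
        simp only [Matrix.row, Function.comp_apply, Equiv.symm_apply_apply]
        rw [Matrix.updateRow_ne hne]
        simp only [SK, S, Matrix.map_apply, Matrix.of_apply, Equiv.symm_apply_apply]
        exact congrFun (hidx r) j
    exact hne h0
  · intro r
    have : ∑ j, Φ r j * (c * D fun i => if j = i then 1 else 0) = c * D (Φ r) := by
      rw [hDsum (Φ r), Finset.mul_sum]
      exact Finset.sum_congr rfl fun j _ => by ring
    rw [this]
    -- At a point with p c ≠ 0 all rows of the square matrix are equations of the system, which has
    -- a nontrivial solution there, so the determinant is zero.
    refine hsep _ fun p => ?_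
    rw [map_mul]
    by_cases hpc : p c = 0
    · rw [hpc, zero_mul]
    refine mul_eq_zero_of_right _ ?_
    obtain ⟨x, hx0, hx⟩ := hker p hpc
    rw [hmap]
    refine Matrix.exists_mulVec_eq_zero_iff.1 ⟨x, hx0, ?_⟩
    ext i
    obtain ⟨o, rfl⟩ := e.surjective i
    cases o with
    | none => simpa [Matrix.mulVec, dotProduct, i₀] using hx r
    | some r' =>
      have hne : e (some r') ≠ i₀ := fun h => by simpa using e.injective h
      simp only [Matrix.mulVec, dotProduct, Matrix.map_apply, Pi.zero_apply]
      rw [Matrix.updateRow_ne hne]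
      simpa [S] using hx (idx r')

/-- Let `β` be linearly independent in a field extension of an algebraically closed field `K`. If an
invertible linear transformation of the span of `β` differs from another one by multiplication with
an element of the field, then this element is in `K`. -/
lemma eq_smul_of_eq_mul_sum {K F : Type*} [Field K] [IsAlgClosed K] [Field F] [Algebra K F] {N : ℕ}
    [NeZero N] {β : Fin N → F} (hβ : LinearIndependent K β) {x a : Matrix (Fin N) (Fin N) K}
    (ha : IsUnit a.det) {θ : F} (h : ∀ i, ∑ j, x i j • β j = θ * ∑ j, a i j • β j) :
    ∃ c : K, x = c • a := by
  classical
  have hβspan : ∀ j, β j = ∑ i, a⁻¹ j i • ∑ l, a i l • β l := fun j => by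
    have h1 : a⁻¹ * a = 1 := Matrix.nonsing_inv_mul a ha
    have h2 : ∀ l, ∑ i, a⁻¹ j i * a i l = (1 : Matrix (Fin N) (Fin N) K) j l := fun l => by
      rw [← h1, Matrix.mul_apply]
    simp_rw [Finset.smul_sum, smul_smul]
    rw [Finset.sum_comm]
    simp_rw [← Finset.sum_smul, h2]
    simp [Matrix.one_apply]
  let W : Submodule K F := Submodule.span K (Set.range β)
  have hW : ∀ c : Fin N → K, ∑ j, c j • β j ∈ W := fun c =>
    Submodule.sum_mem _ fun j _ => Submodule.smul_mem _ _ (Submodule.subset_span ⟨j, rfl⟩)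
  -- As `a` is invertible, its rows give a basis of `W`, so multiplication by θ preserves the
  -- finitely generated module `W`.
  have hint : IsIntegral K θ := by
    refine isIntegral_of_smul_mem_submodule (A := F) (M := F) W ?_
      (Submodule.fg_span (Set.finite_range β)) θ ?_
    · intro h0
      have : β 0 ∈ W := Submodule.subset_span ⟨0, rfl⟩
      rw [h0] at this
      exact hβ.ne_zero 0 (by simpa using this)
    · intro w hw
      induction hw using Submodule.span_induction with
      | mem y hy =>
        obtain ⟨j, rfl⟩ := hy
        rw [hβspan j, smul_eq_mul, Finset.mul_sum]
        refine Submodule.sum_mem _ fun i _ => ?_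
        rw [mul_smul_comm, ← h]
        exact Submodule.smul_mem _ _ (hW _)
      | zero => simp
      | add y z _ _ hy hz => rw [smul_add]; exact add_mem hy hz
      | smul a y _ hy => rw [smul_comm]; exact Submodule.smul_mem _ _ hy
  obtain ⟨c, rfl⟩ := minpoly.mem_range_of_degree_eq_one K θ
    (IsAlgClosed.degree_eq_one_of_irreducible K (minpoly.irreducible hint))
  refine ⟨c, ?_⟩
  ext i j
  have h1 : ∑ j, (x i j - c * a i j) • β j = 0 := by
    simp_rw [sub_smul, Finset.sum_sub_distrib, h, ← Algebra.smul_def, Finset.smul_sum, smul_smul]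
    simp
  exact sub_eq_zero.1 (Fintype.linearIndependent_iff.1 hβ _ h1 j)

section Points

variable {k B A K F : Type*} [Field k] [CommRing B] [Algebra k B] [CommRing A] [Algebra k A]
  [Field K] [Algebra k K] [Field F] [Algebra K F] [Algebra k F] [IsScalarTower k K F]

/-- Evaluation of functions on a product at a `K`-point of the first factor and an `F`-point of the
second one. -/
def evalProd (ε : A →ₐ[k] F) (p : B →ₐ[k] K) : B ⊗[k] A →ₐ[k] F :=
  Algebra.TensorProduct.lift ((IsScalarTower.toAlgHom k K F).comp p) ε fun _ _ => .all _ _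

variable {ι : Type*} (e : Module.Basis ι k A)

lemma evalProd_tmul (ε : A →ₐ[k] F) (p : B →ₐ[k] K) (b : B) (a : A) :
    evalProd ε p (b ⊗ₜ a) = algebraMap K F (p b) * ε a := by
  simp [evalProd]

lemma evalProd_eq_sum (ε : A →ₐ[k] F) (p : B →ₐ[k] K) (x : B ⊗[k] A) :
    evalProd ε p x = ((Algebra.TensorProduct.basis B e).repr x).sum
      fun i b => p b • ε (e i) := by
  conv_lhs => rw [← (Algebra.TensorProduct.basis B e).linearCombination_repr x]
  rw [Finsupp.linearCombination_apply, Finsupp.sum, map_sum]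
  refine Finset.sum_congr rfl fun i _ => ?_
  rw [Algebra.TensorProduct.basis_apply, TensorProduct.smul_tmul', evalProd_tmul, smul_eq_mul,
    _root_.mul_one]
  exact (Algebra.smul_def _ _).symm

/-- Expanding in the basis `e`, whose images are independent over K, turns one equation in the
function field into K-linear equations whose coefficients are values of elements of B. The
coefficients no longer involve the function field. -/
lemma sum_smul_evalProd_eq_zero_iff {ε : A →ₐ[k] F} (hε : LinearIndependent K (ε ∘ e))
    (p : B →ₐ[k] K) {n : Type*} [Fintype n] (x : n → K) (y : n → B ⊗[k] A) :
    ∑ j, x j • evalProd ε p (y j) = 0 ↔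
      ∀ i, ∑ j, p ((Algebra.TensorProduct.basis B e).repr (y j) i) * x j = 0 := by
  classical
  let s : Finset ι := Finset.univ.biUnion fun j => ((Algebra.TensorProduct.basis B e).repr (y j)).support
  have h1 : ∀ j, evalProd ε p (y j) =
      ∑ i ∈ s, p ((Algebra.TensorProduct.basis B e).repr (y j) i) • ε (e i) := fun j => by
    rw [evalProd_eq_sum e, Finsupp.sum]
    refine Finset.sum_subset (fun i hi => Finset.mem_biUnion.2 ⟨j, Finset.mem_univ _, hi⟩) ?_
    intro i _ hi
    rw [Finsupp.notMem_support_iff.1 hi, map_zero, zero_smul]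
  have h2 : ∑ j, x j • evalProd ε p (y j) = ∑ i ∈ s,
      (∑ j, p ((Algebra.TensorProduct.basis B e).repr (y j) i) * x j) • ε (e i) := by
    simp_rw [h1, Finset.smul_sum, Finset.sum_smul]
    rw [Finset.sum_comm]
    exact Finset.sum_congr rfl fun i _ => Finset.sum_congr rfl fun j _ => by
      rw [smul_smul, _root_.mul_comm]
  rw [h2]
  constructor
  · intro h i
    by_cases hi : i ∈ s
    · exact linearIndependent_iff'.1 hε s _ h i hi
    · refine Finset.sum_eq_zero fun j _ => ?_
      have : i ∉ ((Algebra.TensorProduct.basis B e).repr (y j)).support := fun h =>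
        hi (Finset.mem_biUnion.2 ⟨j, Finset.mem_univ _, h⟩)
      rw [Finsupp.notMem_support_iff.1 this, map_zero, zero_mul]
  · intro h
    exact Finset.sum_eq_zero fun i _ => by rw [h, zero_smul]

/-- Suppose that at all points `p` of a nonempty basic open set of `Spec B` the functions `q i`
become, up to a common factor, linear combinations of the functions `β j` with constant coefficients
forming an invertible matrix. Then, locally on `Spec B`, these coefficients can be chosen to be
regular functions. -/
theorem exists_generic_matrix [IsAlgClosed K] {N : ℕ} [NeZero N]
    (hsep : ∀ b : B, (∀ p : B →ₐ[k] K, p b = 0) → b = 0)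
    {ε : A →ₐ[k] F} (hε : LinearIndependent K (ε ∘ e)) (β : Fin N → A)
    (hβ : LinearIndependent K (ε ∘ β)) (s : B ⊗[k] A) (q : Fin N → B ⊗[k] A)
    (h : ∀ p : B →ₐ[k] K, evalProd ε p s ≠ 0 → ∃ ψ : F, ψ ≠ 0 ∧ ∃ a : Matrix (Fin N) (Fin N) K,
      IsUnit a.det ∧ ∀ i, evalProd ε p (q i) = ψ * ∑ j, a i j • ε (β j))
    (p₀ : B →ₐ[k] K) (hp₀ : evalProd ε p₀ s ≠ 0) :
    ∃ (d : B) (a : Matrix (Fin N) (Fin N) B), p₀ d ≠ 0 ∧ (∃ d', d = a.det * d') ∧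
      ∀ p : B →ₐ[k] K, p d ≠ 0 → evalProd ε p s ≠ 0 ∧
        ∃ ψ : F, ψ ≠ 0 ∧ ∀ i, evalProd ε p (q i) = ψ * ∑ j, p (a i j) • ε (β j) := by
  classical
  have hsum_ne : ∀ (a : Matrix (Fin N) (Fin N) K), IsUnit a.det → ∀ i,
      ∑ j, a i j • ε (β j) ≠ 0 := fun a ha i h0 => by
    have h1 := Fintype.linearIndependent_iff.1 hβ _ h0
    rw [Matrix.det_eq_zero_of_row_eq_zero i h1] at ha
    exact not_isUnit_zero ha
  -- A coefficient `c` ∈ B of `s` which is nonzero at `p₀` cuts out a basic open subset of Spec B on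
  -- which `s` does not vanish identically along the fibre.
  obtain ⟨i₁, hi₁⟩ : ∃ i, p₀ ((Algebra.TensorProduct.basis B e).repr s i) ≠ 0 := by
    by_contra! h0
    apply hp₀
    rw [evalProd_eq_sum e]
    exact Finset.sum_eq_zero fun i _ => by simp only [h0, zero_smul]
  set c := (Algebra.TensorProduct.basis B e).repr s i₁ with hc
  have hcs : ∀ p : B →ₐ[k] K, p c ≠ 0 → evalProd ε p s ≠ 0 := fun p hp h0 => by
    have := (sum_smul_evalProd_eq_zero_iff e hε p (fun _ : Unit => 1) fun _ => s).1
      (by simpa using h0) i₁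
    exact hp (by simpa using this)
  -- Eliminating ψ from q_i = ψ · (row i) gives q_{i'} · (row i) = q_i · (row i'), which is linear
  -- in the entries of the matrix.
  let y : Fin N × Fin N → Fin N × Fin N → B ⊗[k] A := fun r l =>
    (if l.1 = r.1 then q r.2 * (1 ⊗ₜ β l.2) else 0) -
      (if l.1 = r.2 then q r.1 * (1 ⊗ₜ β l.2) else 0)
  have hy : ∀ (p : B →ₐ[k] K) (x : Fin N × Fin N → K) r,
      ∑ l, x l • evalProd ε p (y r l) =
        evalProd ε p (q r.2) * ∑ j, x (r.1, j) • ε (β j) -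
          evalProd ε p (q r.1) * ∑ j, x (r.2, j) • ε (β j) := by
    intro p x r
    simp only [y, map_sub, apply_ite (evalProd ε p), map_zero, map_mul, evalProd_tmul, map_one,
      _root_.one_mul, smul_sub, Finset.sum_sub_distrib, smul_ite, smul_zero, Fintype.sum_prod_type,
      Finset.mul_sum, mul_smul_comm]
    congr 1
    · rw [Finset.sum_comm]; simp
    · rw [Finset.sum_comm]; simp
  have hyΦ := fun (p : B →ₐ[k] K) (x : Fin N × Fin N → K) r =>
    sum_smul_evalProd_eq_zero_iff e hε p x (y r)
  let Φ : (Fin N × Fin N) × ι → Fin N × Fin N → B := fun r l =>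
    (Algebra.TensorProduct.basis B e).repr (y r.1 l) r.2
  have hΦ : ∀ (p : B →ₐ[k] K) (x : Fin N × Fin N → K), (∀ r, ∑ l, p (Φ r l) * x l = 0) ↔
      ∀ i i', evalProd ε p (q i') * ∑ j, x (i, j) • ε (β j) =
        evalProd ε p (q i) * ∑ j, x (i', j) • ε (β j) := by
    intro p x
    constructor
    · intro h i i'
      have := (hyΦ p x (i, i')).2 fun t => h ((i, i'), t)
      rw [hy] at this
      exact sub_eq_zero.1 this
    · rintro h ⟨⟨i, i'⟩, t⟩
      refine (hyΦ p x (i, i')).1 ?_ t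
      rw [hy]
      exact sub_eq_zero.2 (h i i')
  have hsolution : ∀ (p : B →ₐ[k] K) (ψ : F) (a : Matrix (Fin N) (Fin N) K),
      (∀ i, evalProd ε p (q i) = ψ * ∑ j, a i j • ε (β j)) →
      ∀ r, ∑ l, p (Φ r l) * a l.1 l.2 = 0 := fun p ψ a ha =>
    (hΦ p fun l => a l.1 l.2).2 fun i i' => by rw [ha, ha]; ring
  have hne : ∀ a : Matrix (Fin N) (Fin N) K, IsUnit a.det →
      (fun l : Fin N × Fin N => a l.1 l.2) ≠ 0 := fun a ha h0 => by
    refine hsum_ne a ha 0 (Finset.sum_eq_zero fun j _ => ?_)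
    rw [show a 0 j = 0 from congrFun h0 (0, j), zero_smul]
  obtain ⟨ψ₀, hψ₀, a₀, ha₀, hq₀⟩ := h p₀ hp₀
  -- Two solutions differ by a factor in F common to all rows; by `eq_smul_of_eq_mul_sum` this
  -- factor can be replaced by a constant.
  have huniq : ∀ x : Fin N × Fin N → K, (∀ r, ∑ l, p₀ (Φ r l) * x l = 0) →
      ∃ c : K, x = c • fun l => a₀ l.1 l.2 := by
    intro x hx
    rw [hΦ] at hx
    have h1 := hsum_ne a₀ ha₀
    obtain ⟨c, hc⟩ := eq_smul_of_eq_mul_sum (F := F) (β := ε ∘ β) hβ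
      (x := Matrix.of fun i j => x (i, j)) ha₀
      (θ := (∑ j, x (0, j) • ε (β j)) / ∑ j, a₀ 0 j • ε (β j)) (fun i => by
        have h2 := hx i 0
        rw [hq₀, hq₀] at h2
        have h3 : (∑ j, a₀ 0 j • ε (β j)) * ∑ j, x (i, j) • ε (β j) =
            (∑ j, a₀ i j • ε (β j)) * ∑ j, x (0, j) • ε (β j) :=
          mul_left_cancel₀ hψ₀ (by rw [← _root_.mul_assoc, ← _root_.mul_assoc, h2])
        simp only [Matrix.of_apply, Function.comp_apply]
        rw [div_mul_eq_mul_div, eq_div_iff (h1 0), _root_.mul_comm, h3, _root_.mul_comm])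
    exact ⟨c, funext fun l => congrFun (congrFun hc l.1) l.2⟩
  obtain ⟨x, ⟨l₀, hl₀⟩, hx⟩ := exists_solution_of_forall_point hsep Φ c
    (fun p hp => by
      obtain ⟨ψ, hψ, a, ha, hq⟩ := h p (hcs p hp)
      exact ⟨_, hne a ha, hsolution p ψ a hq⟩)
    p₀ hi₁ (fun l => a₀ l.1 l.2) (hne a₀ ha₀) (hsolution p₀ ψ₀ a₀ hq₀) huniq
  have hxp : ∀ p : B →ₐ[k] K, ∀ r, ∑ l, p (Φ r l) * p (x l) = 0 := fun p r => by
    simp_rw [← map_mul]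
    rw [← map_sum, hx, map_zero]
  let a : Matrix (Fin N) (Fin N) B := Matrix.of fun i j => x (i, j)
  have hdet : ∀ p : B →ₐ[k] K, p a.det = (a.map p).det := fun p => RingHom.map_det p.toRingHom _
  refine ⟨a.det * c, a, ?_, ⟨c, rfl⟩, fun p hp => ?_⟩
  · rw [map_mul]
    refine mul_ne_zero ?_ hi₁
    obtain ⟨t, ht⟩ := huniq _ (hxp p₀)
    have hmap : a.map p₀ = t • a₀ := by
      ext i j
      exact congrFun ht (i, j)
    rw [hdet, hmap, Matrix.det_smul]
    refine mul_ne_zero (pow_ne_zero _ ?_) ha₀.ne_zero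
    rintro rfl
    exact hl₀ (by simpa using congrFun ht l₀)
  · rw [map_mul] at hp
    have hpc := right_ne_zero_of_mul hp
    have hpa : IsUnit (a.map p).det := by
      rw [← hdet]
      exact (left_ne_zero_of_mul hp).isUnit
    refine ⟨hcs p hpc, ?_⟩
    have h1 : ∀ i, ∑ j, p (a i j) • ε (β j) ≠ 0 := hsum_ne _ hpa
    obtain ⟨ψ, hψ, a', ha', hq⟩ := h p (hcs p hpc)
    have h2 := (hΦ p _).1 (hxp p)
    refine ⟨evalProd ε p (q 0) / ∑ j, p (a 0 j) • ε (β j), div_ne_zero ?_ (h1 0), fun i => ?_⟩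
    · rw [hq]
      exact mul_ne_zero hψ (hsum_ne a' ha' 0)
    · rw [div_mul_eq_mul_div, eq_div_iff (h1 0)]
      exact (h2 0 i)

end Points

end LinearAlgebra

end

section

/-! ### Rational functions without zeros and poles on a normal scheme -/

section Divisors

open Order

lemma isDiscreteValuationRing_stalk {Y : Scheme.{u}} [IsIntegral Y] [IsLocallyNoetherian Y]
    (hY : IsNormalScheme Y) {y : Y} (hy : coheight y = 1) :
    IsDiscreteValuationRing (Y.presheaf.stalk y) := by
  have : IsIntegrallyClosed (Y.presheaf.stalk y) := (hY y).2
  have hdim := ringKrullDim_stalk_eq_coheight y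
  rw [hy] at hdim
  have hle : Ring.KrullDimLE 1 (Y.presheaf.stalk y) := krullDimLE_of_coheight_le hy.le
  have hnf : ¬ IsField (Y.presheaf.stalk y) := fun h => by
    rw [ringKrullDim_eq_zero_of_isField h] at hdim
    exact absurd hdim (by norm_num)
  have : Ring.DimensionLEOne (Y.presheaf.stalk y) := by
    refine ⟨fun {p} hp0 hp => ?_⟩
    rcases Ring.krullDimLE_one_iff.1 hle p hp with h | h
    · exact absurd (by simpa [IsDomain.minimalPrimes_eq_singleton_bot] using h) hp0
    · exact h
  have : IsDedekindDomain (Y.presheaf.stalk y) := { }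
  exact ((IsDiscreteValuationRing.TFAE _ hnf).out 0 2).2 this

lemma exists_algebraMap_stalk_of_ord_eq_zero {Y : Scheme.{u}} [IsIntegral Y]
    [IsLocallyNoetherian Y] (hY : IsNormalScheme Y) {f : Y.functionField} (hf : f ≠ 0) {y : Y}
    (hy : coheight y = 1) (h : Scheme.ord f y = 0) :
    ∃ g, algebraMap (Y.presheaf.stalk y) Y.functionField g = f := by
  have := isDiscreteValuationRing_stalk hY hy
  have hle : Ring.KrullDimLE 1 (Y.presheaf.stalk y) := krullDimLE_of_coheight_le hy.le
  rw [Scheme.ord_eq_iff hy hf] at h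
  obtain ⟨u, hu⟩ := Ring.associated_of_ordFrac_eq (R := Y.presheaf.stalk y)
    (1 : Y.functionField) f ((map_one _).trans h.symm)
  refine ⟨u, ?_⟩
  rw [← hu, Units.smul_def, Algebra.smul_def, _root_.mul_one]

lemma exists_primeIdealOf_eq {Y : Scheme.{u}} {U : Y.Opens} (hU : IsAffineOpen U)
    (p : PrimeSpectrum Γ(Y, U)) : ∃ x : U, hU.primeIdealOf x = p := by
  refine ⟨⟨hU.fromSpec p, (hU.isoSpec.inv p).2⟩, ?_⟩
  refine hU.fromSpec.isOpenEmbedding.injective ?_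
  exact hU.fromSpec_primeIdealOf _

lemma isIntegrallyClosed_section {Y : Scheme.{u}} [IsIntegral Y] (hY : IsNormalScheme Y)
    {U : Y.Opens} (hU : IsAffineOpen U) [Nonempty U] : IsIntegrallyClosed Γ(Y, U) := by
  refine IsIntegrallyClosed.of_localization_maximal fun p _ hp => ?_
  obtain ⟨x, hx⟩ := exists_primeIdealOf_eq hU ⟨p, hp.isPrime⟩
  have h1 := hU.isLocalization_stalk x
  have h2 : p = (hU.primeIdealOf x).asIdeal := by rw [hx]
  subst h2
  have := (hY x).2
  exact .of_equiv (IsLocalization.algEquiv (hU.primeIdealOf x).asIdeal.primeCompl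
    (Y.presheaf.stalk x.1) (Localization.AtPrime (hU.primeIdealOf x).asIdeal)).toRingEquiv

/-- Primes of height one in the coordinate ring are the points of codimension one. The local rings
there are discrete valuation rings, in which a function of order zero is a unit, so algebraic
Hartogs applies. -/
lemma exists_section_affine_of_ord_eq_zero {Y : Scheme.{u}} [IsIntegral Y]
    [IsLocallyNoetherian Y] (hY : IsNormalScheme Y) {f : Y.functionField} (hf : f ≠ 0)
    (h : ∀ y, Scheme.ord f y = 0) {U : Y.Opens} (hU : IsAffineOpen U) [Nonempty U] :
    ∃ s : Γ(Y, U), Y.germToFunctionField U s = f := by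
  have : IsNoetherianRing Γ(Y, U) := IsLocallyNoetherian.component_noetherian ⟨U, hU⟩
  have hfr := functionField_isFractionRing_of_isAffineOpen Y U hU
  have := isIntegrallyClosed_section hY hU
  refine mem_range_of_forall_height_one f fun p hp hp1 => ?_
  obtain ⟨x, hx⟩ := exists_primeIdealOf_eq hU ⟨p, hp⟩
  have h2 : p = (hU.primeIdealOf x).asIdeal := by rw [hx]
  have hco : coheight x.1 = 1 := by
    let z : Spec Γ(Y, U) := hU.primeIdealOf x
    have h3 : hU.fromSpec z = x.1 := hU.fromSpec_primeIdealOf x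
    have h4 := coheight_eq_of_isOpenImmersion (x := z) hU.fromSpec
    rw [h3] at h4
    exact h4.trans ((idealHeight_eq_coheight Γ(Y, U) z).symm.trans (h2 ▸ hp1))
  obtain ⟨g, rfl⟩ := exists_algebraMap_stalk_of_ord_eq_zero hY hf hco (h x.1)
  have h1 := hU.isLocalization_stalk x
  have h3 := functionField_isScalarTower Y U x
  obtain ⟨⟨a, b⟩, hab⟩ := IsLocalization.surj (hU.primeIdealOf x).asIdeal.primeCompl g
  refine ⟨a, b, h2 ▸ b.2, ?_⟩
  rw [IsScalarTower.algebraMap_apply Γ(Y, U) (Y.presheaf.stalk x.1) Y.functionField,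
    IsScalarTower.algebraMap_apply Γ(Y, U) (Y.presheaf.stalk x.1) Y.functionField, ← map_mul, hab]

lemma germToFunctionField_res {Y : Scheme.{u}} [IrreducibleSpace Y] {U V : Y.Opens} [Nonempty U]
    [Nonempty V] (i : V ⟶ U) (s : Γ(Y, U)) :
    Y.germToFunctionField V (Y.presheaf.map i.op s) = Y.germToFunctionField U s :=
  Y.presheaf.germ_res_apply i _ _ s

/-- A section over a nonempty open set is determined by its germ at the generic point, so the
sections on affine open sets agree on overlaps and glue. -/
lemma exists_section_of_forall_affine {Y : Scheme.{u}} [IsIntegral Y] {f : Y.functionField}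
    (h : ∀ U : Y.Opens, IsAffineOpen U → ∀ [Nonempty U],
      ∃ s : Γ(Y, U), Y.germToFunctionField U s = f) :
    ∃ s : Γ(Y, ⊤), Y.germToFunctionField ⊤ s = f := by
  let ι := {U : Y.Opens // IsAffineOpen U ∧ Nonempty U}
  have hne : ∀ i : ι, Nonempty i.1 := fun i => i.2.2
  choose s hs using fun i : ι => h i.1 i.2.1
  have hcov : ⊤ ≤ iSup (fun i : ι => i.1) := fun y _ => by
    obtain ⟨U, hU, hy, -⟩ := exists_isAffineOpen_mem_and_subset (x := y) (U := ⊤) trivial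
    exact TopologicalSpace.Opens.mem_iSup.2 ⟨⟨U, hU, ⟨⟨y, hy⟩⟩⟩, hy⟩
  obtain ⟨t, ht, -⟩ := Y.sheaf.existsUnique_gluing' (fun i : ι => i.1) ⊤
    (fun i => homOfLE le_top) hcov s fun i j => by
      have : Nonempty (i.1 ⊓ j.1 : Y.Opens) := by
        obtain ⟨x, hx⟩ := nonempty_preirreducible_inter i.1.2 j.1.2
          (Set.nonempty_coe_sort.1 (hne i)) (Set.nonempty_coe_sort.1 (hne j))
        exact ⟨⟨x, hx⟩⟩
      refine Y.germToFunctionField_injective (i.1 ⊓ j.1) ?_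
      exact (germToFunctionField_res (i.1.infLELeft j.1) (s i)).trans
        ((hs i).trans ((hs j).symm.trans (germToFunctionField_res (i.1.infLERight j.1) (s j)).symm))
  refine ⟨t, ?_⟩
  obtain ⟨x⟩ : Nonempty Y := inferInstance
  obtain ⟨i, -⟩ := TopologicalSpace.Opens.mem_iSup.1 (hcov (show x ∈ ⊤ from trivial))
  rw [← hs i, ← ht i]
  exact (germToFunctionField_res (homOfLE le_top) t).symm

end Divisors
-- Projective schemes are proper; global functions are constant
section Proper

variable {k : Type u} [Field k]

attribute [local instance] MvPolynomial.gradedAlgebra in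
lemma isProper_projSpace (n : ℕ) : IsProper (ProjSpace k n).hom := by
  -- `Proj` is proper over the spectrum of the degree-zero part of the graded ring, which is k here.
  have hbij : Function.Bijective (algebraMap k (MvPolynomial.homogeneousSubmodule (Fin (n + 1)) k 0)) := by
    refine ⟨fun x y h => MvPolynomial.C_injective (Fin (n + 1)) k (congrArg Subtype.val h), fun x => ?_⟩
    have hx := x.2
    rw [MvPolynomial.mem_homogeneousSubmodule] at hx
    have := MvPolynomial.totalDegree_eq_zero_iff_eq_C.1 (Nat.le_zero.1 hx.totalDegree_le)
    exact ⟨_, Subtype.ext this.symm⟩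
  have : IsIso (CommRingCat.ofHom (algebraMap k (MvPolynomial.homogeneousSubmodule (Fin (n + 1)) k 0))) :=
    (ConcreteCategory.isIso_iff_bijective _).2 hbij
  have hft : Algebra.FiniteType (MvPolynomial.homogeneousSubmodule (Fin (n + 1)) k 0) (MvPolynomial (Fin (n+1)) k) := by
    refine RingHom.FiniteType.of_comp_finiteType (f := algebraMap k _) ?_
    exact (RingHom.finiteType_algebraMap.2 inferInstance :
      (algebraMap k (MvPolynomial (Fin (n + 1)) k)).FiniteType)
  exact inferInstanceAs (IsProper (Proj.toSpecZero (MvPolynomial.homogeneousSubmodule (Fin (n + 1)) k) ≫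
      Spec.map (CommRingCat.ofHom (algebraMap k (MvPolynomial.homogeneousSubmodule (Fin (n + 1)) k 0)))))

lemma IsProjective.isProper {X : Over (Spec (.of k))} (h : IsProjective X) : IsProper X.hom := by
  obtain ⟨n, i, hi⟩ := h
  have := isProper_projSpace (k := k) n
  rw [← Over.w i]
  infer_instance

instance (X : Over (Spec (.of k))) (K : Type u) [Field K] [Algebra k K]
    [IsProper X.hom] : IsProper (baseChange X K).hom :=
  inferInstanceAs (IsProper (pullback.snd X.hom (SpecExt k K).hom))

/-- Global sections are integral over k because the structure morphism is universally closed, and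
they form a domain over the algebraically closed field k. -/
lemma exists_algebraMap_of_section {Y : Over (Spec (.of k))} [IsIntegral Y.left] [IsAlgClosed k] [IsProper Y.hom]
    (s : Γ(Y.left, ⊤)) : ∃ c : k, algebraMap k (RatFun Y) c = Y.left.germToFunctionField ⊤ s := by
  have h : ((Scheme.ΓSpecIso (.of k)).inv ≫ Y.hom.appTop).hom.IsIntegral :=
    RingHom.isIntegral_respectsIso.2 _ (Scheme.ΓSpecIso _).symm.commRingCatIsoToRingEquiv (isIntegral_appTop_of_universallyClosed Y.hom)
  algebraize [((Scheme.ΓSpecIso (.of k)).inv ≫ Y.hom.appTop).hom]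
  obtain ⟨c, hc⟩ := (IsAlgClosed.algebraMap_bijective_of_isIntegral (k := k) (K := Γ(Y.left, ⊤))).2 s
  exact ⟨c, congrArg (Y.left.germToFunctionField ⊤) hc⟩

end Proper

end

section

/-! ### Affine charts of X and X_K and the function field of X_K -/

open scoped TensorProduct
variable {k : Type u} [Field k]

/-- The spectrum of a `k`-algebra, as a scheme over `k`. -/
abbrev SpecAlg (k A : Type u) [Field k] [CommRing A] [Algebra k A] : Over (Spec (.of k)) :=
  Over.mk (Spec.map (CommRingCat.ofHom (algebraMap k A)))

/-- The isomorphism of `R` with the sections over the image of an open immersion `Spec R ⟶ Y`. -/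
lemma exists_ringEquiv_section_opensRange {Y : Scheme.{u}} {R : Type u} [CommRing R]
    (j : Spec (.of R) ⟶ Y) [IsOpenImmersion j] : ∃ t : R ≃+* Γ(Y, j.opensRange),
      Spec.map (CommRingCat.ofHom t.toRingHom) ≫ j = (isAffineOpen_opensRange j).fromSpec := by
  have hU : IsAffineOpen j.opensRange := isAffineOpen_opensRange j
  let e : Spec (.of R) ≅ Spec Γ(Y, j.opensRange) :=
    IsOpenImmersion.isoOfRangeEq j hU.fromSpec (by simp)
  have he : e.inv ≫ j = hU.fromSpec := IsOpenImmersion.isoOfRangeEq_inv_fac _ _ _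
  let t : CommRingCat.of R ≅ Γ(Y, j.opensRange) := (Scheme.Spec.preimageIso e.symm).unop
  have ht : Spec.map t.hom = e.inv := Scheme.Spec.map_preimage e.inv
  exact ⟨t.commRingCatIsoToRingEquiv, by rw [← he, ← ht]; rfl⟩

/-- The generic point lies in every nonempty open set and so factors through the chart. This
factorization is part of the conclusion because it pins down `φ` and makes different charts
comparable. -/
lemma exists_ringHom_functionField {Y : Scheme.{u}} [IsIntegral Y] {R : Type u} [CommRing R]
    [Nontrivial R] (j : Spec (.of R) ⟶ Y) [IsOpenImmersion j] :
    ∃ φ : R →+* Y.functionField,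
      Spec.map (CommRingCat.ofHom φ) ≫ j = Y.fromSpecStalk (genericPoint Y) ∧
      Function.Injective φ ∧ ∀ f, ∃ a b, b ≠ 0 ∧ f * φ b = φ a := by
  have hU : IsAffineOpen j.opensRange := isAffineOpen_opensRange j
  have : Nonempty j.opensRange := ⟨⟨j (Nonempty.some inferInstance), ⟨_, rfl⟩⟩⟩
  have hfr := functionField_isFractionRing_of_isAffineOpen Y _ hU
  obtain ⟨t, ht⟩ := exists_ringEquiv_section_opensRange j
  have hx : genericPoint Y ∈ j.opensRange :=
    (genericPoint_spec Y).mem_open_set_iff j.opensRange.2 |>.2 (by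
      simpa using Set.nonempty_coe_sort.1 this)
  refine ⟨(Y.germToFunctionField j.opensRange).hom.comp t.toRingHom, ?_, ?_, fun f => ?_⟩
  · rw [← hU.fromSpecStalk_eq_fromSpecStalk hx, IsAffineOpen.fromSpecStalk, ← ht,
      ← Spec.map_comp_assoc]
    rfl
  · exact (Y.germToFunctionField_injective _).comp t.injective
  · obtain ⟨a, b, hb, rfl⟩ := IsFractionRing.div_surjective (A := Γ(Y, j.opensRange)) f
    have hb0 := nonZeroDivisors.ne_zero hb
    refine ⟨t.symm a, t.symm b, by simpa using hb0, ?_⟩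
    change _ * algebraMap _ Y.functionField (t (t.symm b)) =
      algebraMap _ Y.functionField (t (t.symm a))
    rw [t.apply_symm_apply, t.apply_symm_apply, div_mul_cancel₀]
    exact (map_ne_zero_iff _ (IsFractionRing.injective _ _)).2 hb0

variable (K : Type u) [Field K] [Algebra k K] {A : Type u} [CommRing A] [Algebra k A]

lemma isPullback_specAlg_tensor : IsPullback
    (Spec.map (CommRingCat.ofHom (Algebra.TensorProduct.includeRight : A →ₐ[k] K ⊗[k] A).toRingHom))
    (SpecAlg K (K ⊗[k] A)).hom (SpecAlg k A).hom (SpecExt k K).hom :=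
  (isPullback_SpecMap_of_isPushout _ _ _ _ (CommRingCat.isPushout_tensorProduct k K A)).flip

/-- The base change of an affine chart. -/
def baseChangeChart {X : Over (Spec (.of k))} (j : SpecAlg k A ⟶ X) :
    SpecAlg K (K ⊗[k] A) ⟶ baseChange X K :=
  Over.homMk (pullback.lift
    (Spec.map (CommRingCat.ofHom (Algebra.TensorProduct.includeRight : A →ₐ[k] K ⊗[k] A).toRingHom) ≫ j.left)
    (SpecAlg K (K ⊗[k] A)).hom
    (by rw [Category.assoc, Over.w j]; exact (isPullback_specAlg_tensor K).w)) (pullback.lift_snd _ _ _)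

lemma baseChangeChart_fst {X : Over (Spec (.of k))} (j : SpecAlg k A ⟶ X) :
    (baseChangeChart K j).left ≫ pullback.fst X.hom (SpecExt k K).hom =
    Spec.map (CommRingCat.ofHom (Algebra.TensorProduct.includeRight : A →ₐ[k] K ⊗[k] A).toRingHom) ≫ j.left :=
  pullback.lift_fst _ _ _

lemma isPullback_baseChangeChart {X : Over (Spec (.of k))} (j : SpecAlg k A ⟶ X) :
   IsPullback (baseChangeChart K j).left
    (Spec.map (CommRingCat.ofHom (Algebra.TensorProduct.includeRight : A →ₐ[k] K ⊗[k] A).toRingHom))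
    (pullback.fst X.hom (SpecExt k K).hom) j.left := by
  refine IsPullback.of_right ?_ (baseChangeChart_fst K j)
    (IsPullback.of_hasPullback X.hom (SpecExt k K).hom).flip
  have h1 : (baseChangeChart K j).left ≫ pullback.snd X.hom (SpecExt k K).hom =
    (SpecAlg K (K ⊗[k] A)).hom := pullback.lift_snd _ _ _
  rw [h1, Over.w j]
  exact (isPullback_specAlg_tensor K).flip

instance {X : Over (Spec (.of k))} (j : SpecAlg k A ⟶ X) [IsOpenImmersion j.left] :
    IsOpenImmersion (baseChangeChart K j).left :=
  MorphismProperty.of_isPullback (P := @IsOpenImmersion) (isPullback_baseChangeChart K j).flip inferInstance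

lemma mem_opensRange_baseChangeChart {X : Over (Spec (.of k))} (j : SpecAlg k A ⟶ X)
    [IsOpenImmersion j.left] {y : (baseChange X K).left} :
    y ∈ (baseChangeChart K j).left.opensRange ↔
      pullback.fst X.hom (SpecExt k K).hom y ∈ j.left.opensRange := by
  have h := (isPullback_baseChangeChart K j)
  have h1 := h.isoPullback_hom_fst
  change y ∈ Set.range _ ↔ _ ∈ Set.range _
  rw [← h1, Scheme.Hom.comp_base, TopCat.coe_comp, Set.range_comp, Set.range_eq_univ.2 (Scheme.Hom.surjective _), Set.image_univ,
    Scheme.Pullback.range_fst]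
  rfl

lemma isIntegrallyClosed_stalk_of_chart {Y : Scheme.{u}} {R : Type u} [CommRing R] [IsDomain R]
    [IsIntegrallyClosed R] (j : Spec (.of R) ⟶ Y) [IsOpenImmersion j] {y : Y}
    (hy : y ∈ j.opensRange) :
    IsDomain (Y.presheaf.stalk y) ∧ IsIntegrallyClosed (Y.presheaf.stalk y) := by
  have hU : IsAffineOpen j.opensRange := isAffineOpen_opensRange j
  obtain ⟨t, -⟩ := exists_ringEquiv_section_opensRange j
  have : IsDomain Γ(Y, j.opensRange) := t.symm.toMulEquiv.isDomain _
  have : IsIntegrallyClosed Γ(Y, j.opensRange) := .of_equiv t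
  let := Y.presheaf.algebra_section_stalk ⟨y, hy⟩
  have hloc := hU.isLocalization_stalk ⟨y, hy⟩
  have hle := (hU.primeIdealOf ⟨y, hy⟩).asIdeal.primeCompl_le_nonZeroDivisors
  have : IsDomain (Y.presheaf.stalk y) := IsLocalization.isDomain_of_le_nonZeroDivisors (R := Γ(Y, j.opensRange)) _ hle
  exact ⟨this, isIntegrallyClosed_of_isLocalization (R := Γ(Y, j.opensRange)) _ _ hle⟩

lemma isDomain_tensor_of_chart {X : Over (Spec (.of k))} [GeometricallyIntegral X.hom]
    [Nontrivial A] (j : SpecAlg k A ⟶ X) [IsOpenImmersion j.left] : IsDomain (K ⊗[k] A) := by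
  have : Nonempty (SpecAlg K (K ⊗[k] A)).left := inferInstanceAs (Nonempty (PrimeSpectrum _))
  have : IsIntegral (SpecAlg K (K ⊗[k] A)).left :=
    isIntegral_of_isOpenImmersion (baseChangeChart K j).left
  exact (affine_isIntegral_iff (.of (K ⊗[k] A))).1 this

/-- The structure of a `k`-algebra on the sections of a scheme over `k`. -/
abbrev sectionAlgebra (X : Over (Spec (.of k))) (V : X.left.Opens) : Algebra k Γ(X.left, V) :=
  ((Scheme.ΓSpecIso (.of k)).inv ≫ X.hom.appLE ⊤ V le_top).hom.toAlgebra

lemma exists_chart (X : Over (Spec (.of k))) {V : X.left.Opens} (hV : IsAffineOpen V) :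
    letI := sectionAlgebra X V
    ∃ j : SpecAlg k Γ(X.left, V) ⟶ X, j.left = hV.fromSpec := by
  let := sectionAlgebra X V
  refine ⟨Over.homMk hV.fromSpec ?_, rfl⟩
  change _ = Spec.map ((Scheme.ΓSpecIso (.of k)).inv ≫ X.hom.appLE ⊤ V le_top)
  rw [Spec.map_comp, ← Scheme.isoSpec_Spec_inv, ← IsAffineOpen.fromSpec_top]
  exact (IsAffineOpen.SpecMap_appLE_fromSpec X.hom (isAffineOpen_top _) hV le_top).symm

lemma finiteType_section (X : Over (Spec (.of k))) [LocallyOfFiniteType X.hom] {V : X.left.Opens}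
    (hV : IsAffineOpen V) : letI := sectionAlgebra X V; Algebra.FiniteType k Γ(X.left, V) := by
  have h := X.hom.finiteType_appLE (isAffineOpen_top _) hV le_top
  let := sectionAlgebra X V
  rw [← RingHom.finiteType_algebraMap]
  exact RingHom.finiteType_respectsIso.2 _ (Scheme.ΓSpecIso _).symm.commRingCatIsoToRingEquiv h

/-- Normality is local, and X_K is covered by spectra of K ⊗ A with A a normal domain. These rings
are domains by geometric integrality and normal by `isIntegrallyClosed_tensor`. -/
lemma isNormalScheme_baseChange {X : Over (Spec (.of k))} [GeometricallyIntegral X.hom]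
    (hX : IsNormalScheme X.left) [Algebra.IsSeparable k K] :
    IsNormalScheme (baseChange X K).left := fun y => by
  let x := pullback.fst X.hom (SpecExt k K).hom y
  obtain ⟨V, hV, hx, -⟩ := exists_isAffineOpen_mem_and_subset (x := x) (U := ⊤) trivial
  have : Nonempty V := ⟨⟨_, hx⟩⟩
  let := sectionAlgebra X V
  obtain ⟨j, hj⟩ := exists_chart X hV
  have hj' : IsOpenImmersion j.left := hj ▸ inferInstance
  have := isIntegrallyClosed_section hX hV
  have := isDomain_tensor_of_chart K j
  let e := Algebra.TensorProduct.comm k K Γ(X.left, V)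
  have : IsDomain (Γ(X.left, V) ⊗[k] K) := e.symm.toMulEquiv.isDomain _
  have := isIntegrallyClosed_tensor k Γ(X.left, V) K
  have : IsIntegrallyClosed (K ⊗[k] Γ(X.left, V)) := .of_equiv e.symm.toRingEquiv
  refine isIntegrallyClosed_stalk_of_chart (baseChangeChart K j).left ?_
  refine (mem_opensRange_baseChangeChart K j).2 ?_
  change x ∈ j.left.opensRange
  simpa [hj] using hx

lemma specMap_algebraMap_ratFun (Y : Over (Spec (.of k))) [IsIntegral Y.left] :
    Spec.map (CommRingCat.ofHom (algebraMap k (RatFun Y))) = genPt Y ≫ Y.hom := by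
  change Spec.map ((Scheme.ΓSpecIso (.of k)).inv ≫ Y.hom.appTop ≫
    Y.left.germToFunctionField ⊤) = _
  rw [Spec.map_comp, Spec.map_comp, Category.assoc]
  have h1 : genPt Y ≫ Y.left.toSpecΓ = Spec.map (Y.left.germToFunctionField ⊤) :=
    Scheme.fromSpecStalk_toSpecΓ _ _
  rw [← h1, Category.assoc, ← Scheme.toSpecΓ_naturality_assoc, toSpecΓ_SpecMap_ΓSpecIso_inv]
  exact congrArg (genPt Y ≫ ·) (Category.comp_id _)

/-- An affine chart of `X` defines regular functions on an open subset of `X_K`. -/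
lemma exists_algHom_ratFun {X : Over (Spec (.of k))} [GeometricallyIntegral X.hom] [Nontrivial A]
    (j : SpecAlg k A ⟶ X) [IsOpenImmersion j.left] :
    ∃ φ : K ⊗[k] A →ₐ[K] RatFun (baseChange X K), Function.Injective φ ∧
      (∀ f, ∃ a b, b ≠ 0 ∧ f * φ b = φ a) ∧
      Spec.map (CommRingCat.ofHom (φ.toRingHom.comp
        (Algebra.TensorProduct.includeRight : A →ₐ[k] K ⊗[k] A).toRingHom)) ≫ j.left =
      (genericPt X K).left := by
  have := isDomain_tensor_of_chart K j
  obtain ⟨φ, h1, h2, h3⟩ := exists_ringHom_functionField (baseChangeChart K j).left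
  have h4 : φ.comp (algebraMap K (K ⊗[k] A)) = algebraMap K (RatFun (baseChange X K)) := by
    have : CommRingCat.ofHom (φ.comp (algebraMap K (K ⊗[k] A))) = CommRingCat.ofHom (algebraMap K (RatFun (baseChange X K))) := by
      refine Spec.map_injective ?_
      rw [specMap_algebraMap_ratFun, CommRingCat.ofHom_comp, Spec.map_comp]
      refine (congrArg (Spec.map (CommRingCat.ofHom φ) ≫ ·) (Over.w (baseChangeChart K j)).symm).trans ?_
      exact (Category.assoc _ _ _).symm.trans (congrArg (· ≫ (baseChange X K).hom) h1)
    exact congrArg CommRingCat.Hom.hom this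
  refine ⟨⟨φ, fun c => RingHom.congr_fun h4 c⟩, h2, h3, ?_⟩
  change _ = genPt (baseChange X K) ≫ pullback.fst X.hom (SpecExt k K).hom
  refine Eq.trans ?_ (congrArg (· ≫ pullback.fst X.hom (SpecExt k K).hom) h1)
  dsimp only
  rw [Category.assoc, baseChangeChart_fst, ← Spec.map_comp_assoc]
  rfl

lemma chart_ext {X : Over (Spec (.of k))} (j : SpecAlg k A ⟶ X) [IsOpenImmersion j.left]
    {R : Type u} [CommRing R] {f g : A →+* R}
    (h : Spec.map (CommRingCat.ofHom f) ≫ j.left = Spec.map (CommRingCat.ofHom g) ≫ j.left) :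
    f = g := by
  have := Spec.map_injective ((cancel_mono j.left).1 h)
  exact congrArg CommRingCat.Hom.hom this

section Chart

variable {X : Over (Spec (.of k))} [GeometricallyIntegral X.hom] [Nontrivial A]
  (j : SpecAlg k A ⟶ X) [IsOpenImmersion j.left]

/-- The rational functions on `X_K` defined by functions on an affine chart of `X` and scalars. -/
def chartHom : K ⊗[k] A →ₐ[K] RatFun (baseChange X K) :=
  (exists_algHom_ratFun K j).choose

lemma chartHom_injective : Function.Injective (chartHom K j) :=
  (exists_algHom_ratFun K j).choose_spec.1

lemma exists_mul_chartHom_eq (f : RatFun (baseChange X K)) :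
    ∃ a b, b ≠ 0 ∧ f * chartHom K j b = chartHom K j a :=
  (exists_algHom_ratFun K j).choose_spec.2.1 f

lemma specMap_chartHom : Spec.map (CommRingCat.ofHom ((chartHom K j).toRingHom.comp
    (Algebra.TensorProduct.includeRight : A →ₐ[k] K ⊗[k] A).toRingHom)) ≫ j.left =
      (genericPt X K).left :=
  (exists_algHom_ratFun K j).choose_spec.2.2

/-- Through this, rational functions on X and their pull-backs to X_K are computed with the same
ring A. -/
lemma exists_ringHom_ratFun : ∃ α : A →+* RatFun X, Function.Injective α ∧
    (∀ f, ∃ a b, b ≠ 0 ∧ f * α b = α a) ∧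
    ∀ a, ratFunMap X K (α a) = chartHom K j (1 ⊗ₜ a) := by
  obtain ⟨α, h1, h2, h3⟩ := exists_ringHom_functionField j.left
  refine ⟨α, h2, h3, fun a => RingHom.congr_fun (f := (ratFunMap X K).comp α)
    (g := (chartHom K j).toRingHom.comp
    (Algebra.TensorProduct.includeRight : A →ₐ[k] K ⊗[k] A).toRingHom) (chart_ext j ?_) a⟩
  rw [specMap_chartHom, CommRingCat.ofHom_comp, Spec.map_comp, Category.assoc, h1]
  exact ratFunMap_spec X K

end Chart

/-- The morphism of spectra defined by a homomorphism of `k`-algebras. -/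
def SpecAlg.map {B : Type u} [CommRing B] [Algebra k B] (f : A →ₐ[k] B) :
    SpecAlg k B ⟶ SpecAlg k A :=
  Over.homMk (U := SpecAlg k B) (V := SpecAlg k A) (Spec.map (CommRingCat.ofHom f.toRingHom)) (by
    change _ ≫ Spec.map _ = Spec.map _
    rw [← Spec.map_comp, ← CommRingCat.ofHom_comp]
    congr 2
    exact f.comp_algebraMap)

instance isOpenImmersion_specAlg_map_away (s : A) : IsOpenImmersion
    (SpecAlg.map (IsScalarTower.toAlgHom k A (Localization.Away s))).left :=
  inferInstanceAs (IsOpenImmersion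
    (Spec.map (CommRingCat.ofHom (algebraMap A (Localization.Away s)))))

section Restrict

variable {K} {X : Over (Spec (.of k))} [GeometricallyIntegral X.hom] [Nontrivial A]

lemma chartHom_restrict (j : SpecAlg k A ⟶ X) [IsOpenImmersion j.left] {B : Type u} [CommRing B] [Algebra k B] [Nontrivial B] (f : A →ₐ[k] B)
    [IsOpenImmersion (SpecAlg.map f ≫ j).left] (a : A) :
    chartHom K (SpecAlg.map f ≫ j) (1 ⊗ₜ f a) = chartHom K j (1 ⊗ₜ a) := by
  refine RingHom.congr_fun (f := ((chartHom K (SpecAlg.map f ≫ j)).toRingHom.comp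
    (Algebra.TensorProduct.includeRight : B →ₐ[k] K ⊗[k] B).toRingHom).comp f.toRingHom)
    (g := (chartHom K j).toRingHom.comp
    (Algebra.TensorProduct.includeRight : A →ₐ[k] K ⊗[k] A).toRingHom) (chart_ext j ?_) a
  rw [specMap_chartHom, CommRingCat.ofHom_comp, Spec.map_comp, Category.assoc]
  exact specMap_chartHom K (SpecAlg.map f ≫ j)

/-- The chart is shrunk by inverting the product of the denominators, which makes all the given
functions regular at once. -/
lemma exists_restrict_of_ratFun (j : SpecAlg k A ⟶ X) [IsOpenImmersion j.left] [Algebra.FiniteType k A] {ι : Type*} [Finite ι]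
    (f : ι → RatFun X) :
    ∃ (A : Type u) (_ : CommRing A) (_ : Algebra k A) (_ : Nontrivial A) (j : SpecAlg k A ⟶ X)
      (_ : IsOpenImmersion j.left) (β : ι → A), Algebra.FiniteType k A ∧
      ∀ i, ratFunMap X K (f i) = chartHom K j (1 ⊗ₜ β i) := by
  classical
  cases nonempty_fintype ι
  obtain ⟨α, hα, hα2, hα3⟩ := exists_ringHom_ratFun K j
  choose a s hs0 hs using fun i => hα2 (f i)
  have : IsDomain A := hα.isDomain α
  let t := ∏ i, s i
  have ht : t ≠ 0 := Finset.prod_ne_zero_iff.2 fun i _ => hs0 i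
  have hnt : Nontrivial (Localization.Away t) :=
    (IsLocalization.injective (Localization.Away t)
      (powers_le_nonZeroDivisors_of_noZeroDivisors ht)).nontrivial
  let g := IsScalarTower.toAlgHom k A (Localization.Away t)
  have hunit : ∀ i, IsUnit (g (s i)) := fun i =>
    isUnit_of_dvd_unit (map_dvd g (Finset.dvd_prod_of_mem s (Finset.mem_univ i)))
      (IsLocalization.Away.algebraMap_isUnit t)
  choose r hr using fun i => (hunit i).exists_right_inv
  have : IsOpenImmersion (SpecAlg.map g ≫ j).left :=
    inferInstanceAs (IsOpenImmersion ((SpecAlg.map g).left ≫ j.left))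
  refine ⟨Localization.Away t, inferInstance, inferInstance, hnt, SpecAlg.map g ≫ j, this,
    fun i => g (a i) * r i, ?_, fun i => ?_⟩
  · have : Algebra.FiniteType A (Localization.Away t) := IsLocalization.finiteType_of_monoid_fg
      (Submonoid.powers t) _
    exact Algebra.FiniteType.trans (S := A) inferInstance this
  · have h1 := congrArg (ratFunMap X K) (hs i)
    rw [map_mul, hα3, hα3, ← chartHom_restrict j g, ← chartHom_restrict j g] at h1
    have h2 : ∀ x y, chartHom K (SpecAlg.map g ≫ j) (1 ⊗ₜ (x * y)) =
        chartHom K (SpecAlg.map g ≫ j) (1 ⊗ₜ x) * chartHom K (SpecAlg.map g ≫ j) (1 ⊗ₜ y) :=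
      fun x y => by rw [← map_mul, Algebra.TensorProduct.tmul_mul_tmul, _root_.one_mul]
    rw [h2, ← h1, _root_.mul_assoc, ← h2, hr, ← Algebra.TensorProduct.one_def, map_one,
      _root_.mul_one]

end Restrict

variable (X : Over (Spec (.of k))) [GeometricallyIntegral X.hom]

lemma exists_chart_of_ratFun [LocallyOfFiniteType X.hom] {ι : Type*} [Finite ι]
    (f : ι → RatFun X) :
    ∃ (A : Type u) (_ : CommRing A) (_ : Algebra k A) (_ : Nontrivial A) (j : SpecAlg k A ⟶ X)
      (_ : IsOpenImmersion j.left) (β : ι → A), Algebra.FiniteType k A ∧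
      ∀ i, ratFunMap X K (f i) = chartHom K j (1 ⊗ₜ β i) := by
  obtain ⟨x⟩ : Nonempty X.left := inferInstance
  obtain ⟨V, hV, hx, -⟩ := exists_isAffineOpen_mem_and_subset (x := x) (U := ⊤) trivial
  have : Nonempty V := ⟨⟨_, hx⟩⟩
  let := sectionAlgebra X V
  have hft := finiteType_section X hV
  obtain ⟨j, hj⟩ := exists_chart X hV
  have hj' : IsOpenImmersion j.left := hj ▸ inferInstance
  exact exists_restrict_of_ratFun j f

lemma ratFunMap_algebraMap (c : k) : ratFunMap X K (algebraMap k (RatFun X) c) =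
    algebraMap K (RatFun (baseChange X K)) (algebraMap k K c) := by
  refine RingHom.congr_fun (f := (ratFunMap X K).comp (algebraMap k (RatFun X)))
    (g := (algebraMap K (RatFun (baseChange X K))).comp (algebraMap k K)) ?_ c
  refine congrArg CommRingCat.Hom.hom (Spec.map_injective
    (a₁ := CommRingCat.ofHom ((ratFunMap X K).comp (algebraMap k (RatFun X))))
    (a₂ := CommRingCat.ofHom ((algebraMap K (RatFun (baseChange X K))).comp (algebraMap k K))) ?_)
  rw [CommRingCat.ofHom_comp (algebraMap k (RatFun X)),
    CommRingCat.ofHom_comp (algebraMap k K), Spec.map_comp, Spec.map_comp,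
    specMap_algebraMap_ratFun]
  refine (Category.assoc _ _ _).symm.trans ?_
  refine (congrArg (· ≫ X.hom) (ratFunMap_spec X K)).trans ?_
  refine Eq.trans ?_ (congrArg (· ≫ (SpecExt k K).hom) (specMap_algebraMap_ratFun (baseChange X K))).symm
  rw [Category.assoc, Category.assoc, pullback.condition]
  rfl

variable {X K} in
-- On a chart where all the functions are regular this is the flatness of K over k, since K ⊗ A
-- embeds into the function field of X_K.
lemma linearIndependent_ratFunMap [LocallyOfFiniteType X.hom] {ι : Type*} [Finite ι]
    {f : ι → RatFun X} (hf : LinearIndependent k f) :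
    LinearIndependent K fun i => ratFunMap X K (f i) := by
  obtain ⟨A, _, _, _, j, _, β, -, hβ⟩ := exists_chart_of_ratFun K X f
  have h1 : LinearIndependent k β := by
    cases nonempty_fintype ι
    rw [Fintype.linearIndependent_iff] at hf ⊢
    refine fun c hc => hf c ?_
    refine (ratFunMap X K).injective ?_
    have h3 : ∀ i, ratFunMap X K (c i • f i) = chartHom K j (1 ⊗ₜ (c i • β i)) := fun i => by
      rw [Algebra.smul_def, map_mul, hβ, ratFunMap_algebraMap, TensorProduct.tmul_smul,
        ← algebraMap_smul K (c i) ((1 : K) ⊗ₜ[k] β i), map_smul, Algebra.smul_def]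
    rw [map_sum, map_zero, Finset.sum_congr rfl fun i _ => h3 i, ← map_sum,
      ← TensorProduct.tmul_sum, hc, TensorProduct.tmul_zero, map_zero]
  have h2 : LinearIndependent K fun i => (1 : K) ⊗ₜ[k] β i :=
    Module.Flat.linearIndependent_one_tmul h1
  simp_rw [hβ]
  exact h2.map' (chartHom K j).toLinearMap (LinearMap.ker_eq_bot.2 (chartHom_injective K j))

variable {X K} in
/-- An automorphism of `k(X_K)` over `K` is determined by its restriction to `k(X)`. -/
lemma ratFun_algEquiv_ext [LocallyOfFiniteType X.hom]
    {σ σ' : RatFun (baseChange X K) ≃ₐ[K] RatFun (baseChange X K)}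
    (h : ∀ f, σ (ratFunMap X K f) = σ' (ratFunMap X K f)) : σ = σ' := by
  obtain ⟨A, _, _, _, j, _, -, -, -⟩ := exists_chart_of_ratFun K X (ι := Empty) Empty.elim
  obtain ⟨α, -, -, hα⟩ := exists_ringHom_ratFun K j
  -- K ⊗ A is spanned over K by functions coming from X, and its fractions exhaust the function
  -- field of X_K.
  have h3 : ∀ x, σ (chartHom K j x) = σ' (chartHom K j x) := fun x => by
    induction x using TensorProduct.induction_on with
    | zero => simp
    | add x y hx hy => simp only [map_add, hx, hy]
    | tmul c a =>
      have : (c ⊗ₜ[k] a : K ⊗[k] A) = c • (1 ⊗ₜ a) := by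
        rw [TensorProduct.smul_tmul', smul_eq_mul, _root_.mul_one]
      rw [this, map_smul, map_smul, map_smul, ← hα, h]
  ext f
  obtain ⟨a, b, hb, hab⟩ := exists_mul_chartHom_eq K j f
  have hb' : σ (chartHom K j b) ≠ 0 := by
    simpa using (map_ne_zero_iff _ (chartHom_injective K j)).2 hb
  refine mul_right_cancel₀ hb' ?_
  rw [← map_mul, hab, h3, h3, ← map_mul, hab]

end

section

/-! ### Linear systems preserved by a birational map, in terms of matrices -/

section LinearSystems

open Order

variable {K : Type u} [Field K] {Y : Over (Spec (.of K))} [IsIntegral Y.left]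

/-- Let `W` be spanned by the `β i`. The automorphism `σ⁻¹` multiplied by a rational function induces
on `W` the linear automorphism with matrix `M`. -/
def ActsBy {N : ℕ} (β : Fin N → RatFun Y) (σ : RatFun Y ≃ₐ[K] RatFun Y) (M : GL (Fin N) K) : Prop :=
  ∃ φ : RatFun Y, φ ≠ 0 ∧ ∀ c : Fin N → K,
    σ.symm (∑ i, c i • β i) = φ * ∑ i, (M.1.mulVec c) i • β i

variable {N : ℕ} {β : Fin N → RatFun Y} {σ σ' : RatFun Y ≃ₐ[K] RatFun Y} {M M' : GL (Fin N) K}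

lemma ActsBy.apply (h : ActsBy β σ M) : ∃ φ : RatFun Y, φ ≠ 0 ∧ ∀ c : Fin N → K,
    σ (∑ i, c i • β i) = φ * ∑ i, (M⁻¹.1.mulVec c) i • β i := by
  obtain ⟨φ, hφ, h⟩ := h
  refine ⟨(σ φ)⁻¹, by simpa using hφ, fun c => ?_⟩
  have := congrArg σ (h (M⁻¹.1.mulVec c))
  rw [σ.apply_symm_apply, map_mul, Matrix.mulVec_mulVec, ← Units.val_mul, mul_inv_cancel,
    Units.val_one, Matrix.one_mulVec] at this
  rw [this, inv_mul_cancel_left₀]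
  simpa using hφ

lemma ActsBy.of_apply {φ : RatFun Y} (hφ : φ ≠ 0) (h : ∀ c : Fin N → K,
    σ (∑ i, c i • β i) = φ * ∑ i, (M⁻¹.1.mulVec c) i • β i) : ActsBy β σ M := by
  refine ⟨(σ.symm φ)⁻¹, by simpa using hφ, fun c => ?_⟩
  have := congrArg σ.symm (h (M.1.mulVec c))
  rw [σ.symm_apply_apply, map_mul, Matrix.mulVec_mulVec, ← Units.val_mul, inv_mul_cancel,
    Units.val_one, Matrix.one_mulVec] at this
  rw [this, inv_mul_cancel_left₀]
  simpa using hφ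

lemma ActsBy.comp {σ'' : RatFun Y ≃ₐ[K] RatFun Y} (h : ActsBy β σ M) (h' : ActsBy β σ' M')
    (hc : ∀ f, σ'' f = σ' (σ f)) : ActsBy β σ'' (M * M') := by
  obtain ⟨φ, hφ, h⟩ := h
  obtain ⟨φ', hφ', h'⟩ := h'
  refine ⟨σ.symm φ' * φ, mul_ne_zero (by simpa using hφ') hφ, fun c => ?_⟩
  have : ∀ f, σ''.symm f = σ.symm (σ'.symm f) := fun f => by
    rw [AlgEquiv.symm_apply_eq, hc, σ.apply_symm_apply, σ'.apply_symm_apply]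
  rw [this, h', map_mul, h, Matrix.mulVec_mulVec, ← Units.val_mul, _root_.mul_assoc]

lemma ActsBy.symm (h : ActsBy β σ M) : ActsBy β σ.symm M⁻¹ := by
  obtain ⟨φ, hφ, h⟩ := h
  exact .of_apply hφ fun c => by rw [h, inv_inv]

/-- Every nonzero vector is an eigenvector of a b⁻¹, and such an endomorphism is scalar. -/
lemma matrix_eq_smul_of_forall_mulVec {N : ℕ} {a b : Matrix (Fin N) (Fin N) K} (hb : IsUnit b.det)
    (h : ∀ c : Fin N → K, c ≠ 0 → ∃ l : K, a.mulVec c = l • b.mulVec c) : ∃ l : K, a = l • b := by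
  have hb' : b * b⁻¹ = 1 := Matrix.mul_nonsing_inv b hb
  obtain ⟨l, hl⟩ := LinearMap.exists_eq_smul_id_of_forall_notLinearIndependent
    (f := (a * b⁻¹).mulVecLin) fun v hv => by
      have h1 : b⁻¹.mulVec v ≠ 0 := fun h0 => by
        have := congrArg b.mulVec h0
        rw [Matrix.mulVec_mulVec, hb', Matrix.one_mulVec, Matrix.mulVec_zero] at this
        exact hv.ne_zero 0 this
      obtain ⟨l, hl⟩ := h _ h1
      rw [Matrix.mulVec_mulVec, Matrix.mulVec_mulVec, hb', Matrix.one_mulVec] at hl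
      rw [LinearIndependent.pair_iff] at hv
      have := (hv l (-1) (by rw [Matrix.mulVecLin_apply, hl]; simp)).2
      norm_num at this
  refine ⟨l, ?_⟩
  have h2 : a * b⁻¹ = l • 1 := by
    refine Matrix.ext_of_mulVec_single fun i => ?_
    rw [Matrix.smul_mulVec, Matrix.one_mulVec]
    exact LinearMap.congr_fun hl (Pi.single i 1)
  calc a = a * b⁻¹ * b := by rw [_root_.mul_assoc, Matrix.nonsing_inv_mul b hb, _root_.mul_one]
    _ = l • b := by rw [h2, smul_mul_assoc, _root_.one_mul]

/-- The quotient of the two factors φ carries one independent family in the span of β to another, so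
`eq_smul_of_eq_mul_sum` applies. Its matrices act on rows, hence the transposes. -/
lemma ActsBy.eq_smul [IsAlgClosed K] (hβ : LinearIndependent K β) (h : ActsBy β σ M)
    (h' : ActsBy β σ M') : ∃ l : K, M'.1 = l • M.1 := by
  rcases N.eq_zero_or_pos with rfl | hN
  · exact ⟨0, by ext i; exact i.elim0⟩
  have : NeZero N := ⟨hN.ne'⟩
  obtain ⟨φ, hφ, h⟩ := h
  obtain ⟨φ', hφ', h'⟩ := h'
  have hM : IsUnit (M.1.transpose).det := by
    rw [Matrix.det_transpose]; exact (Matrix.isUnit_iff_isUnit_det _).1 M.isUnit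
  obtain ⟨l, hl⟩ := eq_smul_of_eq_mul_sum (x := M'.1.transpose) hβ hM (θ := φ / φ') fun i => by
    have h1 := (h (Pi.single i 1)).symm.trans (h' (Pi.single i 1))
    simp only [Matrix.mulVec_single_one] at h1
    rw [div_mul_eq_mul_div, eq_div_iff hφ', mul_comm]
    exact h1.symm
  exact ⟨l, by simpa using congrArg Matrix.transpose hl⟩

lemma linearCombination_ne_zero (hβ : LinearIndependent K β)
    {c : Fin N → K} (hc : c ≠ 0) : ∑ i, c i • β i ≠ 0 :=
  fun h => hc (funext (Fintype.linearIndependent_iff.1 hβ c h))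

lemma mulVec_ne_zero (M : GL (Fin N) K) {c : Fin N → K} (hc : c ≠ 0) : M.1.mulVec c ≠ 0 :=
  fun h => hc <| by
    have := congrArg M⁻¹.1.mulVec h
    rwa [Matrix.mulVec_mulVec, ← Units.val_mul, inv_mul_cancel, Units.val_one,
      Matrix.one_mulVec, Matrix.mulVec_zero] at this

lemma mem_pushforward_span_iff {φ : RatFun Y}
    (h : ∀ c : Fin N → K, σ.symm (∑ i, c i • β i) = φ * ∑ i, (M.1.mulVec c) i • β i)
    (f : RatFun Y) : f ∈ pushforward σ (Submodule.span K (Set.range β)) ↔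
      ∃ g ∈ Submodule.span K (Set.range β), f = φ * g := by
  constructor
  · rintro ⟨g, hg, rfl⟩
    obtain ⟨c, rfl⟩ := (Submodule.mem_span_range_iff_exists_fun K).1 hg
    exact ⟨_, (Submodule.mem_span_range_iff_exists_fun K).2 ⟨_, rfl⟩, h c⟩
  · rintro ⟨g, hg, rfl⟩
    obtain ⟨c, rfl⟩ := (Submodule.mem_span_range_iff_exists_fun K).1 hg
    refine ⟨_, (Submodule.mem_span_range_iff_exists_fun K).2 ⟨M⁻¹.1.mulVec c, rfl⟩, ?_⟩
    refine (h _).trans ?_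
    rw [Matrix.mulVec_mulVec, ← Units.val_mul, mul_inv_cancel, Units.val_one, Matrix.one_mulVec]

section

variable [IsLocallyNoetherian Y.left]

lemma ord_smul {c : K} (hc : c ≠ 0) (f : RatFun Y) (y : Y.left) :
    Scheme.ord (c • f) y = Scheme.ord f y := by
  rcases eq_or_ne f 0 with rfl | hf
  · simp
  have hu : IsUnit (((Scheme.ΓSpecIso (.of K)).inv ≫ Y.hom.appTop).hom c) :=
    (IsUnit.mk0 c hc).map _
  have h0 : algebraMap K (RatFun Y) c ≠ 0 := by simpa using hc
  have h1 : Scheme.ord (algebraMap K (RatFun Y) c) y = 0 :=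
    Scheme.ord_of_isUnit (X := Y.left) (U := ⊤) hu trivial
  rw [Algebra.smul_def, Scheme.ord_mul h0 hf, h1, zero_add]

/-- In `movableMember` the infimum of a set of integers is a genuine minimum only if the set is
bounded below. Normality provides valuations at the points of codimension one, and the ultrametric
inequality bounds the order on the span of a finite set. -/
lemma exists_le_ord (hY : IsNormalScheme Y.left) (W : Submodule K (RatFun Y))
    [FiniteDimensional K W] (y : Y.left) :
    ∃ n : ℤ, ∀ f ∈ W, f ≠ 0 → n ≤ Scheme.ord f y := by
  by_cases hy : coheight y = 1
  · have := isDiscreteValuationRing_stalk hY hy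
    obtain ⟨s, hs⟩ := Module.Finite.iff_fg.1 (inferInstance : FiniteDimensional K W)
    obtain ⟨n, hn⟩ := (s.finite_toSet.image fun f => Scheme.ord f y).bddBelow
    refine ⟨n, fun f hf => ?_⟩
    rw [← hs] at hf
    induction hf using Submodule.span_induction with
    | mem f hf => exact fun _ => hn ⟨f, hf, rfl⟩
    | zero => exact fun h => absurd rfl h
    | add f g _ _ hf hg =>
      intro h
      rcases eq_or_ne f 0 with rfl | hf0
      · rw [zero_add] at h ⊢; exact hg h
      rcases eq_or_ne g 0 with rfl | hg0
      · rw [add_zero] at h ⊢; exact hf h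
      exact (le_min (hf hf0) (hg hg0)).trans (Scheme.ord_add h)
    | smul c f _ hf =>
      intro h
      rw [ord_smul (left_ne_zero_of_smul h)]
      exact hf (right_ne_zero_of_smul h)
  · exact ⟨0, fun f _ _ => (Scheme.ord_eq_zero_of_coheight_neq_one hy f).ge⟩

/-- The quotient has neither zeros nor poles, so it extends to a global regular function, which is
constant. This is the only place where normality, properness and the algebraic closedness of K are
used together. -/
lemma exists_algebraMap_of_ord_eq [IsAlgClosed K] [IsProper Y.hom] (hY : IsNormalScheme Y.left)
    {f g : RatFun Y} (hf : f ≠ 0) (hg : g ≠ 0)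
    (h : ∀ y, Scheme.ord f y = Scheme.ord g y) : ∃ c : K, c ≠ 0 ∧ f = c • g := by
  have hfg : f / g ≠ 0 := div_ne_zero hf hg
  have h0 : ∀ y, Scheme.ord (f / g) y = 0 := fun y => by
    have := Scheme.ord_mul (x := y) hfg hg
    rw [div_mul_cancel₀ _ hg, h] at this
    omega
  obtain ⟨s, hs⟩ := exists_section_of_forall_affine fun U hU _ =>
    exists_section_affine_of_ord_eq_zero hY hfg h0 hU
  obtain ⟨c, hc⟩ := exists_algebraMap_of_section s
  have hc' : f = c • g := by
    rw [Algebra.smul_def, hc, hs, div_mul_cancel₀ _ hg]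
  exact ⟨c, by rintro rfl; simp [hf] at hc', hc'⟩

/-- Multiplication by φ adds ord φ both to the order of f and to the minimum over the space, and the
two contributions cancel. -/
lemma movableMember_mul (hY : IsNormalScheme Y.left) {W W' : Submodule K (RatFun Y)}
    [FiniteDimensional K W] (hW : W ≠ ⊥) {φ : RatFun Y} (hφ : φ ≠ 0)
    (hW' : ∀ f, f ∈ W' ↔ ∃ g ∈ W, f = φ * g) {f : RatFun Y} (hf : f ≠ 0) :
    movableMember W' (φ * f) = movableMember W f := by
  funext y
  obtain ⟨n, hn⟩ := exists_le_ord hY W y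
  obtain ⟨w, hw, hw0⟩ := Submodule.exists_mem_ne_zero_of_ne_bot hW
  have hS := Int.csInf_mem (s := {n : ℤ | ∃ h ∈ W, h ≠ 0 ∧ n = Scheme.ord h y})
    ⟨_, w, hw, hw0, rfl⟩ ⟨n, by rintro _ ⟨h, hh, h0, rfl⟩; exact hn h hh h0⟩
  have hle : ∀ h ∈ W, h ≠ 0 → sInf {n : ℤ | ∃ h ∈ W, h ≠ 0 ∧ n = Scheme.ord h y} ≤
      Scheme.ord h y := fun h hh h0 =>
    csInf_le ⟨n, by rintro _ ⟨h, hh, h0, rfl⟩; exact hn h hh h0⟩ ⟨h, hh, h0, rfl⟩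
  simp only [movableMember]
  generalize sInf {n : ℤ | ∃ h ∈ W, h ≠ 0 ∧ n = Scheme.ord h y} = m at *
  have : IsLeast {n : ℤ | ∃ h ∈ W', h ≠ 0 ∧ n = Scheme.ord h y} (Scheme.ord φ y + m) := by
    refine ⟨?_, ?_⟩
    · obtain ⟨h, hh, h0, hm⟩ := hS
      exact ⟨φ * h, (hW' _).2 ⟨h, hh, rfl⟩, mul_ne_zero hφ h0, by rw [Scheme.ord_mul hφ h0, hm]⟩
    · rintro _ ⟨h, hh, h0, rfl⟩
      obtain ⟨g, hg, rfl⟩ := (hW' _).1 hh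
      have hg0 := right_ne_zero_of_mul h0
      rw [Scheme.ord_mul hφ hg0]
      have := hle g hg hg0
      omega
  rw [this.csInf_eq, Scheme.ord_mul hφ hf]
  omega

lemma ActsBy.movableMember_eq [NeZero N] (hY : IsNormalScheme Y.left)
    (hβ : LinearIndependent K β) (h : ActsBy β σ M) {c : Fin N → K} (hc : c ≠ 0) :
    movableMember (Submodule.span K (Set.range β)) (∑ i, (M.1.mulVec c) i • β i) =
      movableMember (pushforward σ (Submodule.span K (Set.range β)))
        (σ.symm (∑ i, c i • β i)) := by
  obtain ⟨φ, hφ, h⟩ := h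
  have := FiniteDimensional.span_of_finite K (Set.finite_range β)
  rw [h]
  refine (movableMember_mul hY (fun h0 => ?_) hφ (mem_pushforward_span_iff h)
    (linearCombination_ne_zero hβ (mulVec_ne_zero M hc))).symm
  exact hβ.ne_zero 0 (Submodule.span_eq_bot.1 h0 _ ⟨0, rfl⟩)

lemma ActsBy.isPreservedBy [NeZero N] (hY : IsNormalScheme Y.left) (hβ : LinearIndependent K β)
    (h : ActsBy β σ M) : IsPreservedBy (Submodule.span K (Set.range β)) σ := by
  have key := fun c => h.movableMember_eq hY hβ (c := c)
  obtain ⟨φ, hφ, h⟩ := h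
  ext E
  constructor
  · rintro ⟨f, ⟨g, hg, rfl⟩, hf, rfl⟩
    obtain ⟨c, rfl⟩ := (Submodule.mem_span_range_iff_exists_fun K).1 hg
    have hc : c ≠ 0 := by rintro rfl; simp at hf
    exact ⟨_, (Submodule.mem_span_range_iff_exists_fun K).2 ⟨_, rfl⟩,
      linearCombination_ne_zero hβ (mulVec_ne_zero M hc), (key c hc).symm⟩
  · rintro ⟨f, hf, hf0, rfl⟩
    obtain ⟨c, rfl⟩ := (Submodule.mem_span_range_iff_exists_fun K).1 hf
    have hc : c ≠ 0 := by rintro rfl; simp at hf0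
    have hc' := mulVec_ne_zero M⁻¹ hc
    refine ⟨σ.symm (∑ i, (M⁻¹.1.mulVec c) i • β i),
      ⟨_, (Submodule.mem_span_range_iff_exists_fun K).2 ⟨_, rfl⟩, rfl⟩,
      (map_ne_zero_iff σ.symm σ.symm.injective).2 (linearCombination_ne_zero hβ hc'), ?_⟩
    rw [← key _ hc', Matrix.mulVec_mulVec, ← Units.val_mul, mul_inv_cancel, Units.val_one,
      Matrix.one_mulVec]

section

variable [IsAlgClosed K] [IsProper Y.hom]

/-- Functions with equal divisors are proportional, so the two matrices agree up to a scalar on each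
vector, and `matrix_eq_smul_of_forall_mulVec` makes the scalar uniform. -/
lemma eq_smul_of_movableMember_eq (hY : IsNormalScheme Y.left) (hβ : LinearIndependent K β)
    (h : ∀ c : Fin N → K, c ≠ 0 →
      movableMember (Submodule.span K (Set.range β)) (∑ i, (M'.1.mulVec c) i • β i) =
      movableMember (Submodule.span K (Set.range β)) (∑ i, (M.1.mulVec c) i • β i)) :
    ∃ l : K, M'.1 = l • M.1 := by
  refine matrix_eq_smul_of_forall_mulVec ((Matrix.isUnit_iff_isUnit_det _).1 M.isUnit)
    fun c hc => ?_
  obtain ⟨l, -, hl⟩ := exists_algebraMap_of_ord_eq hY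
    (linearCombination_ne_zero hβ (mulVec_ne_zero M' hc))
    (linearCombination_ne_zero hβ (mulVec_ne_zero M hc)) fun y => by
      have := congrFun (h c hc) y
      simp only [movableMember] at this
      omega
  refine ⟨l, funext fun i => ?_⟩
  rw [Finset.smul_sum, ← sub_eq_zero, ← Finset.sum_sub_distrib] at hl
  have := Fintype.linearIndependent_iff.1 hβ (M'.1.mulVec c - l • M.1.mulVec c) (by
    rw [← hl]
    refine Finset.sum_congr rfl fun i _ => ?_
    rw [Pi.sub_apply, Pi.smul_apply, sub_smul, smul_assoc]) i
  exact sub_eq_zero.1 this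

/-- Each transformed function σ⁻¹ β_i has the same movable member as some function g_i in the span W
of β. The common factor φ is read off from i = 0 as σ⁻¹ β_0 / g_0, and every other σ⁻¹ β_i then lies
in φ W. -/
lemma exists_actsBy_of_isPreservedBy [NeZero N] (hY : IsNormalScheme Y.left)
    (hβ : LinearIndependent K β) (h : IsPreservedBy (Submodule.span K (Set.range β)) σ) :
    ∃ M, ActsBy β σ M := by
  have hmem : ∀ f ∈ Submodule.span K (Set.range β), f ≠ 0 →
      ∃ g ∈ Submodule.span K (Set.range β), g ≠ 0 ∧
        movableMember (pushforward σ (Submodule.span K (Set.range β))) (σ.symm f) =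
          movableMember (Submodule.span K (Set.range β)) g := fun f hf hf0 => by
    have : movableMember (pushforward σ (Submodule.span K (Set.range β))) (σ.symm f) ∈
        movableSystem (Submodule.span K (Set.range β)) :=
      h ▸ ⟨σ.symm f, ⟨f, hf, rfl⟩, by simpa using hf0, rfl⟩
    exact this
  have hβ0 := hβ.ne_zero 0
  obtain ⟨f₀, -, hf₀0, hf₀⟩ := hmem (β 0) (Submodule.subset_span ⟨0, rfl⟩) hβ0
  have hσ0 : σ.symm (β 0) ≠ 0 := by simpa using hβ0
  have hφ : σ.symm (β 0) / f₀ ≠ 0 := div_ne_zero hσ0 hf₀0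
  have hstab : ∀ i, ∃ m : Fin N → K, σ.symm (β i) = σ.symm (β 0) / f₀ * ∑ j, m j • β j := by
    intro i
    have hi0 : σ.symm (β i) ≠ 0 := by simpa using hβ.ne_zero i
    obtain ⟨g, hg, hg0, hgm⟩ := hmem (β i) (Submodule.subset_span ⟨i, rfl⟩) (hβ.ne_zero i)
    -- The fixed parts of the two systems are unknown, but they are the same for the indices 0 and i
    -- and cancel in this cross product.
    obtain ⟨l, -, hl⟩ := exists_algebraMap_of_ord_eq hY (f := σ.symm (β i) * f₀)
      (g := σ.symm (β 0) * g) (mul_ne_zero hi0 hf₀0) (mul_ne_zero hσ0 hg0) fun y => by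
        rw [Scheme.ord_mul hi0 hf₀0, Scheme.ord_mul hσ0 hg0]
        have h1 := congrFun hf₀ y
        have h2 := congrFun hgm y
        simp only [movableMember] at h1 h2
        omega
    obtain ⟨m, hm⟩ := (Submodule.mem_span_range_iff_exists_fun K).1 (Submodule.smul_mem _ l hg)
    refine ⟨m, ?_⟩
    rw [hm, mul_smul_comm, div_mul_eq_mul_div, ← smul_div_assoc, ← hl, mul_div_cancel_right₀ _ hf₀0]
  generalize σ.symm (β 0) / f₀ = φ at hφ hstab
  choose m hm using hstab
  have hcomb : ∀ c : Fin N → K, σ.symm (∑ i, c i • β i) =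
      φ * ∑ i, ((Matrix.of m).transpose.mulVec c) i • β i := fun c => by
    simp only [map_sum, map_smul, hm, Matrix.mulVec, dotProduct, Matrix.transpose_apply,
      Matrix.of_apply, Finset.sum_smul]
    rw [Finset.sum_comm, Finset.mul_sum]
    refine Finset.sum_congr rfl fun i _ => ?_
    rw [← mul_smul_comm, Finset.smul_sum]
    congr 1
    refine Finset.sum_congr rfl fun j _ => ?_
    rw [smul_smul, mul_comm]
  have hdet : (Matrix.of m).transpose.det ≠ 0 := fun h0 => by
    obtain ⟨c, hc, hc0⟩ := Matrix.exists_mulVec_eq_zero_iff.2 h0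
    have := hcomb c
    simp only [hc0, Pi.zero_apply, zero_smul, Finset.sum_const_zero, mul_zero] at this
    exact linearCombination_ne_zero hβ hc ((map_eq_zero_iff σ.symm σ.symm.injective).1 this)
  exact ⟨Matrix.GeneralLinearGroup.mkOfDetNeZero _ hdet, _, hφ, hcomb⟩

end

end

end LinearSystems

/-! ### The linear system |D|_K on X_K -/

section BaseChange

variable {k : Type u} [Field k] {K : Type u} [Field K] [Algebra k K]
  {X : Over (Spec (.of k))} [GeometricallyIntegral X.hom] [LocallyOfFiniteType X.hom]
  (L : LinearSystem X) {N : ℕ} (b : Module.Basis (Fin N) k L.V)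

/-- The basis of the space of rational functions on `X_K` defining `|D|_K`. -/
def LinearSystem.ratBasis (K : Type u) [Field K] [Algebra k K] (i : Fin N) :
    RatFun (baseChange X K) :=
  ratFunMap X K (b i : RatFun X)

lemma LinearSystem.linearIndependent_ratBasis : LinearIndependent K (L.ratBasis b K) :=
  linearIndependent_ratFunMap (b.linearIndependent.map' L.V.subtype L.V.ker_subtype)

lemma LinearSystem.extend_eq : L.extend K = Submodule.span K (Set.range (L.ratBasis b K)) := by
  refine le_antisymm (Submodule.span_le.2 ?_) (Submodule.span_mono ?_)
  · rintro _ ⟨f, hf, rfl⟩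
    have h := congrArg Subtype.val (b.sum_repr ⟨f, hf⟩)
    rw [AddSubmonoidClass.coe_finsetSum] at h
    change _ = f at h
    rw [← h, map_sum]
    refine Submodule.sum_mem _ fun i _ => ?_
    rw [SetLike.val_smul, Algebra.smul_def, map_mul, ratFunMap_algebraMap, ← Algebra.smul_def]
    exact Submodule.smul_mem _ _ (Submodule.subset_span ⟨i, rfl⟩)
  · rintro _ ⟨i, rfl⟩
    exact ⟨_, (b i).2, rfl⟩

lemma LinearSystem.neZero (L : LinearSystem X) {N : ℕ} (b : Module.Basis (Fin N) k L.V) :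
    NeZero N := by
  refine ⟨?_⟩
  rintro rfl
  refine L.ne_bot ((Submodule.eq_bot_iff _).2 fun f hf => ?_)
  have h := congrArg Subtype.val (b.sum_repr ⟨f, hf⟩)
  simpa using h.symm

variable {b} {σ : RatFun (baseChange X K) ≃ₐ[K] RatFun (baseChange X K)} {M M' : GL (Fin N) K}
  {L}

lemma ActsBy.isPreservedBy_extend (hX : IsNormalScheme (baseChange X K).left)
    (h : ActsBy (L.ratBasis b K) σ M) : IsPreservedBy (L.extend K) σ := by
  have := L.neZero b
  rw [L.extend_eq b]
  exact h.isPreservedBy hX (L.linearIndependent_ratBasis b)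

lemma ActsBy.induces (hX : IsNormalScheme (baseChange X K).left)
    (h : ActsBy (L.ratBasis b K) σ M) : Induces L b σ M := fun c hc => by
  have := L.neZero b
  rw [L.extend_eq b]
  exact h.movableMember_eq hX (L.linearIndependent_ratBasis b) hc

variable [IsAlgClosed K] [IsProper X.hom]

lemma exists_actsBy_extend (hX : IsNormalScheme (baseChange X K).left)
    (b : Module.Basis (Fin N) k L.V) (h : IsPreservedBy (L.extend K) σ) :
    ∃ M, ActsBy (L.ratBasis b K) σ M := by
  have := L.neZero b
  rw [L.extend_eq b] at h
  exact exists_actsBy_of_isPreservedBy hX (L.linearIndependent_ratBasis b) h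

lemma Induces.eq_smul (hX : IsNormalScheme (baseChange X K).left)
    (h : Induces L b σ M) (h' : Induces L b σ M') : ∃ l : K, M'.1 = l • M.1 := by
  refine eq_smul_of_movableMember_eq hX (L.linearIndependent_ratBasis b) fun c hc => ?_
  have := (h' c hc).trans (h c hc).symm
  rwa [L.extend_eq b] at this

end BaseChange

end

section

/-! ### Smooth schemes over a field are geometrically reduced -/

section Reduced

variable {k : Type u} [Field k]

lemma isReduced_of_smooth_ringHom {S : CommRingCat.{u}} (φ : .of k ⟶ S) (h : φ.hom.Smooth) :
    _root_.IsReduced S := by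
  let : Algebra k S := φ.hom.toAlgebra
  have : Algebra.Smooth k S := h
  exact isReduced_of_smooth k S

lemma isReduced_of_smooth_hom {Z : Scheme.{u}} (f : Z ⟶ Spec (.of k)) [Smooth f] :
    AlgebraicGeometry.IsReduced Z := by
  have (i : Z.affineCover.I₀) : AlgebraicGeometry.IsReduced (Z.affineCover.X i) := by
    have h : Smooth (Z.affineCover.f i ≫ f) := inferInstance
    obtain ⟨φ, hφ⟩ : ∃ φ, Spec.map φ = Z.affineCover.f i ≫ f := Spec.map_surjective _
    rw [← hφ] at h
    have h' := (HasRingHomProperty.Spec_iff (P := @Smooth)).1 h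
    exact (affine_isReduced_iff _).2 (isReduced_of_smooth_ringHom φ h')
  exact AlgebraicGeometry.IsReduced.of_openCover (𝒰 := Z.affineCover)

/-- With this, products of G with reduced schemes are reduced, so morphisms from them to separated
schemes can be compared on dense open subsets. -/
instance geometricallyReduced_of_smooth {Z : Scheme.{u}} (f : Z ⟶ Spec (.of k)) [Smooth f] :
    GeometricallyReduced f := by
  refine ⟨fun K _ y W g h hp => ?_⟩
  have : Smooth h := MorphismProperty.of_isPullback hp inferInstance
  exact isReduced_of_smooth_hom h

variable (G X : Over (Spec (.of k)))

instance [LocallyOfFiniteType G.hom] [LocallyOfFiniteType X.hom] :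
    LocallyOfFiniteType (G ⊗ X).hom := by
  change LocallyOfFiniteType (pullback.fst G.hom X.hom ≫ G.hom)
  infer_instance

instance [Smooth G.hom] [LocallyOfFiniteType X.hom] [AlgebraicGeometry.IsReduced X.left] :
    AlgebraicGeometry.IsReduced (G ⊗ X).left :=
  inferInstanceAs (AlgebraicGeometry.IsReduced (pullback G.hom X.hom))

end Reduced

/-! ### Existence and density of geometric points -/

section Points

variable {k K : Type u} [Field k] [Field K] [Algebra k K] [IsAlgClosed K]

/-- In a scheme locally of finite type over a field every nonempty locally closed set contains a
closed point, and over an algebraically closed field closed points are rational. -/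
lemma exists_section_mem {A : Over (Spec (.of k))} (π : A ⟶ SpecExt k K)
    [LocallyOfFiniteType π.left] {S : Set A.left} (hS : IsLocallyClosed S) (hne : S.Nonempty) :
    ∃ p : SpecExt k K ⟶ A, p ≫ π = 𝟙 _ ∧ Set.range p.left ⊆ S := by
  let f : A.left ⟶ Spec (.of K) := π.left
  have : LocallyOfFiniteType f := ‹_›
  have : JacobsonSpace A.left := LocallyOfFiniteType.jacobsonSpace f
  obtain ⟨x, hx, hxc⟩ := nonempty_inter_closedPoints hne hS
  have hp : pointOfClosedPoint f x hxc ≫ f = 𝟙 _ := pointOfClosedPoint_comp f x hxc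
  refine ⟨Over.homMk (pointOfClosedPoint f x hxc) ?_, Over.OverMorphism.ext hp, ?_⟩
  · rw [← Over.w π]
    exact (Category.assoc _ _ _).symm.trans ((congrArg (· ≫ (SpecExt k K).hom) hp).trans (Category.id_comp _))
  · rintro _ ⟨a, rfl⟩
    have h := pointOfClosedPoint_apply f x hxc a
    exact h.symm ▸ hx

open CartesianMonoidalCategory

instance (Z : Over (Spec (.of k))) [LocallyOfFiniteType Z.hom] :
    LocallyOfFiniteType (fst (SpecExt k K) Z).left :=
  inferInstanceAs (LocallyOfFiniteType (pullback.fst (SpecExt k K).hom Z.hom))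

instance (Z : Over (Spec (.of k))) : Surjective (snd (SpecExt k K) Z).left := by
  have : Surjective (SpecExt k K).hom :=
    inferInstanceAs (Surjective (Spec.map (CommRingCat.ofHom (algebraMap k K))))
  exact inferInstanceAs (Surjective (pullback.snd (SpecExt k K).hom Z.hom))

variable (K) in
lemma exists_point_mem (Z : Over (Spec (.of k))) [LocallyOfFiniteType Z.hom] {S : Set Z.left}
    (hS : IsLocallyClosed S) (hne : S.Nonempty) :
    ∃ p : SpecExt k K ⟶ Z, Set.range p.left ⊆ S := by
  obtain ⟨p, -, hp⟩ := exists_section_mem (fst (SpecExt k K) Z)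
    (hS.preimage (snd (SpecExt k K) Z).left.continuous)
    (hne.preimage (snd (SpecExt k K) Z).left.surjective)
  refine ⟨p ≫ snd _ _, ?_⟩
  rintro _ ⟨a, rfl⟩
  exact hp ⟨a, rfl⟩

/-- The closed points in U are dense, and for reduced source and separated target it suffices to
compare the morphisms on their residue fields. A K-point over such a point is faithfully flat onto
the spectrum of the residue field, hence an epimorphism. -/
lemma over_ext_of_points {Z H : Over (Spec (.of k))} [LocallyOfFiniteType Z.hom]
    [AlgebraicGeometry.IsReduced Z.left] [IsSeparated H.hom] {U : Z.left.Opens} (hU : Dense (U : Set Z.left))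
    {f g : Z ⟶ H}
    (h : ∀ p : SpecExt k K ⟶ Z, Set.range p.left ⊆ U → p ≫ f = p ≫ g) : f = g := by
  have : JacobsonSpace Z.left := LocallyOfFiniteType.jacobsonSpace Z.hom
  refine Over.OverMorphism.ext (ext_of_fromSpecResidueField_eq _ _ H.hom
    ((U : Set Z.left) ∩ closedPoints Z.left) ?_ ?_ ?_)
  · exact dense_iff_closure_eq.2 ((JacobsonSpace.closure_inter_closedPoints_eq_closure
      U.2.isLocallyClosed).trans hU.closure_eq)
  · rintro x ⟨hxU, hx⟩
    obtain ⟨p, hp⟩ := exists_point_mem K Z hx.isLocallyClosed (Set.singleton_nonempty x)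
    let P : Spec (.of K) ⟶ Z.left := p.left
    let w : (y : Z.left) × (Z.left.residueField y ⟶ .of K) := Scheme.SpecToEquivOfField K Z.left P
    have hw : Spec.map w.2 ≫ Z.left.fromSpecResidueField w.1 = P :=
      (Scheme.SpecToEquivOfField K Z.left).symm_apply_apply P
    have hwx : w.1 = x := hp ⟨_, rfl⟩
    obtain ⟨y, φ⟩ := w
    obtain rfl : y = x := hwx
    have : Epi (Spec.map φ) := by
      let := (show Z.left.residueField y →+* K from φ.hom).toAlgebra
      have h1 : Flat (Spec.map φ) :=
        inferInstanceAs (Flat (Spec.map (CommRingCat.ofHom (algebraMap (Z.left.residueField y) K))))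
      have h2 : Surjective (Spec.map φ) :=
        inferInstanceAs (Surjective (Spec.map (CommRingCat.ofHom (algebraMap (Z.left.residueField y) K))))
      exact Flat.epi_of_flat_of_surjective _
    rw [← cancel_epi (Spec.map φ), ← Category.assoc, ← Category.assoc]
    rw [hw]
    exact congrArg (fun q => q.left) (h p (hp.trans (Set.singleton_subset_iff.2 hxU)))
  · rw [Over.w, Over.w]

/-- The fibre over g is nonempty and locally of finite type over K, so it has a rational point. -/
lemma exists_surjective_lift {Z Y : Over (Spec (.of k))} (q : Z ⟶ Y) [Surjective q.left]
    [LocallyOfFiniteType q.left] (g : SpecExt k K ⟶ Y) : ∃ p : SpecExt k K ⟶ Z, p ≫ q = g := by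
  let A : Over (Spec (.of k)) := Over.mk (pullback.snd q.left g.left ≫ (SpecExt k K).hom)
  let π : A ⟶ SpecExt k K := Over.homMk (pullback.snd q.left g.left)
  have : LocallyOfFiniteType π.left :=
    inferInstanceAs (LocallyOfFiniteType (pullback.snd q.left g.left))
  have hs : Surjective (pullback.snd q.left g.left) := inferInstance
  have hne : Nonempty A.left := by
    obtain ⟨x, -⟩ := hs.surj (Nonempty.some (inferInstanceAs (Nonempty (PrimeSpectrum K))))
    exact ⟨x⟩
  obtain ⟨p, hp, -⟩ := exists_section_mem π isOpen_univ.isLocallyClosed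
    (Set.univ_nonempty (α := A.left))
  let r : A ⟶ Z := Over.homMk (pullback.fst q.left g.left) (by
    change _ = pullback.snd q.left g.left ≫ (SpecExt k K).hom
    rw [← Over.w q, ← Over.w g, pullback.condition_assoc])
  have hr : r ≫ q = π ≫ g := Over.OverMorphism.ext pullback.condition
  exact ⟨p ≫ r, by rw [Category.assoc, hr, reassoc_of% hp]⟩

/-- The image is open, and a nonempty closed complement would contain a K-point. -/
lemma surjective_of_points {Z Y : Over (Spec (.of k))} [LocallyOfFiniteType Y.hom] (q : Z ⟶ Y)
    [UniversallyOpen q.left] (h : ∀ g : SpecExt k K ⟶ Y, ∃ p : SpecExt k K ⟶ Z, p ≫ q = g) :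
    Surjective q.left := by
  refine ⟨fun y => ?_⟩
  by_contra hy
  have hopen : IsOpen (Set.range q.left) := q.left.isOpenMap.isOpen_range
  obtain ⟨g, hg⟩ := exists_point_mem K Y hopen.isClosed_compl.isLocallyClosed ⟨y, hy⟩
  obtain ⟨p, rfl⟩ := h g
  let x : (SpecExt k K).left := Nonempty.some (inferInstanceAs (Nonempty (PrimeSpectrum K)))
  exact hg ⟨x, rfl⟩ ⟨p.left x, rfl⟩

end Points

/-! ### Translates of open subsets of a group scheme -/

section GroupPoints

open CartesianMonoidalCategory MonObj

variable {k K : Type u} [Field k] [Field K] [Algebra k K] [IsAlgClosed K]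
  {G : Over (Spec (.of k))} [GrpObj G]

instance (Z : Over (Spec (.of k))) : UniversallyOpen (snd (SpecExt k K) Z).left :=
  inferInstanceAs (UniversallyOpen (pullback.snd (SpecExt k K).hom Z.hom))

/-- Translation by a K-point is an automorphism only after base change to K; composed with the
universally open projection to G it is still open. Preimages of dense sets under it are therefore
dense. -/
lemma isOpenMap_translate (g : SpecExt k K ⟶ G) :
    IsOpenMap ((fst (SpecExt k K) G ≫ g) * snd (SpecExt k K) G).left := by
  let e : SpecExt k K ⊗ G ≅ SpecExt k K ⊗ G :=
    { hom := lift (fst _ _) ((fst _ _ ≫ g) * snd _ _)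
      inv := lift (fst _ _) ((fst _ _ ≫ g⁻¹) * snd _ _)
      hom_inv_id := by
        ext1
        · simp
        · rw [Category.assoc, lift_snd, Category.id_comp, MonObj.comp_mul, lift_fst_assoc, lift_snd,
            GrpObj.comp_inv, inv_mul_cancel_left]
      inv_hom_id := by
        ext1
        · simp
        · rw [Category.assoc, lift_snd, Category.id_comp, MonObj.comp_mul, lift_fst_assoc, lift_snd,
            GrpObj.comp_inv, mul_inv_cancel_left] }
  have h : (fst (SpecExt k K) G ≫ g) * snd (SpecExt k K) G = e.hom ≫ snd _ _ := by simp [e]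
  rw [h]
  have he : IsIso e.hom := e.isIso_hom
  have : IsIso e.hom.left := (Over.forget _).map_isIso e.hom
  have : UniversallyOpen (e.hom ≫ snd (SpecExt k K) G).left :=
    inferInstanceAs (UniversallyOpen (e.hom.left ≫ (snd (SpecExt k K) G).left))
  exact Scheme.Hom.isOpenMap _

/-- Finitely many translates of a dense open subset of a group scheme have a common point. -/
lemma exists_forall_mul_mem [LocallyOfFiniteType G.hom] {U : G.left.Opens}
    (hU : Dense (U : Set G.left)) (s : Finset (SpecExt k K ⟶ G)) :
    ∃ w : SpecExt k K ⟶ G, ∀ g ∈ s, Set.range (g * w).left ⊆ U := by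
  let t (g : SpecExt k K ⟶ G) : SpecExt k K ⊗ G ⟶ G :=
    (fst (SpecExt k K) G ≫ g) * snd (SpecExt k K) G
  let V (g : SpecExt k K ⟶ G) : Set (SpecExt k K ⊗ G).left := (t g).left ⁻¹' U
  have hV : ∀ g, IsOpen (V g) ∧ Dense (V g) := fun g =>
    ⟨U.2.preimage (t g).left.continuous, hU.preimage (isOpenMap_translate g)⟩
  have hVs : IsOpen (⋂ g ∈ s, V g) ∧ Dense (⋂ g ∈ s, V g) := by
    classical
    induction s using Finset.induction_on with
    | empty => simp
    | insert g s _ ih =>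
      rw [Finset.set_biInter_insert]
      exact ⟨(hV g).1.inter ih.1, (hV g).2.inter_of_isOpen_left ih.2 (hV g).1⟩
  have hne : Nonempty (SpecExt k K ⊗ G).left := by
    let x : SpecExt k K ⟶ SpecExt k K ⊗ G := lift (𝟙 _) 1
    exact ⟨x.left (Nonempty.some (inferInstanceAs (Nonempty (PrimeSpectrum K))))⟩
  obtain ⟨p, hp, hpV⟩ := exists_section_mem (fst (SpecExt k K) G) hVs.1.isLocallyClosed
    hVs.2.nonempty
  refine ⟨p ≫ snd _ _, fun g hg => ?_⟩
  have : g * (p ≫ snd _ _) = p ≫ t g := by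
    rw [MonObj.comp_mul, reassoc_of% hp]
  rw [this]
  rintro _ ⟨x, rfl⟩
  exact Set.mem_iInter₂.1 (hpV ⟨x, rfl⟩) g hg

end GroupPoints

end

section

/-! ### Evaluation of rational maps at scheme-valued points -/

section RationalMaps

open CartesianMonoidalCategory MonObj

variable {k : Type u} [Field k] {Y X : Over (Spec (.of k))} [AlgebraicGeometry.IsReduced Y.left]
  [X.left.IsSeparated] (ρ : Y.left.RationalMap X.left)

/-- The domain of definition of a rational map, as a scheme over `k`. -/
abbrev ratDomain : Over (Spec (.of k)) := Over.mk (ρ.toPartialMap.domain.ι ≫ Y.hom)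

/-- The inclusion of the domain of definition. -/
def ratIncl : ratDomain ρ ⟶ Y := Over.homMk ρ.toPartialMap.domain.ι

instance : IsOpenImmersion (ratIncl ρ).left :=
  inferInstanceAs (IsOpenImmersion ρ.toPartialMap.domain.ι)

instance : Mono (ratIncl ρ) :=
  (Over.forget _).mono_of_mono_map (inferInstanceAs (Mono (ratIncl ρ).left))

variable {ρ} in
/-- The morphism defined by a rational map over `k` on its domain of definition. -/
def ratHom (hρ : ρ.compHom X.hom = Y.hom.toRationalMap) : ratDomain ρ ⟶ X :=
  Over.homMk ρ.toPartialMap.hom (by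
    have h1 : (ρ.toPartialMap.compHom X.hom).toRationalMap = Y.hom.toPartialMap.toRationalMap :=
      (congrArg (Scheme.RationalMap.compHom · X.hom) ρ.toRationalMap_toPartialMap).trans hρ
    obtain ⟨W, hW, hl, hr, h2⟩ := Scheme.PartialMap.toRationalMap_eq_iff.1 h1
    have hl' : W ≤ ρ.toPartialMap.domain := hl
    have : IsDominant (Y.left.homOfLE hl') := AlgebraicGeometry.Opens.isDominant_homOfLE hW _
    have h3 : Y.left.homOfLE hl' ≫ ρ.toPartialMap.hom ≫ X.hom =
        Y.left.homOfLE hr ≫ (Y.left.topIso.hom ≫ Y.hom) := h2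
    have h4 : Y.left.homOfLE hr ≫ Y.left.topIso.hom =
        Y.left.homOfLE hl' ≫ ρ.toPartialMap.domain.ι := by simp; exact (Scheme.homOfLE_ι _ _)
    have : AlgebraicGeometry.IsReduced (ρ.toPartialMap.domain : Scheme) := inferInstance
    exact ext_of_isDominant (X := ρ.toPartialMap.domain) (Y.left.homOfLE hl') (h3.trans
      (congrArg (· ≫ Y.hom) h4)))

/-- For reduced source and separated target there is a largest domain of definition, so the
representative quantified over in `RatMapsTo` can be fixed once and for all. -/
lemma ratMapsTo_iff (hρ : ρ.compHom X.hom = Y.hom.toRationalMap) {T : Over (Spec (.of k))}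
    (t : T ⟶ Y) (y : T ⟶ X) :
    RatMapsTo ρ t y ↔ ∃ s : T ⟶ ratDomain ρ, s ≫ ratIncl ρ = t ∧ s ≫ ratHom hρ = y := by
  constructor
  · rintro ⟨f, rfl, s, hs, hy⟩
    have h1 : Y.left.homOfLE f.le_domain_toRationalMap ≫ f.toRationalMap.toPartialMap.hom = f.hom :=
      f.toPartialMap_toRationalMap_restrict
    have h2 : Y.left.homOfLE f.le_domain_toRationalMap ≫ f.toRationalMap.toPartialMap.domain.ι =
      f.domain.ι := Scheme.homOfLE_ι _ _
    let s' : T.left ⟶ f.toRationalMap.toPartialMap.domain :=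
      s ≫ Y.left.homOfLE f.le_domain_toRationalMap
    have hs' : s' ≫ f.toRationalMap.toPartialMap.domain.ι = t.left :=
      (Category.assoc _ _ _).trans ((congrArg (s ≫ ·) h2).trans hs)
    refine ⟨Over.homMk s' ?_, Over.OverMorphism.ext hs', Over.OverMorphism.ext ?_⟩
    · exact (Category.assoc _ _ _).symm.trans ((congrArg (· ≫ Y.hom) hs').trans (Over.w t))
    · exact (Category.assoc _ _ _).trans ((congrArg (s ≫ ·) h1).trans hy)
  · rintro ⟨s, rfl, rfl⟩
    exact ⟨ρ.toPartialMap, ρ.toRationalMap_toPartialMap, s.left, rfl, rfl⟩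

lemma RatMapsTo.comp {T T' : Over (Spec (.of k))} {t : T ⟶ Y} {y : T ⟶ X} (h : RatMapsTo ρ t y)
    (a : T' ⟶ T) : RatMapsTo ρ (a ≫ t) (a ≫ y) := by
  obtain ⟨f, hf, s, hs, hy⟩ := h
  exact ⟨f, hf, a.left ≫ s, by simp [hs], by simp [hy]⟩

lemma RatMapsTo.unique (hρ : ρ.compHom X.hom = Y.hom.toRationalMap) {T : Over (Spec (.of k))}
    {t : T ⟶ Y} {y y' : T ⟶ X} (h : RatMapsTo ρ t y) (h' : RatMapsTo ρ t y') : y = y' := by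
  obtain ⟨s, hs, rfl⟩ := (ratMapsTo_iff ρ hρ t y).1 h
  obtain ⟨s', hs', rfl⟩ := (ratMapsTo_iff ρ hρ t y').1 h'
  rw [(cancel_mono (ratIncl ρ)).1 (hs.trans hs'.symm)]

/-- The open subscheme of `T` on which a `T`-point of `Y` lies in the domain of definition. -/
lemma exists_restrict_ratDomain (hρ : ρ.compHom X.hom = Y.hom.toRationalMap)
    {T : Over (Spec (.of k))} (t : T ⟶ Y) :
    ∃ (T' : Over (Spec (.of k))) (i : T' ⟶ T) (y : T' ⟶ X), IsOpenImmersion i.left ∧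
      RatMapsTo ρ (i ≫ t) y ∧ ∀ {S : Over (Spec (.of k))} (a : S ⟶ T) {z : S ⟶ X},
        RatMapsTo ρ (a ≫ t) z → ∃ a' : S ⟶ T', a' ≫ i = a := by
  let U : T.left.Opens := t.left ⁻¹ᵁ (ratIncl ρ).left.opensRange
  let i : Over.mk (U.ι ≫ T.hom) ⟶ T := Over.homMk U.ι
  have hi : IsOpenImmersion i.left := inferInstanceAs (IsOpenImmersion U.ι)
  have hrange : Set.range (U.ι ≫ t.left) ⊆ Set.range (ratIncl ρ).left := by
    rintro _ ⟨x, rfl⟩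
    exact x.2
  let s : Over.mk (U.ι ≫ T.hom) ⟶ ratDomain ρ :=
    Over.homMk (IsOpenImmersion.lift (ratIncl ρ).left (U.ι ≫ t.left) hrange) (by
      rw [← Over.w (ratIncl ρ), IsOpenImmersion.lift_fac_assoc, Category.assoc, Over.w]
      rfl)
  refine ⟨_, i, s ≫ ratHom hρ, hi, (ratMapsTo_iff ρ hρ _ _).2
    ⟨s, Over.OverMorphism.ext (IsOpenImmersion.lift_fac _ _ _), rfl⟩, fun {S} a _ hz => ?_⟩
  obtain ⟨s', hs', -⟩ := (ratMapsTo_iff ρ hρ _ _).1 hz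
  have ha : Set.range a.left ⊆ Set.range i.left := by
    rintro _ ⟨x, rfl⟩
    have hx : a.left x ∈ U := ⟨s'.left x, congrArg (fun q => q.left x) hs'⟩
    exact ⟨⟨a.left x, hx⟩, rfl⟩
  refine ⟨Over.homMk (IsOpenImmersion.lift i.left a.left ha) ?_,
    Over.OverMorphism.ext (IsOpenImmersion.lift_fac _ _ _)⟩
  rw [← Over.w i, IsOpenImmersion.lift_fac_assoc, Over.w]

end RationalMaps

/-! ### Associativity of a rational action wherever it makes sense -/

section Action

open CartesianMonoidalCategory MonObj

variable {k : Type u} [Field k] {G X : Over (Spec (.of k))} [GrpObj G] [Smooth G.hom]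
  [LocallyOfFiniteType X.hom] [AlgebraicGeometry.IsReduced X.left] [X.left.IsSeparated]
  {ρ : (G ⊗ X).left.RationalMap X.left}

/-- The axiom speaks only of points in a dense open subset, which a given triple (g, h, η), with η
the generic point of X_K, may miss. In the universal case, the open subscheme `T₃` of G × G × X on
which all three terms are defined, both sides are morphisms from a reduced scheme to X that agree on
a dense open subset, hence are equal; every other case is pulled back from it. -/
lemma IsRationalAction.eq_of_ratMapsTo (hρ : IsRationalAction G X ρ) {T : Over (Spec (.of k))}
    {g₁ g₂ : T ⟶ G} {x y z z' : T ⟶ X} (h₁ : RatMapsTo ρ (lift g₂ x) y)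
    (h₂ : RatMapsTo ρ (lift g₁ y) z) (h₃ : RatMapsTo ρ (lift (g₁ * g₂) x) z') : z = z' := by
  let p₁ : G ⊗ G ⊗ X ⟶ G := fst _ _
  let p₂ : G ⊗ G ⊗ X ⟶ G := snd _ _ ≫ fst _ _
  let p₃ : G ⊗ G ⊗ X ⟶ X := snd _ _ ≫ snd _ _
  obtain ⟨T₁, i₁, y₁, hi₁, hy₁, hT₁⟩ := exists_restrict_ratDomain ρ hρ.isOver (lift p₂ p₃)
  obtain ⟨T₂, i₂, y₂, hi₂, hy₂, hT₂⟩ := exists_restrict_ratDomain ρ hρ.isOver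
    (lift (i₁ ≫ p₁) y₁)
  obtain ⟨T₃, i₃, y₃, hi₃, hy₃, hT₃⟩ := exists_restrict_ratDomain ρ hρ.isOver
    (i₂ ≫ i₁ ≫ lift (p₁ * p₂) p₃)
  let i := i₃ ≫ i₂ ≫ i₁
  have hi : IsOpenImmersion i.left :=
    inferInstanceAs (IsOpenImmersion (i₃.left ≫ i₂.left ≫ i₁.left))
  have key : i₃ ≫ y₂ = y₃ := by
    obtain ⟨W, hW, hW'⟩ := hρ.assoc
    let W' : T₃.left.Opens := i.left ⁻¹ᵁ W
    have hdense : Dense (W' : Set T₃.left) := hW.preimage i.left.isOpenMap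
    have : IsDominant W'.ι := AlgebraicGeometry.Opens.isDominant_ι hdense
    have : AlgebraicGeometry.IsReduced (G ⊗ G ⊗ X).left := inferInstance
    have : AlgebraicGeometry.IsReduced T₃.left := isReduced_of_isOpenImmersion i.left
    let w : Over.mk (W'.ι ≫ T₃.hom) ⟶ T₃ := Over.homMk W'.ι
    have hp : ∀ {Z : Over (Spec (.of k))} (a : Z ⟶ G ⊗ G ⊗ X),
        lift (a ≫ p₁) (lift (a ≫ p₂) (a ≫ p₃)) = a := by
      intro Z a
      ext1 <;> simp [p₁]
      ext1 <;> simp [p₂, p₃]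
    obtain ⟨y, z, h₁, h₂, h₃⟩ := hW' _ (w ≫ i ≫ p₁) (w ≫ i ≫ p₂) (w ≫ i ≫ p₃) (by
      have := hp (w ≫ i)
      simp only [Category.assoc] at this
      rw [this]
      rintro _ ⟨x, rfl⟩
      exact x.2)
    have e₁ : w ≫ i₃ ≫ i₂ ≫ y₁ = y := by
      refine RatMapsTo.unique ρ hρ.isOver ?_ h₁
      have := hy₁.comp _ (w ≫ i₃ ≫ i₂)
      simpa [i] using this
    have e₂ : w ≫ i₃ ≫ y₂ = z := by
      refine RatMapsTo.unique ρ hρ.isOver ?_ h₂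
      have := hy₂.comp _ (w ≫ i₃)
      rw [← e₁]
      simpa [i] using this
    have e₃ : w ≫ y₃ = z := by
      refine RatMapsTo.unique ρ hρ.isOver ?_ h₃
      have := hy₃.comp _ w
      rw [comp_lift, comp_lift, comp_lift, comp_lift, MonObj.comp_mul, MonObj.comp_mul,
        MonObj.comp_mul, MonObj.comp_mul] at this
      simpa [i] using this
    exact Over.OverMorphism.ext (ext_of_isDominant W'.ι
      (congrArg (fun q => q.left) (e₂.trans e₃.symm)))
  -- The given T-point factors successively through the three domains, where the universal identity
  -- `key` can be evaluated.
  obtain ⟨a₁, ha₁⟩ := hT₁ (lift g₁ (lift g₂ x)) (z := y) (by simpa [p₂, p₃] using h₁)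
  have e₁ : a₁ ≫ y₁ = y := by
    refine RatMapsTo.unique ρ hρ.isOver (hy₁.comp _ a₁) ?_
    rw [reassoc_of% ha₁]
    simpa [p₂, p₃] using h₁
  obtain ⟨a₂, ha₂⟩ := hT₂ a₁ (z := z) (by simpa [reassoc_of% ha₁, e₁, p₁] using h₂)
  have e₂ : a₂ ≫ y₂ = z := by
    refine RatMapsTo.unique ρ hρ.isOver (hy₂.comp _ a₂) ?_
    rw [reassoc_of% ha₂]
    simpa [reassoc_of% ha₁, e₁, p₁] using h₂
  have e₃' : a₂ ≫ i₂ ≫ i₁ ≫ lift (p₁ * p₂) p₃ = lift (g₁ * g₂) x := by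
    rw [reassoc_of% ha₂, reassoc_of% ha₁, comp_lift, MonObj.comp_mul]
    simp [p₁, p₂, p₃]
  obtain ⟨a₃, ha₃⟩ := hT₃ a₂ (z := z') (by rwa [e₃'])
  have e₃ : a₃ ≫ y₃ = z' := by
    refine RatMapsTo.unique ρ hρ.isOver (hy₃.comp _ a₃) ?_
    rw [reassoc_of% ha₃]
    rwa [e₃']
  rw [← e₂, ← e₃, ← key, reassoc_of% ha₃]

end Action

/-! ### Pull-backs of rational functions and multiplication in G -/

section Pullback

open CartesianMonoidalCategory MonObj

variable {k K : Type u} [Field k] [Field K] [Algebra k K] {G X : Over (Spec (.of k))} [GrpObj G]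
  [Smooth G.hom] [GeometricallyIntegral X.hom] [LocallyOfFiniteType X.hom] [X.left.IsSeparated]
  {ρ : (G ⊗ X).left.RationalMap X.left}

lemma specMap_comp_structure (σ : RatFun (baseChange X K) ≃ₐ[K] RatFun (baseChange X K)) :
    Spec.map (CommRingCat.ofHom σ.toRingEquiv.toRingHom) ≫
      genPt (baseChange X K) ≫ (baseChange X K).hom =
      genPt (baseChange X K) ≫ (baseChange X K).hom := by
  rw [← specMap_algebraMap_ratFun, ← Spec.map_comp, ← CommRingCat.ofHom_comp]
  congr 2
  ext c
  exact σ.commutes c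

/-- The endomorphism of the generic point of `X_K` given by a `K`-automorphism of the function
field. -/
def specAut (σ : RatFun (baseChange X K) ≃ₐ[K] RatFun (baseChange X K)) :
    specRatFun X K ⟶ specRatFun X K :=
  Over.homMk (Spec.map (CommRingCat.ofHom σ.toRingEquiv.toRingHom)) (by
    exact (Category.assoc _ _ _).symm.trans
      (congrArg (· ≫ (SpecExt k K).hom) (specMap_comp_structure σ)))

lemma specAut_constPt (σ : RatFun (baseChange X K) ≃ₐ[K] RatFun (baseChange X K))
    (g : SpecExt k K ⟶ G) : specAut σ ≫ constPt g = constPt g := by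
  refine (Category.assoc _ _ _).symm.trans (congrArg (· ≫ g) ?_)
  exact Over.OverMorphism.ext (specMap_comp_structure σ)

lemma constPt_mul (g h : SpecExt k K ⟶ G) :
    (constPt (g * h) : specRatFun X K ⟶ G) = constPt g * constPt h :=
  MonObj.comp_mul _ _ _

lemma eq_of_specMap_genericPt {R : Type u} [CommRing R] {f g : RatFun (baseChange X K) →+* R}
    (h : Spec.map (CommRingCat.ofHom f) ≫ (genericPt X K).left =
      Spec.map (CommRingCat.ofHom g) ≫ (genericPt X K).left) (x : RatFun X) :
    f (ratFunMap X K x) = g (ratFunMap X K x) := by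
  have hη : (genericPt X K).left = Spec.map (CommRingCat.ofHom (ratFunMap X K)) ≫ genPt X :=
    (ratFunMap_spec X K).symm
  rw [hη, ← Category.assoc, ← Category.assoc, cancel_mono, ← Spec.map_comp, ← Spec.map_comp] at h
  exact DFunLike.congr_fun (congrArg CommRingCat.Hom.hom (Spec.map_injective h)) x

lemma isPullbackBy_iff {g : SpecExt k K ⟶ G}
    {σ : RatFun (baseChange X K) ≃ₐ[K] RatFun (baseChange X K)} :
    IsPullbackBy ρ g σ ↔
      RatMapsTo ρ (lift (constPt g) (genericPt X K)) (specAut σ ≫ genericPt X K) := by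
  constructor
  · rintro ⟨y, hy, e⟩
    rwa [← show y = specAut σ ≫ genericPt X K from Over.OverMorphism.ext e]
  · exact fun h => ⟨_, h, rfl⟩

/-- Pull-back is contravariant, and the identity is read off at the generic point η. Acting first by
h gives η ∘ Spec σ'; precomposition with Spec σ' leaves the constant point g unchanged, so acting by
g afterwards gives η ∘ Spec σ ∘ Spec σ'. -/
lemma IsPullbackBy.mul_apply (hρ : IsRationalAction G X ρ) {g h : SpecExt k K ⟶ G}
    {σ σ' σ'' : RatFun (baseChange X K) ≃ₐ[K] RatFun (baseChange X K)} (hg : IsPullbackBy ρ g σ)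
    (hh : IsPullbackBy ρ h σ') (hgh : IsPullbackBy ρ (g * h) σ'') (f) : σ'' f = σ' (σ f) := by
  rw [isPullbackBy_iff] at hg hh hgh
  rw [constPt_mul] at hgh
  have h1 := RatMapsTo.comp ρ hg (specAut σ')
  rw [comp_lift, specAut_constPt] at h1
  have h2 := hρ.eq_of_ratMapsTo hh h1 hgh
  suffices σ'' = σ.trans σ' from DFunLike.congr_fun this f
  refine ratFun_algEquiv_ext (fun x => ?_)
  refine (eq_of_specMap_genericPt (f := (σ.trans σ').toRingEquiv.toRingHom)
    (g := σ''.toRingEquiv.toRingHom) ?_ x).symm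
  refine Eq.trans ?_ (congrArg (fun q => q.left) h2)
  have h3 : Spec.map (CommRingCat.ofHom (σ.trans σ').toRingEquiv.toRingHom) =
      Spec.map (CommRingCat.ofHom σ'.toRingEquiv.toRingHom) ≫
        Spec.map (CommRingCat.ofHom σ.toRingEquiv.toRingHom) := by
    rw [← Spec.map_comp]
    rfl
  rw [h3]
  exact Category.assoc _ _ _

end Pullback

end

/-! ### Extension of partially defined homomorphisms, and inner automorphisms of the matrix algebra
-/

section

/-- A map which is defined and multiplicative on a subset with the property that finitely many
translates of it have a common point extends to a homomorphism. -/
lemma exists_monoidHom_extension {Γ H : Type*} [Group Γ] [Group H] {U : Set Γ}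
    (hU : ∀ s : Finset Γ, ∃ w, ∀ g ∈ s, g * w ∈ U) (t : Γ → H)
    (ht : ∀ g h, g ∈ U → h ∈ U → g * h ∈ U → t (g * h) = t g * t h) :
    ∃ τ : Γ →* H, ∀ g ∈ U, τ g = t g := by
  classical
  have hw : ∀ g, ∃ w, w ∈ U ∧ g * w ∈ U := fun g => by
    obtain ⟨w, hw⟩ := hU {1, g}
    exact ⟨w, by simpa using hw 1 (by simp), hw g (by simp)⟩
  choose w hw hgw using hw
  let τ : Γ → H := fun g => t (g * w g) * (t (w g))⁻¹
  -- The value t(gv) t(v)⁻¹ does not depend on v: any two choices are compared with a third one, x,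
  -- for which all the products that occur lie in U.
  have key : ∀ g v, v ∈ U → g * v ∈ U → τ g = t (g * v) * (t v)⁻¹ := by
    intro g v hv hgv
    obtain ⟨x, hx⟩ := hU {(w g)⁻¹, v⁻¹, 1, g}
    have h1 : ∀ v, v ∈ U → g * v ∈ U → v⁻¹ * x ∈ U →
        t (g * v) * (t v)⁻¹ = t (g * x) * (t x)⁻¹ := by
      intro v hv hgv hvx
      have hxU : x ∈ U := by simpa using hx 1 (by simp)
      have e1 := ht v (v⁻¹ * x) hv hvx (by simpa using hxU)
      have e2 := ht (g * v) (v⁻¹ * x) hgv hvx (by simpa [_root_.mul_assoc] using hx g (by simp))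
      rw [mul_inv_cancel_left] at e1
      rw [_root_.mul_assoc, mul_inv_cancel_left] at e2
      rw [e1, e2]
      group
    exact (h1 _ (hw g) (hgw g) (hx _ (by simp))).trans (h1 v hv hgv (hx _ (by simp))).symm
  refine ⟨MonoidHom.mk' τ fun g h => ?_, fun g hg => ?_⟩
  · obtain ⟨v, hv⟩ := hU {1, h, g * h}
    have hv1 : v ∈ U := by simpa using hv 1 (by simp)
    have hv2 : h * v ∈ U := hv h (by simp)
    have hv3 : g * (h * v) ∈ U := by simpa [_root_.mul_assoc] using hv (g * h) (by simp)
    rw [key (g * h) v hv1 (hv _ (by simp)), key h v hv1 hv2, key g (h * v) hv2 hv3]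
    simp [_root_.mul_assoc]
  · change t (g * w g) * (t (w g))⁻¹ = t g
    rw [ht g (w g) hg (hw g) (hgw g), mul_inv_cancel_right]

section Conj

variable {N : ℕ} {R S : Type*} [CommRing R] [CommRing S]

/-- The matrix of the linear map `x ↦ a x b` on `Mat_N(R)`. -/
def conjMat (a b : Matrix (Fin N) (Fin N) R) : Matrix (Fin N × Fin N) (Fin N × Fin N) R :=
  Matrix.of fun p q => a p.1 q.1 * b q.2 p.2

lemma act_conjMat (a b x : Matrix (Fin N) (Fin N) R) : act (conjMat a b) x = a * x * b := by
  ext i j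
  simp only [act, conjMat, Matrix.of_apply, Matrix.mul_apply, Fintype.sum_prod_type,
    Finset.sum_mul]
  rw [Finset.sum_comm]
  exact Finset.sum_congr rfl fun _ _ => Finset.sum_congr rfl fun _ _ => by ring

lemma act_injective : Function.Injective
    (act : Matrix (Fin N × Fin N) (Fin N × Fin N) R → _) := by
  intro a b h
  ext ⟨i, j⟩ ⟨p, q⟩
  have h1 : ∀ a : Matrix (Fin N × Fin N) (Fin N × Fin N) R,
      act a (Matrix.single p q 1) i j = a (i, j) (p, q) := fun a => by
    simp only [act, Matrix.of_apply]
    rw [Finset.sum_eq_single (p, q)]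
    · simp
    · rintro ⟨p', q'⟩ - hne
      rw [Matrix.single_apply_of_ne, mul_zero]
      rintro ⟨rfl, rfl⟩
      exact hne rfl
    · simp
  rw [← h1 a, ← h1 b, h]

lemma conjMat_mul (a b c d : Matrix (Fin N) (Fin N) R) :
    conjMat a b * conjMat c d = conjMat (a * c) (d * b) := by
  refine act_injective (funext fun x => ?_)
  rw [act_mul, act_conjMat, act_conjMat, act_conjMat]
  simp only [_root_.mul_assoc]

lemma conjMat_one : conjMat (1 : Matrix (Fin N) (Fin N) R) 1 = 1 := by
  refine act_injective (funext fun x => ?_)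
  rw [act_conjMat, act_one, _root_.one_mul, _root_.mul_one]

/-- The inner automorphism of `Mat_N(R)` defined by an invertible matrix. -/
def conj : GL (Fin N) R →* PGLPoints N R where
  toFun a := ⟨⟨conjMat a.1 (a⁻¹).1, conjMat (a⁻¹).1 a.1,
      by rw [conjMat_mul, ← Units.val_mul, mul_inv_cancel, Units.val_one, conjMat_one],
      by rw [conjMat_mul, ← Units.val_mul, inv_mul_cancel, Units.val_one, conjMat_one]⟩, by
    refine ⟨?_, fun x y => ?_⟩
    · rw [act_conjMat, _root_.mul_one, ← Units.val_mul, mul_inv_cancel, Units.val_one]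
    · have h : (a⁻¹).1 * a.1 = 1 := by rw [← Units.val_mul, inv_mul_cancel, Units.val_one]
      simp only [act_conjMat, _root_.mul_assoc]
      rw [← _root_.mul_assoc (a⁻¹).1 a.1, h, _root_.one_mul]⟩
  map_one' := Subtype.ext (Units.ext (by simp [conjMat_one]))
  map_mul' a b := Subtype.ext (Units.ext (by simp [conjMat_mul]))

lemma act_conj (a : GL (Fin N) R) (x : Matrix (Fin N) (Fin N) R) :
    act (conj a).1.1 x = a.1 * x * (a⁻¹).1 :=
  act_conjMat _ _ _

lemma eq_conj_of_act {a : PGLPoints N R} {m : GL (Fin N) R}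
    (h : ∀ x, act a.1.1 x = m.1 * x * (m⁻¹).1) : a = conj m :=
  Subtype.ext (Units.ext (act_injective (funext fun x => (h x).trans (act_conj m x).symm)))

lemma map_conj (f : R →+* S) (a : GL (Fin N) R) :
    PGLPoints.map f (conj a) = conj (Matrix.GeneralLinearGroup.map f a) := by
  refine Subtype.ext (Units.ext ?_)
  ext p q
  change f (a.1 p.1 q.1 * (a⁻¹).1 q.2 p.2) = f (a.1 p.1 q.1) * _
  rw [map_mul, ← map_inv]
  rfl

lemma conj_eq_conj_of_eq_smul [NeZero N] {K : Type*} [Field K] {a b : GL (Fin N) K} {l : K}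
    (h : b.1 = l • a.1) : conj a = conj b := by
  have hl : l ≠ 0 := by
    rintro rfl
    rw [zero_smul] at h
    exact Units.ne_zero b h
  have h' : (b⁻¹).1 = l⁻¹ • (a⁻¹).1 := by
    have : b.1 * (l⁻¹ • (a⁻¹).1) = 1 := by
      rw [h, Matrix.smul_mul, Matrix.mul_smul, smul_smul, mul_inv_cancel₀ hl, one_smul,
        ← Units.val_mul, mul_inv_cancel, Units.val_one]
    exact Units.inv_eq_of_mul_eq_one_right this
  refine eq_conj_of_act fun x => ?_
  rw [act_conj, h, h', Matrix.smul_mul, Matrix.smul_mul, Matrix.mul_smul, smul_smul,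
    mul_inv_cancel₀ hl, one_smul]

lemma map_comp_apply {T : Type*} [CommRing T] (f : R →+* S) (g : S →+* T) (a : PGLPoints N R) :
    PGLPoints.map (g.comp f) a = PGLPoints.map g (PGLPoints.map f a) := rfl

end Conj

/-! ### Values of points of PGL_N -/

section Value

open CartesianMonoidalCategory MonObj

variable {k : Type u} [Field k] {N : ℕ} {K : Type u} [Field K] [Algebra k K]

lemma PGL.value_injective : Function.Injective (PGL.value : (SpecExt k K ⟶ PGL k N) → _) := by
  intro p q h
  refine (PGL.homEquiv _).injective ?_
  have h1 : ∀ a : PGLPoints N Γ((SpecExt k K).left, ⊤), PGLPoints.map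
      (Scheme.ΓSpecIso (.of K)).inv.hom (PGLPoints.map (Scheme.ΓSpecIso (.of K)).hom.hom a) = a := by
    intro a
    rw [← map_comp_apply]
    refine Subtype.ext (Units.ext ?_)
    ext i j
    exact congr($((Scheme.ΓSpecIso (.of K)).hom_inv_id).hom (a.1.1 i j))
  rw [← h1 (PGL.homEquiv _ p), ← h1 (PGL.homEquiv _ q)]
  exact congrArg _ h

/-- The group law was defined by representability, so the formula holds for the universal pair of
projections; the general case follows by naturality. -/
lemma PGL.homEquiv_mul {T : Over (Spec (.of k))} (p q : T ⟶ PGL k N) :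
    PGL.homEquiv T (p * q) = PGL.homEquiv T p * PGL.homEquiv T q := by
  have h1 : PGL.homEquiv _ μ[PGL k N] =
      PGL.homEquiv _ (fst (PGL k N) (PGL k N)) * PGL.homEquiv _ (snd (PGL k N) (PGL k N)) :=
    (PGL.homEquiv _).apply_symm_apply _
  change PGL.homEquiv T (lift p q ≫ μ[PGL k N]) = _
  rw [PGL.homEquiv_comp, h1, map_mul, ← PGL.homEquiv_comp, ← PGL.homEquiv_comp, lift_fst, lift_snd]

lemma PGL.value_mul (p q : SpecExt k K ⟶ PGL k N) :
    PGL.value (p * q) = PGL.value p * PGL.value q := by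
  rw [PGL.value, PGL.homEquiv_mul, map_mul]
  rfl

/-- The morphism `Spec B → PGL_N` defined by an invertible matrix over `B`. -/
def PGL.ofGL {B : Type u} [CommRing B] [Algebra k B] (a : GL (Fin N) B) : SpecAlg k B ⟶ PGL k N :=
  PGL.ofPoint _ (PGLPoints.map (Scheme.ΓSpecIso (.of B)).inv.hom (conj a))

lemma PGL.value_map_ofGL {B : Type u} [CommRing B] [Algebra k B] (a : GL (Fin N) B)
    (p : B →ₐ[k] K) : PGL.value (SpecAlg.map p ≫ PGL.ofGL a) =
      conj (Matrix.GeneralLinearGroup.map p.toRingHom a) := by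
  have h1 : PGL.homEquiv (SpecAlg k B) (PGL.ofGL a) =
      PGLPoints.map (Scheme.ΓSpecIso (.of B)).inv.hom (conj a) :=
    (PGL.homEquiv _).apply_symm_apply _
  rw [← map_conj]
  refine (congrArg (PGLPoints.map (Scheme.ΓSpecIso (.of K)).hom.hom)
    (PGL.homEquiv_comp (SpecAlg.map p) (PGL.ofGL a))).trans ?_
  rw [h1, ← map_comp_apply, ← map_comp_apply]
  congr 2
  have : (Scheme.ΓSpecIso (.of B)).inv ≫ (SpecAlg.map p).left.appTop ≫
      (Scheme.ΓSpecIso (.of K)).hom = CommRingCat.ofHom p.toRingHom := by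
    change (Scheme.ΓSpecIso (.of B)).inv ≫ (Spec.map (CommRingCat.ofHom p.toRingHom)).appTop ≫
      (Scheme.ΓSpecIso (.of K)).hom = _
    simp
  exact congrArg CommRingCat.Hom.hom this

end Value

end

section

open scoped TensorProduct
open CartesianMonoidalCategory MonObj

/-! ### Geometric points of affine schemes -/

section AffinePoints

variable {k K B : Type u} [Field k] [Field K] [Algebra k K] [CommRing B] [Algebra k B]

lemma SpecAlg.map_id : SpecAlg.map (AlgHom.id k B) = 𝟙 (SpecAlg k B) :=
  Over.OverMorphism.ext (Spec.map_id _)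

lemma SpecAlg.map_comp {C D : Type u} [CommRing C] [Algebra k C] [CommRing D] [Algebra k D]
    (f : B →ₐ[k] C) (g : C →ₐ[k] D) :
    SpecAlg.map (g.comp f) = SpecAlg.map g ≫ SpecAlg.map f :=
  Over.OverMorphism.ext (Spec.map_comp (CommRingCat.ofHom f.toRingHom)
    (CommRingCat.ofHom g.toRingHom))

lemma SpecAlg.exists_map_eq {C : Type u} [CommRing C] [Algebra k C]
    (x : SpecAlg k C ⟶ SpecAlg k B) : ∃ p : B →ₐ[k] C, SpecAlg.map p = x := by
  let y : Spec (.of C) ⟶ Spec (.of B) := x.left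
  have h1 : y ≫ Spec.map (CommRingCat.ofHom (algebraMap k B)) =
    Spec.map (CommRingCat.ofHom (algebraMap k C)) := Over.w x
  obtain ⟨φ, hφ⟩ : ∃ φ, Spec.map φ = y := Spec.map_surjective _
  rw [← hφ, ← Spec.map_comp] at h1
  have h2 := congrArg CommRingCat.Hom.hom (Spec.map_injective h1)
  exact ⟨⟨φ.hom, fun c => DFunLike.congr_fun h2 c⟩, Over.OverMorphism.ext hφ⟩

lemma SpecAlg.locallyOfFiniteType [Algebra.FiniteType k B] :
    LocallyOfFiniteType (SpecAlg k B).hom := by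
  refine (HasRingHomProperty.Spec_iff (P := @LocallyOfFiniteType)).2 ?_
  change (algebraMap k B).FiniteType
  exact RingHom.finiteType_algebraMap.2 inferInstance

/-- This is the Nullstellensatz: in a reduced algebra a nonzero b has a nonempty basic open set,
which contains a K-point. -/
lemma eq_zero_of_forall_algHom [IsAlgClosed K] [Algebra.FiniteType k B] [_root_.IsReduced B]
    {b : B} (h : ∀ p : B →ₐ[k] K, p b = 0) : b = 0 := by
  by_contra hb
  have := SpecAlg.locallyOfFiniteType (k := k) (B := B)
  let S : Set (SpecAlg k B).left := (PrimeSpectrum.basicOpen b : Set (PrimeSpectrum B))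
  have hne : S.Nonempty := by
    by_contra hS
    have h1 : (PrimeSpectrum.basicOpen b) = ⊥ :=
      TopologicalSpace.Opens.ext (Set.not_nonempty_iff_eq_empty.1 hS)
    exact hb ((PrimeSpectrum.basicOpen_eq_bot_iff b).1 h1).eq_zero
  have hS : IsOpen S := (PrimeSpectrum.basicOpen b).2
  obtain ⟨x, hx⟩ := exists_point_mem K (SpecAlg k B) hS.isLocallyClosed hne
  obtain ⟨p, rfl⟩ := SpecAlg.exists_map_eq x
  let z : PrimeSpectrum K := ⊥
  have h2 : (SpecAlg.map p).left z ∈ S := hx ⟨z, rfl⟩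
  have h3 : p b ∉ z.asIdeal := h2
  exact h3 (by rw [h]; exact zero_mem _)

end AffinePoints

lemma exists_lift_of_range_subset {k : Type u} [Field k] {S T Z : Over (Spec (.of k))} (i : S ⟶ Z)
    [IsOpenImmersion i.left] (f : T ⟶ Z) (h : Set.range f.left ⊆ Set.range i.left) :
    ∃ f' : T ⟶ S, f' ≫ i = f :=
  ⟨Over.homMk (IsOpenImmersion.lift i.left f.left h) (by
    rw [← Over.w i, IsOpenImmersion.lift_fac_assoc, Over.w]),
    Over.OverMorphism.ext (IsOpenImmersion.lift_fac _ _ _)⟩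

/-! ### The action on affine charts and local matrices for it -/

section Evaluation

variable {k K : Type u} [Field k] [Field K] [Algebra k K] {X : Over (Spec (.of k))}
  [GeometricallyIntegral X.hom]

/-- The function field of `X_K` as an algebra over `k`. -/
@[reducible] def ratFunBaseAlgebra : Algebra k (RatFun (baseChange X K)) :=
  ((algebraMap K (RatFun (baseChange X K))).comp (algebraMap k K)).toAlgebra

attribute [local instance] ratFunBaseAlgebra

instance : IsScalarTower k K (RatFun (baseChange X K)) := .of_algebraMap_eq fun _ => rfl

/-- The point over the function field of `X_K` defined by a homomorphism to it. -/
def ratPt {B : Type u} [CommRing B] [Algebra k B] (f : B →ₐ[k] RatFun (baseChange X K)) :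
    specRatFun X K ⟶ SpecAlg k B :=
  Over.homMk (Spec.map (CommRingCat.ofHom f.toRingHom)) (by
    refine (Spec.map_comp (CommRingCat.ofHom (algebraMap k B))
      (CommRingCat.ofHom f.toRingHom)).symm.trans ?_
    refine Eq.trans ?_ (congrArg (· ≫ (SpecExt k K).hom)
      (specMap_algebraMap_ratFun (baseChange X K)))
    refine Eq.trans ?_ (Spec.map_comp (CommRingCat.ofHom (algebraMap k K))
      (CommRingCat.ofHom (algebraMap K (RatFun (baseChange X K)))))
    exact congrArg (fun g => Spec.map (CommRingCat.ofHom g)) f.comp_algebraMap)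

lemma ratPt_comp {B C : Type u} [CommRing B] [Algebra k B] [CommRing C] [Algebra k C]
    (f : C →ₐ[k] RatFun (baseChange X K)) (g : B →ₐ[k] C) :
    ratPt (f.comp g) = ratPt f ≫ SpecAlg.map g :=
  Over.OverMorphism.ext (Spec.map_comp (CommRingCat.ofHom g.toRingHom)
    (CommRingCat.ofHom f.toRingHom))

variable {A : Type u} [CommRing A] [Algebra k A] [Nontrivial A] (j : SpecAlg k A ⟶ X)
  [IsOpenImmersion j.left]

variable (K) in
/-- The rational functions on `X_K` defined by functions on a chart of `X`. -/
def chartFun : A →ₐ[k] RatFun (baseChange X K) :=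
  ((chartHom K j).restrictScalars k).comp Algebra.TensorProduct.includeRight

lemma ratPt_chartFun : ratPt (chartFun K j) ≫ j = genericPt X K :=
  Over.OverMorphism.ext (specMap_chartHom K j)

lemma linearIndependent_chartFun {n : Type*} (e : Module.Basis n k A) :
    LinearIndependent K (chartFun K j ∘ e) := by
  have h := (Algebra.TensorProduct.basis K e).linearIndependent.map'
    (chartHom K j).toLinearMap (LinearMap.ker_eq_bot.2 (chartHom_injective K j))
  have h1 : chartFun K j ∘ e = (chartHom K j).toLinearMap ∘ Algebra.TensorProduct.basis K e :=
    funext fun i => by simp [chartFun]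
  rw [h1]
  exact h

lemma ratPt_evalProd {B : Type u} [CommRing B] [Algebra k B] {G : Over (Spec (.of k))}
    (jB : SpecAlg k B ⟶ G) (p : B →ₐ[k] K) :
    ratPt (evalProd (chartFun K j) p) ≫
      lift (SpecAlg.map Algebra.TensorProduct.includeLeft ≫ jB)
        (SpecAlg.map Algebra.TensorProduct.includeRight ≫ j) =
      lift (constPt (X := X) (SpecAlg.map p ≫ jB)) (genericPt X K) := by
  rw [comp_lift, ← Category.assoc, ← Category.assoc, ← ratPt_comp, ← ratPt_comp]
  have h1 : (evalProd (chartFun K j) p).comp Algebra.TensorProduct.includeRight = chartFun K j :=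
    AlgHom.ext fun a => by simp [evalProd_tmul]
  have h2 : (evalProd (chartFun K j) p).comp Algebra.TensorProduct.includeLeft =
      (IsScalarTower.toAlgHom k K (RatFun (baseChange X K))).comp p :=
    AlgHom.ext fun a => by simp [evalProd_tmul]
  rw [h1, h2, ratPt_chartFun, ratPt_comp, Category.assoc]
  congr 1
  refine (congrArg (· ≫ SpecAlg.map p ≫ jB) ?_)
  exact Over.OverMorphism.ext (specMap_algebraMap_ratFun (baseChange X K))

variable {G : Over (Spec (.of k))} [GrpObj G]
  [Smooth G.hom] [LocallyOfFiniteType X.hom] [X.left.IsSeparated]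
  {ρ : (G ⊗ X).left.RationalMap X.left}

/-- The part of Spec (B ⊗ A) where the action is defined and has values in the chart `j` is open,
and it contains the generic point of the fibre over `p₀`. A basic open neighbourhood D(s) of that
point carries the action as a homomorphism `θ`, which specializes to the pull-back of functions at
every point p at which `s` does not vanish on the fibre. -/
lemma exists_localization_hom (hρ : IsRationalAction G X ρ) {B : Type u} [CommRing B] [Algebra k B]
    (jB : SpecAlg k B ⟶ G) (p₀ : B →ₐ[k] K)
    {σ₀ : RatFun (baseChange X K) ≃ₐ[K] RatFun (baseChange X K)}
    (hσ₀ : IsPullbackBy ρ (SpecAlg.map p₀ ≫ jB) σ₀) :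
    ∃ (s : B ⊗[k] A) (θ : A →ₐ[k] Localization.Away s), evalProd (chartFun K j) p₀ s ≠ 0 ∧
      ∀ (p : B →ₐ[k] K) (σ : RatFun (baseChange X K) ≃ₐ[K] RatFun (baseChange X K)),
        IsPullbackBy ρ (SpecAlg.map p ≫ jB) σ →
        ∀ ev : Localization.Away s →ₐ[k] RatFun (baseChange X K),
          (∀ x, ev (algebraMap _ _ x) = evalProd (chartFun K j) p x) →
          ∀ a, ev (θ a) = σ (chartFun K j a) := by
  let r : SpecAlg k (B ⊗[k] A) ⟶ G ⊗ X :=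
    lift (SpecAlg.map Algebra.TensorProduct.includeLeft ≫ jB)
      (SpecAlg.map Algebra.TensorProduct.includeRight ≫ j)
  obtain ⟨T', i, y, hi, hy, hT⟩ := exists_restrict_ratDomain ρ hρ.isOver r
  have : Mono i := (Over.forget _).mono_of_mono_map (inferInstanceAs (Mono i.left))
  let V : T'.left.Opens := y.left ⁻¹ᵁ j.left.opensRange
  have hfac : ∀ (p : B →ₐ[k] K) (σ : RatFun (baseChange X K) ≃ₐ[K] RatFun (baseChange X K)),
      IsPullbackBy ρ (SpecAlg.map p ≫ jB) σ → ∃ a : specRatFun X K ⟶ T',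
        a ≫ i = ratPt (evalProd (chartFun K j) p) ∧ a ≫ y = specAut σ ≫ genericPt X K := by
    intro p σ h
    rw [isPullbackBy_iff, ← ratPt_evalProd j] at h
    obtain ⟨a, ha⟩ := hT _ h
    refine ⟨a, ha, RatMapsTo.unique ρ hρ.isOver (hy.comp _ a) ?_⟩
    rwa [reassoc_of% ha]
  let z : (specRatFun X K).left := (⊥ : PrimeSpectrum (RatFun (baseChange X K)))
  obtain ⟨a₀, ha₀, ha₀'⟩ := hfac p₀ σ₀ hσ₀
  have hz : a₀.left z ∈ V := by
    refine ⟨(specAut σ₀ ≫ ratPt (chartFun K j)).left z, ?_⟩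
    change ((specAut σ₀ ≫ ratPt (chartFun K j)) ≫ j).left z = (a₀ ≫ y).left z
    rw [ha₀', Category.assoc, ratPt_chartFun]
  have hO : IsOpen (i.left '' V) := i.left.isOpenMap _ V.2
  have hz' : (ratPt (evalProd (chartFun K j) p₀)).left z ∈ i.left '' V :=
    ⟨a₀.left z, hz, congrArg (fun q => q.left z) ha₀⟩
  obtain ⟨_, ⟨s, rfl⟩, hs, hsub⟩ :=
    (PrimeSpectrum.isTopologicalBasis_basic_opens (R := B ⊗[k] A)).exists_subset_of_mem_open hz' hO
  let loc := IsScalarTower.toAlgHom k (B ⊗[k] A) (Localization.Away s)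
  have hrange : Set.range (SpecAlg.map loc).left ⊆ i.left '' V :=
    (PrimeSpectrum.localization_away_comap_range (Localization.Away s) s).subset.trans hsub
  obtain ⟨l₁, hl₁⟩ := exists_lift_of_range_subset i (SpecAlg.map loc)
    (hrange.trans (Set.image_subset_range _ _))
  obtain ⟨l₂, hl₂⟩ := exists_lift_of_range_subset j (l₁ ≫ y) (by
    rintro _ ⟨x, rfl⟩
    obtain ⟨v, hv, hvx⟩ := hrange ⟨x, rfl⟩
    have : l₁.left x = v := i.left.isOpenEmbedding.injective
      ((congrArg (fun q => q.left x) hl₁).trans hvx.symm)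
    change y.left (l₁.left x) ∈ _
    rw [this]
    exact hv)
  obtain ⟨θ, rfl⟩ := SpecAlg.exists_map_eq l₂
  refine ⟨s, θ, fun h0 => hs ?_, fun p σ h ev hev a => ?_⟩
  · change evalProd (chartFun K j) p₀ s = 0
    exact h0
  · obtain ⟨a', ha', ha''⟩ := hfac p σ h
    have h1 : ev.comp loc = evalProd (chartFun K j) p := AlgHom.ext hev
    have h2 : a' = ratPt ev ≫ l₁ := by
      rw [← cancel_mono i, ha', Category.assoc, hl₁, ← ratPt_comp, h1]
    have h3 : ratPt (ev.comp θ) ≫ j = specAut σ ≫ ratPt (chartFun K j) ≫ j := by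
      rw [ratPt_chartFun, ← ha'', h2, ratPt_comp, Category.assoc, hl₂, Category.assoc]
    have h4 : (ev.comp θ).toRingHom = σ.toRingEquiv.toRingHom.comp (chartFun K j).toRingHom := by
      refine chart_ext j ?_
      refine (congrArg (fun q => q.left) h3).trans ?_
      refine (Category.assoc _ _ _).symm.trans (congrArg (· ≫ j.left) ?_)
      exact (Spec.map_comp (CommRingCat.ofHom (chartFun K j).toRingHom)
        (CommRingCat.ofHom σ.toRingEquiv.toRingHom)).symm
    exact DFunLike.congr_fun h4 a

lemma IsPullbackBy.unique (hρ : ρ.compHom X.hom = (G ⊗ X).hom.toRationalMap)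
    {g : SpecExt k K ⟶ G} {σ σ' : RatFun (baseChange X K) ≃ₐ[K] RatFun (baseChange X K)}
    (h : IsPullbackBy ρ g σ) (h' : IsPullbackBy ρ g σ') : σ = σ' := by
  rw [isPullbackBy_iff] at h h'
  refine ratFun_algEquiv_ext (fun x => ?_)
  exact eq_of_specMap_genericPt (f := σ.toRingEquiv.toRingHom) (g := σ'.toRingEquiv.toRingHom)
    (congrArg (fun q => q.left) (RatMapsTo.unique ρ hρ h h')) x

/-- With a common denominator, θ(β_i) = q_i / s^n. At each point p with s ≠ 0 on the fibre, q_i is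
s^n σ(v_i), a common factor times a constant combination of the v_j, which is the situation of
`exists_generic_matrix`. -/
lemma IsPullbackBy.exists_local_matrix [IsAlgClosed K] (hρ : IsRationalAction G X ρ)
    {N : ℕ} [NeZero N] {v : Fin N → RatFun (baseChange X K)} (hv : LinearIndependent K v)
    {β : Fin N → A} (hβ : ∀ i, v i = chartHom K j (1 ⊗ₜ β i))
    {B : Type u} [CommRing B] [Algebra k B] [Algebra.FiniteType k B] [_root_.IsReduced B]
    (jB : SpecAlg k B ⟶ G)
    (h : ∀ p : B →ₐ[k] K, ∃ σ M, IsPullbackBy ρ (SpecAlg.map p ≫ jB) σ ∧ ActsBy v σ M)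
    (p₀ : B →ₐ[k] K) :
    ∃ (d : B) (m : GL (Fin N) (Localization.Away d)), p₀ d ≠ 0 ∧
      ∀ p : Localization.Away d →ₐ[k] K, ∀ σ,
        IsPullbackBy ρ (SpecAlg.map (p.comp (IsScalarTower.toAlgHom k B _)) ≫ jB) σ →
          ActsBy v σ (Matrix.GeneralLinearGroup.map p.toRingHom m) := by
  obtain ⟨σ₀, M₀, hσ₀, -⟩ := h p₀
  obtain ⟨s, θ, hs, hθ⟩ := exists_localization_hom j hρ jB p₀ hσ₀
  obtain ⟨⟨b, hb⟩, hint⟩ := IsLocalization.exist_integer_multiples_of_finite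
    (Submonoid.powers s) (fun i => θ (β i))
  choose q hq using hint
  obtain ⟨n, rfl⟩ := hb
  have hv : ∀ i, chartFun K j (β i) = v i := fun i => (hβ i).symm
  have hq' : ∀ (p : B →ₐ[k] K) σ, evalProd (chartFun K j) p s ≠ 0 →
      IsPullbackBy ρ (SpecAlg.map p ≫ jB) σ → ∀ i,
        evalProd (chartFun K j) p (q i) = evalProd (chartFun K j) p s ^ n * σ (v i) := by
    intro p σ hp hσ i
    let ev : Localization.Away s →ₐ[k] RatFun (baseChange X K) :=
      IsLocalization.liftAlgHom (M := Submonoid.powers s) (f := evalProd (chartFun K j) p) (by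
        rintro ⟨_, m, rfl⟩
        change IsUnit (evalProd (chartFun K j) p (s ^ m))
        rw [map_pow]
        exact (IsUnit.mk0 _ hp).pow m)
    have hev : ∀ x, ev (algebraMap _ _ x) = evalProd (chartFun K j) p x := fun x =>
      IsLocalization.lift_eq _ _
    rw [← hv, ← hθ p σ hσ ev hev, ← hev, hq, Algebra.smul_def, map_mul, hev, map_pow]
  have hsingle : ∀ i, ∑ c, (Pi.single i (1 : K) : Fin N → K) c • v c = v i := fun i => by
    rw [Finset.sum_eq_single i]
    · simp
    · intro c _ hc
      simp [hc]
    · simp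
  have hβv : LinearIndependent K (chartFun K j ∘ β) := by
    rwa [show chartFun K j ∘ β = v from funext hv]
  obtain ⟨d, a, hd, ⟨d', hd'⟩, ha⟩ := exists_generic_matrix (Module.Basis.ofVectorSpace k A)
    (fun b hb => eq_zero_of_forall_algHom hb)
    (linearIndependent_chartFun j (Module.Basis.ofVectorSpace k A)) β hβv s q
    (fun p hp => by
      obtain ⟨σ, M, hσ, hM⟩ := h p
      obtain ⟨φ, hφ, hM⟩ := hM.apply
      refine ⟨evalProd (chartFun K j) p s ^ n * φ, mul_ne_zero (pow_ne_zero n hp) hφ,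
        (M⁻¹).1.transpose, ?_, fun i => ?_⟩
      · rw [Matrix.det_transpose]
        exact (Matrix.isUnit_iff_isUnit_det _).1 (M⁻¹).isUnit
      · rw [hq' p σ hp hσ, ← hsingle, hM, _root_.mul_assoc]
        simp [hv]) p₀ hs
  -- The rows of `a` express σ(v_i), whereas `ActsBy` uses coordinate vectors and σ⁻¹. The required
  -- matrix is therefore the inverse of the transpose of `a`; it exists because det a divides `d`.
  have hunit : IsUnit ((a.map (algebraMap B (Localization.Away d))).transpose.det) := by
    rw [Matrix.det_transpose, ← RingHom.mapMatrix_apply, ← RingHom.map_det]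
    refine isUnit_of_dvd_unit ?_ (IsLocalization.Away.algebraMap_isUnit (S := Localization.Away d) d)
    exact map_dvd _ ⟨d', hd'⟩
  let m := Matrix.GeneralLinearGroup.mk'' _ hunit
  refine ⟨d, m⁻¹, hd, fun p σ hσ => ?_⟩
  obtain ⟨hs', ψ, hψ, hψ'⟩ := ha (p.comp (IsScalarTower.toAlgHom k B _)) (by
    exact ((IsLocalization.Away.algebraMap_isUnit (S := Localization.Away d) d).map p).ne_zero)
  have h1 : ∀ i, σ (v i) = (evalProd (chartFun K j)
      (p.comp (IsScalarTower.toAlgHom k B (Localization.Away d))) s ^ n)⁻¹ * ψ *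
        ∑ c, p (algebraMap _ _ (a i c)) • v c := fun i => by
    have h2 := hψ' i
    rw [hq' _ σ hs' hσ] at h2
    rw [_root_.mul_assoc, eq_inv_mul_iff_mul_eq₀ (pow_ne_zero n hs'), h2]
    simp [hv]
  refine ActsBy.of_apply (φ := (evalProd (chartFun K j)
      (p.comp (IsScalarTower.toAlgHom k B (Localization.Away d))) s ^ n)⁻¹ * ψ)
    (mul_ne_zero (inv_ne_zero (pow_ne_zero n hs')) hψ) fun c => ?_
  have h3 : ∀ x y, ((Matrix.GeneralLinearGroup.map p.toRingHom m⁻¹)⁻¹).1 x y =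
      p (algebraMap _ _ (a y x)) := fun x y => by
    rw [← map_inv, inv_inv]
    rfl
  rw [map_sum]
  simp only [map_smul, h1, Matrix.mulVec, dotProduct, h3]
  simp only [Finset.sum_smul, Finset.mul_sum, Finset.smul_sum]
  rw [Finset.sum_comm]
  refine Finset.sum_congr rfl fun x _ => Finset.sum_congr rfl fun y _ => ?_
  simp only [Algebra.smul_def, map_mul]
  ring

end Evaluation

end

section

/-! ### Gluing the local matrices to a morphism to PGL_N -/

open CartesianMonoidalCategory MonObj

variable {k K : Type u} [Field k] [Field K] [Algebra k K] [IsAlgClosed K]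

/-- A map on `K`-points which is locally given by morphisms is given by a morphism. -/
lemma exists_glue_of_points {Z H : Over (Spec (.of k))} [LocallyOfFiniteType Z.hom]
    [AlgebraicGeometry.IsReduced Z.left] [IsSeparated H.hom]
    (v : (SpecExt k K ⟶ Z) → (SpecExt k K ⟶ H))
    (h : ∀ z : SpecExt k K ⟶ Z, ∃ (W : Over (Spec (.of k))) (i : W ⟶ Z) (f : W ⟶ H), IsOpenImmersion i.left ∧
      (∃ w, w ≫ i = z) ∧ ∀ w : SpecExt k K ⟶ W, w ≫ f = v (w ≫ i)) :
    ∃ f : Z ⟶ H, ∀ z, z ≫ f = v z := by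
  choose W i f hi hw hf using h
  choose w hw using hw
  let 𝒰 : Z.left.OpenCover :=
    { I₀ := SpecExt k K ⟶ Z
      X z := (W z).left
      f z := (i z).left
      mem₀ := by
        rw [Scheme.presieve₀_mem_precoverage_iff]
        refine ⟨fun x => ?_, hi⟩
        -- A point outside all the given open subschemes would make their closed complement contain
        -- a K-point, but every K-point lies in one of them.
        by_contra hx
        let O : Set Z.left := ⋃ z, Set.range (i z).left
        have hO : IsOpen O := isOpen_iUnion fun z => (i z).left.isOpenEmbedding.isOpen_range
        have hx' : x ∈ Oᶜ := fun hxO => hx (Set.mem_iUnion.1 hxO)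
        obtain ⟨z, hz⟩ := exists_point_mem K Z hO.isClosed_compl.isLocallyClosed ⟨x, hx'⟩
        let y : (SpecExt k K).left := (⊥ : PrimeSpectrum K)
        exact hz ⟨y, rfl⟩ (Set.mem_iUnion.2 ⟨z, (w z).left y, congrArg (fun q => q.left y) (hw z)⟩) }
  -- The overlaps are reduced, so compatibility is checked on K-points, where both morphisms are
  -- given by `v`.
  have hglue : ∀ z z', pullback.fst (i z).left (i z').left ≫ (f z).left =
      pullback.snd (i z).left (i z').left ≫ (f z').left := by
    intro z z'
    let P : Over (Spec (.of k)) := Over.mk (pullback.fst (i z).left (i z').left ≫ (W z).hom)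
    let a : P ⟶ W z := Over.homMk (pullback.fst (i z).left (i z').left)
    have ha : a.left ≫ (i z).left = pullback.snd (i z).left (i z').left ≫ (i z').left :=
      pullback.condition
    let b : P ⟶ W z' := Over.homMk (pullback.snd (i z).left (i z').left) (by
      rw [← Over.w (i z'), ← Category.assoc, ← ha, Category.assoc, Over.w]
      rfl)
    have hab : a ≫ i z = b ≫ i z' := Over.OverMorphism.ext ha
    have : IsOpenImmersion (a ≫ i z).left :=
      inferInstanceAs (IsOpenImmersion (pullback.fst (i z).left (i z').left ≫ (i z).left))
    have : AlgebraicGeometry.IsReduced P.left := isReduced_of_isOpenImmersion (a ≫ i z).left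
    have : LocallyOfFiniteType P.hom := by
      rw [← Over.w (a ≫ i z)]
      infer_instance
    refine congrArg (fun q => q.left) (over_ext_of_points (K := K) (f := a ≫ f z) (g := b ≫ f z')
      (U := ⊤) dense_univ fun p _ => ?_)
    rw [← Category.assoc, ← Category.assoc, hf, hf, Category.assoc, Category.assoc, hab]
  let F : Z.left ⟶ H.left := 𝒰.glueMorphisms (fun z => (f z).left) hglue
  have hF : ∀ z, (i z).left ≫ F = (f z).left := fun z => 𝒰.ι_glueMorphisms _ _ z
  let F' : Z ⟶ H := Over.homMk F (by
    refine 𝒰.hom_ext _ _ fun z => ?_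
    change (i z).left ≫ F ≫ H.hom = (i z).left ≫ Z.hom
    rw [← Category.assoc, hF, Over.w, Over.w])
  refine ⟨F', fun z => ?_⟩
  have h1 : i z ≫ F' = f z := Over.OverMorphism.ext (hF z)
  conv_lhs => rw [← hw z, Category.assoc, h1, hf, hw]

instance (N : ℕ) : IsSeparated (PGL k N).hom :=
  inferInstanceAs (IsSeparated (Spec.map (CommRingCat.ofHom (algebraMap k (PGLRing k N)))))

lemma PGL.value_ofGL {N : ℕ} (M : GL (Fin N) K) :
    PGL.value (PGL.ofGL M : SpecAlg k K ⟶ PGL k N) = conj M := by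
  have h := PGL.value_map_ofGL M (AlgHom.id k K)
  rw [SpecAlg.map_id, Category.id_comp] at h
  exact h.trans (congrArg conj (Units.ext (by ext; rfl)))

/-- A scheme over `k`, restricted to an open subset. -/
abbrev openOver {Z : Over (Spec (.of k))} (U : Z.left.Opens) : Over (Spec (.of k)) :=
  Over.mk (U.ι ≫ Z.hom)

/-- The inclusion of an open subset. -/
def openIncl {Z : Over (Spec (.of k))} (U : Z.left.Opens) : openOver U ⟶ Z := Over.homMk U.ι

instance {Z : Over (Spec (.of k))} (U : Z.left.Opens) : IsOpenImmersion (openIncl U).left :=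
  inferInstanceAs (IsOpenImmersion U.ι)

lemma range_comp_openIncl {Z T : Over (Spec (.of k))} {U : Z.left.Opens} (x : T ⟶ openOver U) :
    Set.range (x ≫ openIncl U).left ⊆ U := by
  rintro _ ⟨y, rfl⟩
  exact (x.left y).2

variable {G X : Over (Spec (.of k))} [GrpObj G] [Smooth G.hom] [GeometricallyIntegral X.hom]
  [LocallyOfFiniteType X.hom] [X.left.IsSeparated] {ρ : (G ⊗ X).left.RationalMap X.left}

/-- Matrices are chosen arbitrarily at each point. A local matrix from `exists_local_matrix` acts by
the same σ, so it differs from the chosen one by a scalar, and the two have the same class in PGL_N.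
-/
lemma exists_hom_of_actsBy (hρ : IsRationalAction G X ρ) {N : ℕ} [NeZero N] (f : Fin N → RatFun X)
    (hf : LinearIndependent K fun i => ratFunMap X K (f i)) {U : G.left.Opens}
    (h : ∀ g : SpecExt k K ⟶ G, Set.range g.left ⊆ U →
      ∃ σ M, IsPullbackBy ρ g σ ∧ ActsBy (fun i => ratFunMap X K (f i)) σ M) :
    ∃ t : openOver U ⟶ PGL k N, ∀ (z : SpecExt k K ⟶ openOver U) σ M,
      IsPullbackBy ρ (z ≫ openIncl U) σ → ActsBy (fun i => ratFunMap X K (f i)) σ M →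
        PGL.value (z ≫ t) = conj M := by
  choose σ M hσ hM using fun z : SpecExt k K ⟶ openOver U => h _ (range_comp_openIncl z)
  obtain ⟨A, _, _, _, j, _, β, _, hβ⟩ := exists_chart_of_ratFun K X f
  have hlft : LocallyOfFiniteType (openOver U).hom :=
    inferInstanceAs (LocallyOfFiniteType (U.ι ≫ G.hom))
  have hred : AlgebraicGeometry.IsReduced G.left := isReduced_of_smooth_hom G.hom
  have : AlgebraicGeometry.IsReduced (openOver U).left :=
    inferInstanceAs (AlgebraicGeometry.IsReduced (U : Scheme))
  obtain ⟨t, ht⟩ := exists_glue_of_points (fun z => (PGL.ofGL (M z) : SpecAlg k K ⟶ PGL k N))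
    fun z => by
      let y : (SpecExt k K).left := (⊥ : PrimeSpectrum K)
      obtain ⟨V, hV, hy, -⟩ := exists_isAffineOpen_mem_and_subset (x := z.left y) (U := ⊤) trivial
      let := sectionAlgebra (openOver U) V
      obtain ⟨jB, hjB⟩ := exists_chart (openOver U) hV
      have : IsOpenImmersion jB.left := hjB ▸ inferInstance
      have : Algebra.FiniteType k Γ((openOver U).left, V) := finiteType_section (openOver U) hV
      obtain ⟨p₀, hp₀⟩ := exists_lift_of_range_subset jB z (by
        rintro _ ⟨y', rfl⟩
        obtain rfl : y' = y := Subsingleton.elim (α := PrimeSpectrum K) _ _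
        rw [hjB]
        exact hV.range_fromSpec.superset hy)
      obtain ⟨p₀, rfl⟩ := SpecAlg.exists_map_eq (C := K) p₀
      obtain ⟨d, m, hd, hm⟩ := IsPullbackBy.exists_local_matrix j hρ hf hβ (jB ≫ openIncl U)
        (fun p => ⟨_, _, by simpa using hσ (SpecAlg.map p ≫ jB), hM _⟩) p₀
      let loc := IsScalarTower.toAlgHom k Γ((openOver U).left, V) (Localization.Away d)
      refine ⟨_, SpecAlg.map loc ≫ jB, PGL.ofGL m, ?_, ?_, fun w => ?_⟩
      · exact inferInstanceAs (IsOpenImmersion ((SpecAlg.map loc).left ≫ jB.left))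
      · let p : Localization.Away d →ₐ[k] K :=
          IsLocalization.liftAlgHom (M := Submonoid.powers d) (f := p₀) (by
            rintro ⟨_, n, rfl⟩
            change IsUnit (p₀ (d ^ n))
            rw [map_pow]
            exact (IsUnit.mk0 _ hd).pow n)
        have hp : p.comp loc = p₀ := AlgHom.ext fun x => IsLocalization.lift_eq _ _
        exact ⟨SpecAlg.map p, by rw [← Category.assoc, ← SpecAlg.map_comp, hp, hp₀]⟩
      · obtain ⟨p, rfl⟩ := SpecAlg.exists_map_eq (C := K) w
        refine PGL.value_injective ?_
        have hp := hm p (σ (SpecAlg.map p ≫ SpecAlg.map loc ≫ jB)) (by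
          rw [SpecAlg.map_comp]
          simpa [loc] using hσ (SpecAlg.map p ≫ SpecAlg.map loc ≫ jB))
        obtain ⟨l, hl⟩ := hp.eq_smul hf (hM _)
        exact (PGL.value_map_ofGL m p).trans
          ((conj_eq_conj_of_eq_smul hl).trans (PGL.value_ofGL _).symm)
  refine ⟨t, fun z σ' M' hσ' hM' => ?_⟩
  obtain rfl := hσ'.unique hρ.isOver (hσ z)
  obtain ⟨l, hl⟩ := hM'.eq_smul hf (hM z)
  rw [ht z]
  exact (PGL.value_ofGL _).trans (conj_eq_conj_of_eq_smul hl).symm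

end

section

/-! ### Smooth descent and extension of homomorphisms from a dense open subset -/

open CartesianMonoidalCategory MonObj

variable {k K : Type u} [Field k] [Field K] [Algebra k K] [IsAlgClosed K]

/-- Descent of morphisms along a smooth surjection, with the descent condition checked on
geometric points. -/
lemma exists_descent_of_points {Z Y H : Over (Spec (.of k))} [Smooth Z.hom] [IsSeparated H.hom]
    (q : Z ⟶ Y) [Smooth q.left] [Surjective q.left] (θ : Z ⟶ H)
    (h : ∀ z z' : SpecExt k K ⟶ Z, z ≫ q = z' ≫ q → z ≫ θ = z' ≫ θ) :
    ∃ τ : Y ⟶ H, q ≫ τ = θ := by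
  let P : Over (Spec (.of k)) := Over.mk (pullback.fst q.left q.left ≫ Z.hom)
  let a : P ⟶ Z := Over.homMk (pullback.fst q.left q.left)
  have hab' : a.left ≫ q.left = pullback.snd q.left q.left ≫ q.left := pullback.condition
  let b : P ⟶ Z := Over.homMk (pullback.snd q.left q.left) (by
    rw [← Over.w q, ← Category.assoc, ← hab', Category.assoc, Over.w]
    rfl)
  have hab : a ≫ q = b ≫ q := Over.OverMorphism.ext hab'
  have : Smooth P.hom := inferInstanceAs (Smooth (pullback.fst q.left q.left ≫ Z.hom))
  have : AlgebraicGeometry.IsReduced P.left := isReduced_of_smooth_hom P.hom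
  have key : a ≫ θ = b ≫ θ := over_ext_of_points (K := K) (U := ⊤) dense_univ fun p _ => by
    rw [← Category.assoc, ← Category.assoc]
    refine h _ _ ?_
    rw [Category.assoc, hab, Category.assoc]
  have hd : ∀ {W : Scheme.{u}} (g₁ g₂ : W ⟶ Z.left), g₁ ≫ q.left = g₂ ≫ q.left →
      g₁ ≫ θ.left = g₂ ≫ θ.left := by
    intro W g₁ g₂ hg
    have h1 : pullback.fst q.left q.left ≫ θ.left = pullback.snd q.left q.left ≫ θ.left :=
      congrArg (fun q => q.left) key
    rw [← pullback.lift_fst g₁ g₂ hg, Category.assoc, h1, pullback.lift_snd_assoc]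
  have hfac : q.left ≫ EffectiveEpi.desc q.left θ.left hd = θ.left := EffectiveEpi.fac _ _ _
  refine ⟨Over.homMk (EffectiveEpi.desc q.left θ.left hd) ?_, Over.OverMorphism.ext hfac⟩
  rw [← cancel_epi q.left, ← Category.assoc, hfac, Over.w, Over.w]

section Group

variable {G H : Over (Spec (.of k))} [GrpObj G] [GrpObj H]

/-- Preservation of the unit is automatic in a group: the image of 1 is idempotent. -/
lemma isMonHom_of_mul {τ : G ⟶ H} (h : μ[G] ≫ τ = (τ ⊗ₘ τ) ≫ μ[H]) : IsMonHom τ := by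
  refine ⟨?_, h⟩
  have h1 : ∀ x y : 𝟙_ _ ⟶ G, (x * y) ≫ τ = (x ≫ τ) * (y ≫ τ) := fun x y => by
    change (lift x y ≫ μ[G]) ≫ τ = lift (x ≫ τ) (y ≫ τ) ≫ μ[H]
    rw [Category.assoc, h, lift_map_assoc]
  have h2 := h1 1 1
  rw [_root_.mul_one, left_eq_mul] at h2
  rw [MonObj.one_eq_one, MonObj.one_eq_one]
  exact h2

variable [Smooth G.hom] [IsSeparated H.hom]

/-- The morphism `(u, v) ↦ u v⁻¹`. -/
def divHom (G : Over (Spec (.of k))) [GrpObj G] : G ⊗ G ⟶ G := fst G G * (snd G G)⁻¹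

/-- It is the automorphism (u, v) ↦ (u v⁻¹, v) followed by the projection to the smooth scheme G. -/
lemma smooth_divHom : Smooth (divHom G).left := by
  let e : G ⊗ G ≅ G ⊗ G :=
    { hom := lift (divHom G) (snd _ _)
      inv := lift (fst _ _ * snd _ _) (snd _ _)
      hom_inv_id := by
        ext1
        · simp [MonObj.comp_mul, divHom]
        · simp
      inv_hom_id := by
        ext1
        · simp [MonObj.comp_mul, divHom, GrpObj.comp_inv]
        · simp }
  have h : divHom G = e.hom ≫ fst _ _ := by simp [e]
  have he : IsIso e.hom := e.isIso_hom
  have : IsIso e.hom.left := (Over.forget _).map_isIso e.hom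
  have : Smooth (fst G G).left := inferInstanceAs (Smooth (pullback.fst G.hom G.hom))
  rw [h]
  exact inferInstanceAs (Smooth (e.hom.left ≫ (fst G G).left))

/-- A homomorphism on geometric points which is given by a morphism on a dense open subset of a
smooth group scheme is given by a homomorphism of group schemes. -/
lemma exists_isMonHom_of_points {U : G.left.Opens} (hU : Dense (U : Set G.left))
    (t : openOver U ⟶ H) (φ : (SpecExt k K ⟶ G) →* (SpecExt k K ⟶ H))
    (ht : ∀ z : SpecExt k K ⟶ openOver U, z ≫ t = φ (z ≫ openIncl U)) :
    ∃ τ : G ⟶ H, IsMonHom τ ∧ ∀ g : SpecExt k K ⟶ G, g ≫ τ = φ g := by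
  -- V is U × U. On it t(u) t(v)⁻¹ is a morphism whose K-points depend only on u v⁻¹.
  let V : (G ⊗ G).left.Opens := ((fst G G).left ⁻¹ᵁ U) ⊓ ((snd G G).left ⁻¹ᵁ U)
  obtain ⟨a, ha⟩ := exists_lift_of_range_subset (openIncl U) (openIncl V ≫ fst G G) (by
    rintro _ ⟨x, rfl⟩
    exact ⟨⟨_, (show V.ι x ∈ V from x.2).1⟩, rfl⟩)
  obtain ⟨b, hb⟩ := exists_lift_of_range_subset (openIncl U) (openIncl V ≫ snd G G) (by
    rintro _ ⟨x, rfl⟩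
    exact ⟨⟨_, (show V.ι x ∈ V from x.2).2⟩, rfl⟩)
  let q : openOver V ⟶ G := openIncl V ≫ divHom G
  have hq : q = (openIncl V ≫ fst G G) * (openIncl V ≫ snd G G)⁻¹ := by
    rw [← GrpObj.comp_inv, ← MonObj.comp_mul]
    rfl
  let θ : openOver V ⟶ H := (a ≫ t) * (b ≫ t)⁻¹
  have hθ : ∀ z : SpecExt k K ⟶ openOver V, z ≫ θ = φ (z ≫ q) := fun z => by
    rw [MonObj.comp_mul, GrpObj.comp_inv, ← Category.assoc, ← Category.assoc, ht, ht, hq,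
      MonObj.comp_mul, GrpObj.comp_inv, map_mul, map_inv, Category.assoc, ha, Category.assoc, hb]
  have hdiv := smooth_divHom (G := G)
  have hq1 : Smooth q.left := inferInstanceAs (Smooth ((openIncl V).left ≫ (divHom G).left))
  have hGG : Smooth (G ⊗ G).hom := by
    change Smooth (pullback.fst G.hom G.hom ≫ G.hom)
    infer_instance
  have : Smooth (openOver V).hom := inferInstanceAs (Smooth (V.ι ≫ (G ⊗ G).hom))
  -- A point g equals (gw) w⁻¹ as soon as w and gw both lie in U.
  have hq2 : Surjective q.left := surjective_of_points (K := K) q fun g => by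
    classical
    obtain ⟨w, hw⟩ := exists_forall_mul_mem hU {1, g}
    have hw1 := hw 1 (by simp)
    have hw2 := hw g (by simp)
    rw [_root_.one_mul] at hw1
    obtain ⟨p, hp⟩ := exists_lift_of_range_subset (openIncl V) (lift (g * w) w) (by
      rintro _ ⟨x, rfl⟩
      refine ⟨⟨(lift (g * w) w).left x, ?_, ?_⟩, rfl⟩
      · have h1 := congrArg (fun q => q.left x) (lift_fst (g * w) w)
        exact (h1 ▸ hw2 ⟨x, rfl⟩ :)
      · have h1 := congrArg (fun q => q.left x) (lift_snd (g * w) w)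
        exact (h1 ▸ hw1 ⟨x, rfl⟩ :))
    refine ⟨p, ?_⟩
    rw [hq, MonObj.comp_mul, GrpObj.comp_inv, reassoc_of% hp, reassoc_of% hp, lift_fst, lift_snd,
      mul_inv_cancel_right]
  obtain ⟨τ, hτ⟩ := exists_descent_of_points (K := K) q θ fun z z' h => by rw [hθ, hθ, h]
  have hτφ : ∀ g : SpecExt k K ⟶ G, g ≫ τ = φ g := fun g => by
    obtain ⟨p, rfl⟩ := exists_surjective_lift q g
    rw [Category.assoc, hτ, hθ]
  refine ⟨τ, isMonHom_of_mul ?_, hτφ⟩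
  -- Multiplicativity is an equality of morphisms out of the reduced scheme G × G, so the
  -- multiplicativity of φ on K-points suffices.
  have : AlgebraicGeometry.IsReduced (G ⊗ G).left := isReduced_of_smooth_hom (G ⊗ G).hom
  refine over_ext_of_points (K := K) (U := ⊤) dense_univ fun p _ => ?_
  have h1 : p = lift (p ≫ fst _ _) (p ≫ snd _ _) := by simp
  rw [← Category.assoc, hτφ]
  conv_rhs => rw [h1]
  rw [lift_map_assoc, hτφ, hτφ]
  refine Eq.trans ?_ (map_mul φ (p ≫ fst _ _) (p ≫ snd _ _))
  conv_lhs => rw [h1]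
  rfl

end Group

end

section

/-! ### The homomorphism defined by a preserved linear system -/

open CartesianMonoidalCategory MonObj

lemma isSeparated_left {k : Type u} [Field k] (X : Over (Spec (.of k))) [IsSeparated X.hom] :
    X.left.IsSeparated := by
  rw [Scheme.isSeparated_iff, ← terminal.comp_from X.hom]
  infer_instance

/-- A rational action preserving a linear system at the general geometric points induces a
homomorphism to the projective linear group. -/
lemma exists_isMonHom_of_actsBy {k K : Type u} [Field k] [Field K] [Algebra k K] [IsAlgClosed K]
    {G X : Over (Spec (.of k))} [GrpObj G] [Smooth G.hom] [GeometricallyIntegral X.hom]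
    [LocallyOfFiniteType X.hom] [X.left.IsSeparated] {ρ : (G ⊗ X).left.RationalMap X.left}
    (hρ : IsRationalAction G X ρ) {N : ℕ} [NeZero N] (f : Fin N → RatFun X)
    (hf : LinearIndependent K fun i => ratFunMap X K (f i)) {U : G.left.Opens}
    (hU : Dense (U : Set G.left))
    (h : ∀ g : SpecExt k K ⟶ G, Set.range g.left ⊆ U →
      ∃ σ M, IsPullbackBy ρ g σ ∧ ActsBy (fun i => ratFunMap X K (f i)) σ M) :
    ∃ τ : G ⟶ PGL k N, IsMonHom τ ∧ ∀ (g : SpecExt k K ⟶ G) σ, IsPullbackBy ρ g σ →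
      ∃ M, ActsBy (fun i => ratFunMap X K (f i)) σ M ∧ PGL.value (g ≫ τ) = conj M := by
  classical
  obtain ⟨t, ht⟩ := exists_hom_of_actsBy hρ f hf h
  let S : Set (SpecExt k K ⟶ G) := {g | Set.range g.left ⊆ U}
  have hS : ∀ s : Finset (SpecExt k K ⟶ G), ∃ w, ∀ g ∈ s, g * w ∈ S :=
    fun s => exists_forall_mul_mem hU s
  have hlift : ∀ g : S, ∃ z : SpecExt k K ⟶ openOver U, z ≫ openIncl U = g := fun g =>
    exists_lift_of_range_subset _ _ (g.2.trans (Subtype.range_coe_subtype (p := (· ∈ U))).superset)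
  choose z hz using hlift
  -- Outside U the value 1 is arbitrary and plays no role.
  let T : (SpecExt k K ⟶ G) → (SpecExt k K ⟶ PGL k N) :=
    fun g => if hg : g ∈ S then z ⟨g, hg⟩ ≫ t else 1
  have hT : ∀ g ∈ S, ∀ σ M, IsPullbackBy ρ g σ → ActsBy (fun i => ratFunMap X K (f i)) σ M →
      PGL.value (T g) = conj M := fun g hg σ M hσ hM => by
    simp only [T, dif_pos hg]
    exact ht _ σ M (by rwa [hz]) hM
  obtain ⟨φ, hφ⟩ := exists_monoidHom_extension hS T fun g g' hg hg' hgg' => by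
    obtain ⟨σ, M, hσ, hM⟩ := h g hg
    obtain ⟨σ', M', hσ', hM'⟩ := h g' hg'
    obtain ⟨σ'', M'', hσ'', hM''⟩ := h _ hgg'
    obtain ⟨l, hl⟩ := (hM.comp hM' (hσ.mul_apply hρ hσ' hσ'')).eq_smul hf hM''
    refine PGL.value_injective ?_
    rw [PGL.value_mul, hT g hg σ M hσ hM, hT g' hg' σ' M' hσ' hM', hT _ hgg' σ'' M'' hσ'' hM'',
      ← map_mul, conj_eq_conj_of_eq_smul hl]
  obtain ⟨τ, hτ, hτφ⟩ := exists_isMonHom_of_points hU t φ fun x => by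
    have hx : x ≫ openIncl U ∈ S := range_comp_openIncl x
    have h1 : z ⟨_, hx⟩ = x := by
      have : Mono (openIncl U) :=
        (Over.forget _).mono_of_mono_map (inferInstanceAs (Mono (openIncl U).left))
      exact (cancel_mono (openIncl U)).1 (hz ⟨_, hx⟩)
    rw [hφ _ hx]
    simp only [T, dif_pos hx, h1]
  refine ⟨τ, hτ, fun g σ hσ => ?_⟩
  -- An arbitrary g with pull-back σ is written as (gw) w⁻¹ with both factors coming from U. Then σ
  -- is the pull-back of gw followed by the inverse of that of w, so the matrix of g is the product
  -- of those of gw and w⁻¹.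
  obtain ⟨w, hw⟩ := hS {1, g}
  have hw1 : w ∈ S := by simpa using hw 1 (by simp)
  have hw2 : g * w ∈ S := hw g (by simp)
  obtain ⟨σ', M', hσ', hM'⟩ := h w hw1
  obtain ⟨σ'', M'', hσ'', hM''⟩ := h _ hw2
  have hc : ∀ x, σ x = σ'.symm (σ'' x) := fun x => by
    rw [hσ.mul_apply hρ hσ' hσ'', σ'.symm_apply_apply]
  refine ⟨M'' * M'⁻¹, hM''.comp hM'.symm hc, ?_⟩
  have h1 : PGL.value (φ g) * PGL.value (φ w) = PGL.value (φ (g * w)) := by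
    rw [← PGL.value_mul, map_mul]
  rw [hφ w hw1, hφ _ hw2, hT w hw1 σ' M' hσ' hM', hT _ hw2 σ'' M'' hσ'' hM''] at h1
  rw [hτφ, map_mul, map_inv, eq_mul_inv_iff_mul_eq, h1]

end

end LinRep

end

theorem mainTheorem8 {k : Type u} [Field k]
    -- a connected (smooth) algebraic group over `k`
    (G : Over (Spec (.of k))) [GrpObj G] [Smooth G.hom] [QuasiCompact G.hom]
    [ConnectedSpace G.left]
    -- a normal, projective, geometrically integral variety over `k`
    (X : Over (Spec (.of k))) [GeometricallyIntegral X.hom] [LocallyOfFiniteType X.hom]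
    (hproj : LinRep.IsProjective X) (hnormal : LinRep.IsNormalScheme X.left)
    (hk : PerfectField k ∨
      LinRep.IsNormalScheme (LinRep.baseChange X (AlgebraicClosure k)).left)
    -- a rational action of `G` on `X`
    (ρ : (G ⊗ X).left.RationalMap X.left) (hρ : LinRep.IsRationalAction G X ρ)
    -- a linear system on `X` such that `(ρ_g)_* |D| = |D|` for general geometric points `g`
    (L : LinRep.LinearSystem X) (hL : L.NoFixedComponents)
    (hpres : ∃ U : G.left.Opens, Dense (U : Set G.left) ∧
      ∀ g : LinRep.SpecExt k (AlgebraicClosure k) ⟶ G, Set.range g.left ⊆ U →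
        ∃ σ, LinRep.IsPullbackBy ρ g σ ∧
          LinRep.IsPreservedBy (L.extend (AlgebraicClosure k)) σ)
    (N : ℕ) (b : Module.Basis (Fin N) k L.V) :
    ∃! τ : G ⟶ LinRep.PGL k N, IsMonHom τ ∧
      ∀ (g : LinRep.SpecExt k (AlgebraicClosure k) ⟶ G) σ, LinRep.IsPullbackBy ρ g σ →
        LinRep.IsPreservedBy (L.extend (AlgebraicClosure k)) σ ∧
        ∃ M : GL (Fin N) (AlgebraicClosure k), LinRep.Induces L b σ M ∧
          ∀ x, LinRep.act (LinRep.PGL.value (g ≫ τ)).1.1 x = M.1 * x * (M⁻¹).1 := by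
  let K := AlgebraicClosure k
  have hproper : IsProper X.hom := hproj.isProper
  have hsep : X.left.IsSeparated := LinRep.isSeparated_left X
  have hXK : LinRep.IsNormalScheme (LinRep.baseChange X K).left := by
    rcases hk with hk | hk
    · exact LinRep.isNormalScheme_baseChange K hnormal
    · exact hk
  have hN : NeZero N := L.neZero b
  obtain ⟨U, hU, hpres⟩ := hpres
  obtain ⟨τ, hτ, h⟩ := LinRep.exists_isMonHom_of_actsBy hρ (fun i => (b i : LinRep.RatFun X))
    (L.linearIndependent_ratBasis b) hU fun g hg => by
      obtain ⟨σ, hσ, hp⟩ := hpres g hg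
      obtain ⟨M, hM⟩ := LinRep.exists_actsBy_extend hXK b hp
      exact ⟨σ, M, hσ, hM⟩
  refine ⟨τ, ⟨hτ, fun g σ hσ => ?_⟩, fun τ' hτ' => ?_⟩
  · obtain ⟨M, hM, hv⟩ := h g σ hσ
    have hM' : LinRep.ActsBy (L.ratBasis b K) σ M := hM
    exact ⟨hM'.isPreservedBy_extend hXK, M, hM'.induces hXK, fun x => hv ▸ LinRep.act_conj M x⟩
  · have : AlgebraicGeometry.IsReduced G.left := LinRep.isReduced_of_smooth_hom G.hom
    -- At a K-point of U the values of the two homomorphisms are conjugations by matrices inducing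
    -- the same map on the members of |D|_K; such matrices are proportional and define the same
    -- conjugation.
    refine LinRep.over_ext_of_points (K := K) hU fun g hg => LinRep.PGL.value_injective ?_
    obtain ⟨σ, hσ, -⟩ := hpres g hg
    obtain ⟨M, hM, hv⟩ := h g σ hσ
    have hM' : LinRep.ActsBy (L.ratBasis b K) σ M := hM
    obtain ⟨-, M', hM'', hv'⟩ := hτ'.2 g σ hσ
    obtain ⟨l, hl⟩ := (hM'.induces hXK).eq_smul hXK hM''
    rw [hv, LinRep.eq_conj_of_act hv', LinRep.conj_eq_conj_of_eq_smul hl]
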